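/- Let $K$ be an algebraic function field of one variable with (full) constant field $\mathbb F_q$, let $\infty$ be a place of $K$ of odd degree, and let $A$ be the ring of elements of $K$ that are integral outside $\infty$. Let $K_\infty$ be the completion of $K$ at $\infty$, let $C_\infty$ be the completion of an algebraic closure of $K_\infty$, and let $G=GL_2(A)$ act on $\Omega=C_\infty\setminus K_\infty$ by linear fractional transformations. An element $\omega\in\Omega$ is called elliptic if its stabilizer in $G$ contains a non-scalar matrix; let $E(G)$ be the set of elliptic elements and $\mathrm{Ell}(G)=G\backslash E(G)$. Let $\widetilde K=\mathbb F_{q^2}K\subset C_\infty$, with conjugation $\overline{a+\varepsilon b}=a+\varepsilon^q b$ for $a,b\in K$ and $\varepsilon\in\mathbb F_{q^2}\setminus\mathbb F_q$, and let $\widetilde A$ be the integral closure of $A$ in $\widetilde K$. Let $\mathrm{Ell}(G)_2\subseteq\mathrm{Ell}(G)$ be the set of orbits of those elliptic $\omega$ for which $\overline\omega$ lies in the $G$-orbit of $\omega$. The rings $A$ and $\widetilde A$ are Dedekind domains. Let $\overline N:\mathrm{Cl}(\widetilde A)\to\mathrm{Cl}(A)$ and $\overline N:\mathrm{Cl}^0(\widetilde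 K)\to\mathrm{Cl}^0(K)$ be the homomorphisms of ideal class groups and of degree-$0$ divisor class groups induced by the norm of ideals and of divisors (a prime $\widetilde P$ above $P$ is mapped to $P^{f(\widetilde P/P)}$, with $f$ the inertia degree). For every choice of $\varepsilon\in\mathbb F_{q^2}\setminus\mathbb F_q$, every elliptic $\omega$ can be written as $\omega=(\varepsilon+s)/t$ with $s,t\in A$, $t\ne 0$ and $(\varepsilon^q+s)(\varepsilon+s)\in tA$; then $J_\omega=tA+(\varepsilon+s)A$ is a nonzero ideal of $\widetilde A$, and $\omega\mapsto[J_\omega]$ induces a well-defined map $\mathrm{Ell}(G)\to\mathrm{Cl}(\widetilde A)$, independent of $\varepsilon$, which is a bijection from $\mathrm{Ell}(G)$ onto $\ker\big(\overline N:\mathrm{Cl}(\widetilde A)\to\mathrm{Cl}(A)\big)$. **Theorem 2.8.** This bijection restricts to a bijection from $\mathrm{Ell}(G)_2$ onto the $2$-torsion subgroup $\{c\in\ker\overline N : c^2=1\}$ of the kernel of $\overline N$ in $\mathrm{Cl}(\widetilde A)$. Equivalently, the canonical homomorphism $\mathrm{Cl}^0(\widetilde K)\to\mathrm{Cl}(\widetilde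 A)$ (omit from a divisor the part above $\infty$) maps the kernel of $\overline N$ in $\mathrm{Cl}^0(\widetilde K)$ bijectively onto the kernel of $\overline N$ in $\mathrm{Cl}(\widetilde A)$, and the resulting bijection from $\mathrm{Ell}(G)$ onto the kernel of $\overline N$ in $\mathrm{Cl}^0(\widetilde K)$ restricts to a bijection from $\mathrm{Ell}(G)_2$ onto the $2$-torsion subgroup of that kernel. In particular, the cardinalities $|\mathrm{Ell}(G)|$ and $|\mathrm{Ell}(G)_2|$ depend only on $K$: they are the same for any two places $\infty$ of odd degree of $K$. -/

import Mathlib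

open scoped WithZero

noncomputable section

set_option linter.unusedSectionVars false

namespace DrinfeldElliptic

/-! ### Function fields, places, divisors -/

/-- `K` is an algebraic function field of one variable over `k`, and `k` is its full field of
constants. -/
structure IsFunctionField (k K : Type*) [Field k] [Field K] [Algebra k K] : Prop where
  exists_finite : ∃ t : K, Transcendental k t ∧
    FiniteDimensional (IntermediateField.adjoin k {t}) K
  constants : ∀ x : K, IsAlgebraic k x → x ∈ Set.range (algebraMap k K)

/-- A place of a function field `F / k`: a discrete valuation ring containing `k` whose field of
fractions is `F`. -/
@[ext]
structure Place (k F : Type*) [Field k] [Field F] [Algebra k F] where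
  /-- the valuation ring of the place -/
  ring : ValuationSubring F
  algebraMap_mem : ∀ a : k, algebraMap k F a ∈ ring
  dvr : IsDiscreteValuationRing ring

namespace Place

section Basic

variable {k F : Type*} [Field k] [Field F] [Algebra k F]

instance (P : Place k F) : IsDiscreteValuationRing P.ring := P.dvr

/-- The normalized discrete valuation of a place, written multiplicatively. -/
def valuation (P : Place k F) : Valuation F ℤᵐ⁰ :=
  (IsDiscreteValuationRing.maximalIdeal P.ring).valuation F

/-- The order (normalized additive valuation) of a nonzero element at a place. -/
def ord (P : Place k F) (x : F) : ℤ := -WithZero.log (P.valuation x)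

lemma ord_mul (P : Place k F) {x y : F} (hx : x ≠ 0) (hy : y ≠ 0) :
    P.ord (x * y) = P.ord x + P.ord y := by
  have hx' : P.valuation x ≠ 0 := (Valuation.ne_zero_iff _).2 hx
  have hy' : P.valuation y ≠ 0 := (Valuation.ne_zero_iff _).2 hy
  simp only [ord, map_mul, WithZero.log_mul hx' hy']
  ring

lemma ord_one (P : Place k F) : P.ord 1 = 0 := by simp [ord]

lemma mem_ring_iff (P : Place k F) (x : F) : x ∈ P.ring ↔ P.valuation x ≤ 1 := by
  constructor
  · intro hx
    exact (IsDiscreteValuationRing.maximalIdeal P.ring).valuation_le_one (⟨x, hx⟩ : P.ring)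
  · intro hx
    obtain ⟨a, rfl⟩ := IsDiscreteValuationRing.exists_lift_of_le_one hx
    exact a.2

lemma ring_ne_top (P : Place k F) : P.ring ≠ ⊤ := by
  intro h
  refine IsDiscreteValuationRing.not_isField P.ring ⟨⟨0, 1, zero_ne_one⟩, mul_comm, ?_⟩
  intro a ha
  refine ⟨⟨(a : F)⁻¹, h.ge trivial⟩, Subtype.ext ?_⟩
  exact mul_inv_cancel₀ (fun h0 => ha (Subtype.ext h0))

/-- The degree of a place: the degree of its residue field over `k`. -/
def degree (P : Place k F) : ℕ :=
  letI : Algebra k (IsLocalRing.ResidueField P.ring) :=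
    ((IsLocalRing.residue P.ring).comp
      ((algebraMap k F).codRestrict P.ring.toSubring P.algebraMap_mem)).toAlgebra
  Module.finrank k (IsLocalRing.ResidueField P.ring)

end Basic

section Extension

variable {k F E : Type*} [Field k] [Field F] [Field E] [Algebra k F] [Algebra k E] [Algebra F E]
  [IsScalarTower k F E]

lemma isDiscreteValuationRing_comap [Algebra.IsAlgebraic F E] (Q : Place k E) :
    IsDiscreteValuationRing (Q.ring.comap (algebraMap F E)) := by
  let w : Valuation F ℤᵐ⁰ := Q.valuation.comap (algebraMap F E)
  have hw : w.valuationSubring = Q.ring.comap (algebraMap F E) := by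
    ext x
    rw [Valuation.mem_valuationSubring_iff, ValuationSubring.mem_comap, Q.mem_ring_iff]
    rfl
  have hx : ∃ x : F, 1 < w x := by
    by_contra! h
    apply Q.ring_ne_top
    rw [eq_top_iff]
    intro y _
    have hy : IsIntegral F y := Algebra.IsIntegral.isIntegral y
    obtain ⟨p, hp, hpy⟩ := hy
    let f : F →+* Q.ring :=
      (algebraMap F E).codRestrict Q.ring.toSubring (fun a => (Q.mem_ring_iff _).2 (h a))
    have hint : IsIntegral Q.ring y := by
      refine ⟨p.map f, hp.map f, ?_⟩
      rw [Polynomial.eval₂_map]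
      exact hpy
    obtain ⟨z, hz⟩ := IsIntegrallyClosed.isIntegral_iff.1 hint
    rw [← hz]
    exact z.2
  obtain ⟨x, hx⟩ := hx
  have hx0 : w x ≠ 0 := fun h => by simp [h] at hx
  have : Nontrivial (MonoidWithZeroHom.valueGroup (.ofClass w)) := by
    rw [Subgroup.nontrivial_iff_exists_ne_one]
    refine ⟨Units.mk0 (w x) hx0, ?_, ?_⟩
    · apply MonoidWithZeroHom.mem_valueGroup
      exact ⟨x, rfl⟩
    · intro h
      have := congrArg Units.val h
      simp only [Units.val_mk0, Units.val_one] at this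
      exact hx.ne' this
  have : w.IsRankOneDiscrete := inferInstance
  rw [← hw]
  infer_instance

variable (F) in
/-- The place of `F` below a place of the extension `E`. -/
def under [Algebra.IsAlgebraic F E] (Q : Place k E) : Place k F where
  ring := Q.ring.comap (algebraMap F E)
  algebraMap_mem a := by
    rw [ValuationSubring.mem_comap, ← IsScalarTower.algebraMap_apply k F E]
    exact Q.algebraMap_mem a
  dvr := Q.isDiscreteValuationRing_comap

variable (F) in
/-- The inclusion of the valuation ring below into the valuation ring above. -/
def ringMap [Algebra.IsAlgebraic F E] (Q : Place k E) : (Q.under F).ring →+* Q.ring :=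
  ((algebraMap F E).comp (Q.under F).ring.subtype).codRestrict Q.ring.toSubring (fun x => x.2)

instance [Algebra.IsAlgebraic F E] (Q : Place k E) : IsLocalHom (Q.ringMap F) where
  map_nonunit x hx := by
    obtain ⟨y, hy⟩ := hx.exists_right_inv
    have hy' : algebraMap F E (x : F) * (y : E) = 1 := congrArg Subtype.val hy
    have hx0 : (x : F) ≠ 0 := by
      intro h
      rw [h, map_zero, zero_mul] at hy'
      exact zero_ne_one hy'
    have hyx : (y : E) = algebraMap F E ((x : F)⁻¹) := by
      rw [map_inv₀]
      exact eq_inv_of_mul_eq_one_right hy'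
    refine IsUnit.of_mul_eq_one ⟨(x : F)⁻¹, ?_⟩ (Subtype.ext (mul_inv_cancel₀ hx0))
    change algebraMap F E ((x : F)⁻¹) ∈ Q.ring
    rw [← hyx]
    exact y.2

variable (F) in
/-- The inertia degree of a place over the place below it: the degree of the extension of residue
fields. -/
def inertiaDeg [Algebra.IsAlgebraic F E] (Q : Place k E) : ℕ :=
  letI := (IsLocalRing.ResidueField.map (Q.ringMap F)).toAlgebra
  Module.finrank (IsLocalRing.ResidueField (Q.under F).ring) (IsLocalRing.ResidueField Q.ring)

end Extension

end Place

/-- The divisor group of `F / k`. -/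
abbrev Divisor (k F : Type*) [Field k] [Field F] [Algebra k F] := Place k F →₀ ℤ

section Divisors

variable (k F : Type*) [Field k] [Field F] [Algebra k F]

/-- The degree of a divisor, computed over `k`. If `k` is not the full constant field of `F`, this
is a fixed positive multiple of the degree over the constant field, so that the divisors of
degree `0` are the same. -/
def divisorDegree : Divisor k F →+ ℤ :=
  Finsupp.liftAddHom fun P => AddMonoidHom.mulRight (P.degree : ℤ)

/-- The divisors of degree `0`. -/
def degreeZero : AddSubgroup (Divisor k F) := (divisorDegree k F).ker

/-- The principal divisors. -/
def principalDivisors : AddSubgroup (Divisor k F) where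
  carrier := {D | ∃ f : F, f ≠ 0 ∧ ∀ P : Place k F, D P = P.ord f}
  zero_mem' := ⟨1, one_ne_zero, fun P => P.ord_one.symm⟩
  add_mem' := by
    rintro D E ⟨f, hf, hD⟩ ⟨g, hg, hE⟩
    exact ⟨f * g, mul_ne_zero hf hg, fun P => by rw [P.ord_mul hf hg, ← hD, ← hE]; rfl⟩
  neg_mem' := by
    rintro D ⟨f, hf, hD⟩
    refine ⟨f⁻¹, inv_ne_zero hf, fun P => ?_⟩
    have h := P.ord_mul hf (inv_ne_zero hf)
    rw [mul_inv_cancel₀ hf, P.ord_one] at h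
    rw [Finsupp.neg_apply, hD]
    linarith

/-- The divisor class group of degree `0`. -/
abbrev Cl0 := degreeZero k F ⧸ (principalDivisors k F).addSubgroupOf (degreeZero k F)

variable {k F}

/-- The class of a divisor of degree `0`. -/
def Cl0.mk (D : degreeZero k F) : Cl0 k F := QuotientAddGroup.mk D

variable {E : Type*} [Field E] [Algebra k E] [Algebra F E] [IsScalarTower k F E]

variable (F) in
/-- The norm of divisors: a place `Q` of `E` over the place `P` of `F` goes to `f(Q/P) P`. -/
def divisorNorm [Algebra.IsAlgebraic F E] (D : Divisor k E) : Divisor k F :=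
  D.sum fun Q n => Finsupp.single (Q.under F) (n * (Q.inertiaDeg F : ℤ))

end Divisors

/-! ### The rings `A` and `Ã` -/

/-- The ring `A` of all elements of `K` that are integral outside the place `inf`. -/
def ringA {k K : Type*} [Field k] [Field K] [Algebra k K] (inf : Place k K) : Subalgebra k K where
  carrier := {x | ∀ P : Place k K, P ≠ inf → x ∈ P.ring}
  mul_mem' hx hy P hP := P.ring.mul_mem _ _ (hx P hP) (hy P hP)
  add_mem' hx hy P hP := P.ring.add_mem _ _ (hx P hP) (hy P hP)
  algebraMap_mem' a P _ := P.algebraMap_mem a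

section Extension

variable {k K : Type*} (L : Type*) [Field k] [Field K] [Field L] [Algebra k K] [Algebra K L]

/-- The ring `Ã`, the integral closure of `A` in `L`. -/
abbrev ringAt (inf : Place k K) : Subalgebra (ringA inf) L := integralClosure (ringA inf) L

variable {L} [Algebra k L] [IsScalarTower k K L] [Algebra.IsAlgebraic K L]

lemma ringAt_le {inf : Place k K} {Q : Place k L} (hQ : Q.under K ≠ inf) (x : ringAt L inf) :
    (x : L) ∈ Q.ring := by
  obtain ⟨p, hp, hpx⟩ := x.2
  let f : ringA inf →+* Q.ring :=
    ((algebraMap K L).comp (ringA inf).val.toRingHom).codRestrict Q.ring.toSubring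
      (fun a => a.2 _ hQ)
  have hint : IsIntegral Q.ring (x : L) := by
    refine ⟨p.map f, hp.map f, ?_⟩
    rw [Polynomial.eval₂_map]
    exact hpx
  obtain ⟨z, hz⟩ := IsIntegrallyClosed.isIntegral_iff.1 hint
  rw [← hz]
  exact z.2

/-- The prime ideal of `Ã` attached to a place of `L` that does not lie above `inf`: the
intersection of `Ã` with the maximal ideal of the valuation ring. -/
def placeIdeal {inf : Place k K} (Q : Place k L) (hQ : Q.under K ≠ inf) : Ideal (ringAt L inf) :=
  (IsLocalRing.maximalIdeal Q.ring).comap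
    ((ringAt L inf).val.toRingHom.codRestrict Q.ring.toSubring (ringAt_le hQ))

end Extension

open scoped Classical in
/-- The class of a nonzero ideal in the ideal class group (with value `1` on the zero ideal). -/
def idealClass {R : Type*} [CommRing R] [IsDedekindDomain R] (J : Ideal R) : ClassGroup R :=
  if h : J = ⊥ then 1 else ClassGroup.mk0 ⟨J, mem_nonZeroDivisors_iff_ne_zero.2 h⟩

open scoped Classical in
/-- The class in `Cl(Ã)` of the fractional ideal obtained from the divisor `∏ Q ^ (e_Q)` of `L` by
omitting the places above `inf`. -/
def divisorIdealClass {k K L : Type*} [Field k] [Field K] [Field L] [Algebra k K] [Algebra K L]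
    [Algebra k L] [IsScalarTower k K L] [Algebra.IsAlgebraic K L] (inf : Place k K)
    [IsDedekindDomain (ringAt L inf)] (D : Divisor k L) : ClassGroup (ringAt L inf) :=
  D.prod fun Q e => if hQ : Q.under K = inf then 1 else idealClass (placeIdeal Q hQ) ^ e

/-! ### The Drinfeld upper half-plane -/

section HalfPlane

variable {k K : Type*} [Field k] [Field K] [Algebra k K]

/-- The absolute value `x ↦ 2 ^ (-ν(x))` attached to a place. (The choice of the base does not
affect the topology.) -/
def Place.abv (P : Place k K) : AbsoluteValue K ℝ :=
  (IsDiscreteValuationRing.maximalIdeal P.ring).adicAbv (K := K) (b := 2) one_lt_two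

lemma Place.isNonarchimedean_abv (P : Place k K) : IsNonarchimedean P.abv :=
  (IsDiscreteValuationRing.maximalIdeal P.ring).isNonarchimedean_adicAbv one_lt_two

lemma Place.exists_one_lt_abv (P : Place k K) : ∃ x : K, 1 < P.abv x := by
  obtain ⟨π, hπ⟩ := IsDiscreteValuationRing.exists_irreducible P.ring
  have h1 : P.abv (algebraMap P.ring K π) < 1 :=
    ((IsDiscreteValuationRing.maximalIdeal P.ring).adicAbv_coe_lt_one_iff one_lt_two π).2
      ((IsLocalRing.mem_maximalIdeal _).2 hπ.not_isUnit)
  have h0 : algebraMap P.ring K π ≠ 0 := fun h => hπ.ne_zero (Subtype.ext h)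
  refine ⟨(algebraMap P.ring K π)⁻¹, ?_⟩
  rw [map_inv₀]
  exact (one_lt_inv₀ (P.abv.pos h0)).2 h1

/-- The completion `K_∞` of `K` at the place `inf`. -/
abbrev Kinf (inf : Place k K) := inf.abv.Completion

instance (inf : Place k K) : IsUltrametricDist (WithAbs inf.abv) :=
  IsUltrametricDist.isUltrametricDist_of_isNonarchimedean_norm
    fun x y => inf.isNonarchimedean_abv x.ofAbs y.ofAbs

instance (inf : Place k K) : IsUltrametricDist (Kinf inf) where
  dist_triangle_max x y z := by
    induction x, y, z using UniformSpace.Completion.induction_on₃ with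
    | hp => exact isClosed_le (by fun_prop) (by fun_prop)
    | ih a b c =>
      simp only [UniformSpace.Completion.dist_eq]
      exact dist_triangle_max a b c

instance (inf : Place k K) : NontriviallyNormedField (Kinf inf) where
  non_trivial := by
    obtain ⟨x, hx⟩ := inf.exists_one_lt_abv
    refine ⟨((WithAbs.toAbs inf.abv x : WithAbs inf.abv) : Kinf inf), ?_⟩
    rw [UniformSpace.Completion.norm_coe]
    exact hx

/-- An algebraic closure of `K_∞`, with the unique extension of the absolute value. -/
abbrev KinfAlg (inf : Place k K) := AlgebraicClosure (Kinf inf)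

instance (inf : Place k K) : NormedField (KinfAlg inf) :=
  spectralNorm.normedField (Kinf inf) (KinfAlg inf)

/-- The field `C_∞`, the completion of an algebraic closure of `K_∞`. -/
def Cinf (inf : Place k K) := UniformSpace.Completion (KinfAlg inf)

instance (inf : Place k K) : NormedField (Cinf inf) :=
  inferInstanceAs (NormedField (UniformSpace.Completion (KinfAlg inf)))

/-- The embedding of `K` into `K_∞`. -/
def toKinf (inf : Place k K) : K →+* Kinf inf :=
  (UniformSpace.Completion.coeRingHom (α := WithAbs inf.abv)).comp
    (WithAbs.equiv inf.abv).symm.toRingHom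

/-- The embedding of `K_∞` into `C_∞`. -/
def Kinf.toCinf (inf : Place k K) : Kinf inf →+* Cinf inf :=
  (UniformSpace.Completion.coeRingHom (α := KinfAlg inf)).comp
    (algebraMap (Kinf inf) (KinfAlg inf))

instance (inf : Place k K) : Algebra K (Cinf inf) :=
  ((Kinf.toCinf inf).comp (toKinf inf)).toAlgebra

/-- Drinfeld's upper half-plane `Ω = C_∞ - K_∞`. -/
def Omega (inf : Place k K) := {z : Cinf inf // z ∉ Set.range (Kinf.toCinf inf)}

/-- The Drinfeld modular group `G = GL₂(A)`. -/
abbrev ModularGroup (inf : Place k K) := GL (Fin 2) (ringA inf)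

/-- The entries of an element of `G`, as elements of `C_∞`. -/
def entry {inf : Place k K} (g : ModularGroup inf) (i j : Fin 2) : Cinf inf :=
  algebraMap K (Cinf inf) ((g.val i j : ringA inf) : K)

/-- The linear fractional transformation `z ↦ (a z + b) / (c z + d)`. -/
def moebius {inf : Place k K} (g : ModularGroup inf) (z : Cinf inf) : Cinf inf :=
  (entry g 0 0 * z + entry g 0 1) / (entry g 1 0 * z + entry g 1 1)

lemma entry_mem {inf : Place k K} (g : ModularGroup inf) (i j : Fin 2) :
    entry g i j ∈ (Kinf.toCinf inf).fieldRange := ⟨toKinf inf (g.val i j : ringA inf), rfl⟩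

lemma entry_one {inf : Place k K} (i j : Fin 2) :
    entry (1 : ModularGroup inf) i j = if i = j then 1 else 0 := by
  unfold entry
  rw [Units.val_one, Matrix.one_apply]
  split_ifs <;> simp

lemma entry_mul {inf : Place k K} (g h : ModularGroup inf) (i j : Fin 2) :
    entry (g * h) i j = entry g i 0 * entry h 0 j + entry g i 1 * entry h 1 j := by
  simp [entry, Units.val_mul, Matrix.mul_apply, Fin.sum_univ_two]

lemma det_ne_zero {inf : Place k K} (g : ModularGroup inf) :
    entry g 0 0 * entry g 1 1 - entry g 0 1 * entry g 1 0 ≠ 0 := by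
  have h : entry g 0 0 * entry g 1 1 - entry g 0 1 * entry g 1 0
      = algebraMap K (Cinf inf) ((g.val.det : ringA inf) : K) := by
    simp [entry, Matrix.det_fin_two]
  rw [h]
  intro h0
  have h1 : ((g.val.det : ringA inf) : K) = 0 := by
    rwa [map_eq_zero_iff _ (algebraMap K (Cinf inf)).injective] at h0
  have h2 : (g.val.det : ringA inf) = 0 := Subtype.ext h1
  have h3 : IsUnit (g.val.det : ringA inf) := (Matrix.isUnit_iff_isUnit_det _).1 g.isUnit
  rw [h2] at h3
  exact not_isUnit_zero h3

lemma denom_ne_zero {inf : Place k K} (g : ModularGroup inf) (z : Omega inf) :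
    entry g 1 0 * z.1 + entry g 1 1 ≠ 0 := by
  intro h
  by_cases hc : entry g 1 0 = 0
  · have hd : entry g 1 1 = 0 := by simpa [hc] using h
    exact det_ne_zero g (by rw [hc, hd]; ring)
  · apply z.2
    have hz : z.1 = -entry g 1 1 / entry g 1 0 := by
      rw [eq_div_iff hc]
      linear_combination h
    have hm : z.1 ∈ (Kinf.toCinf inf).fieldRange := by
      rw [hz]
      exact div_mem (neg_mem (entry_mem g 1 1)) (entry_mem g 1 0)
    exact hm

lemma moebius_mem {inf : Place k K} (g : ModularGroup inf) (z : Omega inf) :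
    moebius g z.1 ∉ Set.range (Kinf.toCinf inf) := by
  intro h
  have hy : moebius g z.1 ∈ (Kinf.toCinf inf).fieldRange := h
  have hden := denom_ne_zero g z
  have heq : entry g 0 0 * z.1 + entry g 0 1
      = moebius g z.1 * (entry g 1 0 * z.1 + entry g 1 1) := by
    rw [moebius, div_mul_cancel₀ _ hden]
  generalize moebius g z.1 = y at hy heq
  by_cases hc : entry g 0 0 - y * entry g 1 0 = 0
  · refine det_ne_zero g ?_
    linear_combination (entry g 1 1 + z.1 * entry g 1 0) * hc - entry g 1 0 * heq
  · apply z.2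
    have hz : z.1 = (y * entry g 1 1 - entry g 0 1) / (entry g 0 0 - y * entry g 1 0) := by
      rw [eq_div_iff hc]
      linear_combination heq
    have hm : z.1 ∈ (Kinf.toCinf inf).fieldRange := by
      rw [hz]
      exact div_mem (sub_mem (mul_mem hy (entry_mem g 1 1)) (entry_mem g 0 1))
        (sub_mem (entry_mem g 0 0) (mul_mem hy (entry_mem g 1 0)))
    exact hm

/-- The action of `G` on `Ω` by linear fractional transformations. -/
instance (inf : Place k K) : MulAction (ModularGroup inf) (Omega inf) where
  smul g z := ⟨moebius g z.1, moebius_mem g z⟩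
  one_smul z := Subtype.ext (by
    change moebius 1 z.1 = z.1
    simp [moebius, entry_one])
  mul_smul g h z := Subtype.ext (by
    change moebius (g * h) z.1 = moebius g (moebius h z.1)
    have h1 := denom_ne_zero (g * h) z
    have h2 := denom_ne_zero h z
    have h3 := denom_ne_zero g ⟨moebius h z.1, moebius_mem h z⟩
    simp only [moebius, entry_mul] at h1 h3 ⊢
    rw [div_eq_div_iff h1 h3]
    field_simp
    ring)

/-- `ω ∈ Ω` is elliptic if its stabilizer in `G` contains a non-scalar matrix. -/
def IsElliptic {inf : Place k K} (ω : Omega inf) : Prop :=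
  ∃ g ∈ MulAction.stabilizer (ModularGroup inf) ω,
    ∀ a : ringA inf, g.val ≠ Matrix.scalar (Fin 2) a

/-- The set `E(G)` of elliptic elements. -/
abbrev EllipticElement (inf : Place k K) := {ω : Omega inf // IsElliptic ω}

/-- `G`-equivalence of elliptic elements. -/
instance ellipticSetoid (inf : Place k K) : Setoid (EllipticElement inf) :=
  (MulAction.orbitRel (ModularGroup inf) (Omega inf)).comap Subtype.val

/-- The set `Ell(G) = G \ E(G)` of elliptic points. -/
abbrev Ell (inf : Place k K) := Quotient (ellipticSetoid inf)

/-- `ω'` is the conjugate of `ω`: for some `ε ∈ 𝔽_{q²}` and `a, b ∈ K` one has `ω = a + ε b` and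
`ω' = a + ε ^ q b`. -/
def IsConjugate {inf : Place k K} (ω ω' : Omega inf) : Prop :=
  ∃ (ε : Cinf inf) (a b : K), ε ^ (Nat.card k ^ 2) = ε ∧
    ω.1 = algebraMap K _ a + ε * algebraMap K _ b ∧
    ω'.1 = algebraMap K _ a + ε ^ Nat.card k * algebraMap K _ b

/-- The subset `Ell(G)₂` of the orbits of elliptic elements `ω` that are `G`-equivalent to their
conjugate. -/
def Ell2 (inf : Place k K) : Set (Ell inf) :=
  {x | ∃ ω ω' : EllipticElement inf, Quotient.mk _ ω = x ∧ IsConjugate ω.1 ω'.1 ∧ ω' ≈ ω}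

/-- `ω = (ε + s) / t` with `s, t ∈ A`, `t ≠ 0`, and `(ε ^ q + s)(ε + s) ∈ t A`. Here `ε` is an
element of `L = 𝔽_{q²} K`, which is embedded in `C_∞` by `ι`. -/
def IsRepresentation {L : Type*} [Field L] [Algebra K L] {inf : Place k K} (ι : L →ₐ[K] Cinf inf)
    (ε : L) (s t : ringA inf) (ω : Omega inf) : Prop :=
  t ≠ 0 ∧ ω.1 = ι ((ε + algebraMap K L s) / algebraMap K L t) ∧
    ∃ t' : ringA inf, (ε ^ Nat.card k + algebraMap K L s) * (ε + algebraMap K L s)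
      = algebraMap K L t * algebraMap K L t'

end HalfPlane

end DrinfeldElliptic

end

noncomputable section

set_option linter.unusedSectionVars false

/-! ### Fields of one variable: finiteness of quotients and Dedekind subrings -/

namespace DrinfeldElliptic

open IntermediateField Polynomial

/-! Write `k = 𝔽_q`, `L = 𝔽_{q²} K`, and let `ε` generate `𝔽_{q²}` over `𝔽_q`.

If a non-scalar `g` in `GL₂(A)` with bottom row `(c, d)` fixes `ω`, then `(ω, 1)` is an eigenvector
with eigenvalue `x = c ω + d`, and `c ≠ 0`, so `x` is not in `K_∞`. The determinant of `g` is a unit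
of `A`, hence a constant. The characteristic polynomial is irreducible over the complete field `K_∞`
and has integral constant term, so its trace is integral at `∞`; being in `A`, the trace is constant
too (`isQuadConst_of_quadratic`). Thus `x` lies in `𝔽_{q²}`, and solving for `ω` gives `ω = (ε + s)
/ t`, where the norm condition says that `t A + (ε + s) A` is stable under `ε`, that is, an ideal of
`Ã = A + A ε`.

Equality of two such ideal classes is a change of `A`-basis up to scaling, which is exactly
`G`-equivalence (`IsEtaleGenerator.idealClass_latticeIdeal_eq_iff`). The image is the kernel of the
norm because `ε^q - ε` is a unit of `Ã`: every nonzero ideal is `J = I₁ + I₂ (ε + s)`, its norm is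
`I₁ I₂`, and if this is principal then `J` is free over `A` (`exists_isLattice`, `relNorm_eq`,
`exists_basis`). The odd degree of `∞` keeps `ε` out of `K_∞`, so each such ideal does give a point
of `Ω`. Conjugating `ω` conjugates the ideal, and `J J̄ = t Ã` is principal, so conjugation inverts
the class. Therefore `ω` is equivalent to its conjugate exactly when the class is its own inverse
(`mem_Ell2_iff`).

For divisors, every place of `L` has even degree, so `∞` is inert with a single place `Q_∞` above
it. A divisor of degree `0` is determined up to principal divisors by its class away from `Q_∞`,
which gives injectivity of the canonical map. If `N J = (a)`, comparing parities in the product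
formula shows that `ord_∞ a` is even, and half of it is the multiple of `Q_∞` that completes `J` to
a divisor of degree `0` with principal norm. The kernel in `Cl⁰(L)` does not involve `∞`, whence the
independence of the cardinalities.

The foundations (Dedekind property of `A`, nonconstant elements of `A`, degree `0` of principal
divisors) come from one counting device in place of Riemann–Roch: polynomials in `y` of degree `< m`
with coefficients in a basis over `k(y)` form a space of dimension `[F : k(y)] m` with poles bounded
by those of `y ^ (m + C)`. -/

/-- `F` is finitely generated of transcendence degree at most one over `k`, in the form in which
it is used below. -/
class OneVariable (k F : Type*) [Field k] [Field F] [Algebra k F] : Prop where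
  finite_adjoin : ∀ y : F, Transcendental k y → FiniteDimensional k⟮y⟯ F

section OneVariable

variable {k F : Type*} [Field k] [Field F] [Algebra k F]

lemma isTranscendenceBasis_of_finite {t : F} (ht : Transcendental k t)
    [FiniteDimensional k⟮t⟯ F] : IsTranscendenceBasis k (fun _ : Unit => t) := by
  rw [isTranscendenceBasis_iff_algebraicIndependent_isAlgebraic]
  refine ⟨(algebraicIndependent_singleton_iff ()).2 ht, ?_⟩
  rw [Set.range_const]
  have : Algebra.IsAlgebraic k⟮t⟯ F := inferInstance
  open scoped IntermediateField.algebraAdjoinAdjoin in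
  exact (IsFractionRing.comap_isAlgebraic_iff (A := Algebra.adjoin k {t}) (K := k⟮t⟯)).2 this

/-- The transcendence degree is one, so any transcendental `y` is a transcendence basis. An
algebraic extension of `k(y)` that is finitely generated as a field is finite. -/
lemma OneVariable.of_finite {t : F} (ht : Transcendental k t) [FiniteDimensional k⟮t⟯ F] :
    OneVariable k F where
  finite_adjoin y hy := by
    have hb := isTranscendenceBasis_of_finite ht
    have hy' : AlgebraicIndependent k (fun _ : Unit => y) :=
      (algebraicIndependent_singleton_iff ()).2 hy
    have hyb := hy'.isTranscendenceBasis_of_lift_trdeg_le_of_finite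
      hb.lift_cardinalMk_eq_trdeg.ge
    have halg := hyb.isAlgebraic_field
    rw [Set.range_const] at halg
    have : Algebra.EssFiniteType k k⟮t⟯ := essFiniteType_iff.2 ⟨{t}, by simp⟩
    have : Algebra.EssFiniteType k F := Algebra.EssFiniteType.comp k k⟮t⟯ F
    have : Algebra.EssFiniteType k⟮y⟯ F := Algebra.EssFiniteType.of_comp k k⟮y⟯ F
    exact Algebra.finite_of_essFiniteType_of_isAlgebraic


/-- A finite extension of a field of one variable is of one variable. -/
lemma OneVariable.of_extension {K L : Type*} [Field K] [Field L] [Algebra k K] [Algebra k L]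
    [Algebra K L] [IsScalarTower k K L] [FiniteDimensional K L] {t : K} (ht : Transcendental k t)
    [FiniteDimensional k⟮t⟯ K] : OneVariable k L := by
  have ht' : Transcendental k (algebraMap K L t) :=
    (transcendental_algebraMap_iff (algebraMap K L).injective).2 ht
  let f : k⟮t⟯ →+* L := (algebraMap K L).comp (algebraMap k⟮t⟯ K)
  have : FiniteDimensional k⟮t⟯ L := FiniteDimensional.trans k⟮t⟯ K L
  have hle : ∀ x : k⟮t⟯, f x ∈ k⟮algebraMap K L t⟯ := by
    intro x
    have : k⟮algebraMap K L t⟯ = (k⟮t⟯).map (IsScalarTower.toAlgHom k K L) := by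
      rw [adjoin_map]; simp
    rw [this]
    exact ⟨x, x.2, rfl⟩
  let g : k⟮t⟯ →+* k⟮algebraMap K L t⟯ := f.codRestrict _ hle
  let : Algebra k⟮t⟯ k⟮algebraMap K L t⟯ := g.toAlgebra
  have : IsScalarTower k⟮t⟯ k⟮algebraMap K L t⟯ L := IsScalarTower.of_algebraMap_eq fun _ => rfl
  have : FiniteDimensional k⟮algebraMap K L t⟯ L :=
    FiniteDimensional.right k⟮t⟯ k⟮algebraMap K L t⟯ L
  exact OneVariable.of_finite ht'

/-! ### Subrings of a field of one variable -/

variable {R : Type*} [CommRing R] [Algebra k R] [Algebra R F] [IsScalarTower k R F]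
  [FaithfulSMul R F]

-- Descent along powers of `y`: modulo `y` the relation kills all constant coefficients; then the
-- relation can be divided by `y`, which shifts the coefficients down by one.
include F in
lemma aeval_eq_zero_of_linearIndependent_quotient {y : R} (hy : y ≠ 0) {ι : Type*} {v : ι → R}
    (hv : LinearIndependent k (fun i => Ideal.Quotient.mk (Ideal.span {y}) (v i)))
    (s : Finset ι) (p : ι → k[X]) (hp : ∑ i ∈ s, aeval y (p i) * v i = 0) :
    ∀ i ∈ s, p i = 0 := by
  have : IsDomain R := (FaithfulSMul.algebraMap_injective R F).isDomain
  suffices h : ∀ (n : ℕ) (p : ι → k[X]), ∑ i ∈ s, aeval y (p i) * v i = 0 →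
      ∀ i ∈ s, (p i).coeff n = 0 from fun i hi => Polynomial.ext fun n => h n p hp i hi
  have key : ∀ p : ι → k[X], ∑ i ∈ s, aeval y (p i) * v i = 0 →
      ∀ i ∈ s, (p i).coeff 0 = 0 := by
    intro p hp
    refine linearIndependent_iff'.1 hv s (fun i => (p i).coeff 0) ?_
    have h1 : ∀ i, (p i).coeff 0 • Ideal.Quotient.mk (Ideal.span {y}) (v i) =
        Ideal.Quotient.mk (Ideal.span {y}) (aeval y (p i) * v i) := by
      intro i
      rw [← Ideal.Quotient.mkₐ_eq_mk k, ← map_smul, Ideal.Quotient.mkₐ_eq_mk, Ideal.Quotient.eq,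
        Ideal.mem_span_singleton]
      refine ⟨-(aeval y (p i).divX * v i), ?_⟩
      conv_lhs => rw [← divX_mul_X_add (p i)]
      simp [Algebra.smul_def]
      ring
    rw [Finset.sum_congr rfl fun i _ => h1 i, ← map_sum, hp, map_zero]
  intro n
  induction n with
  | zero => exact key
  | succ n ih =>
    intro p hp i hi
    rw [← coeff_divX]
    refine ih (fun i => (p i).divX) ?_ i hi
    have h0 := key p hp
    refine (mul_eq_zero.1 ?_).resolve_left hy
    rw [← hp, Finset.mul_sum]
    refine Finset.sum_congr rfl fun j hj => ?_
    conv_rhs => rw [← divX_mul_X_add (p j), h0 j hj]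
    simp
    ring

open scoped IntermediateField.algebraAdjoinAdjoin in
lemma linearIndependent_intermediateFieldAdjoin {S : Set F} {ι : Type*} {v : ι → F}
    (hv : LinearIndependent (Algebra.adjoin k S) v) :
    LinearIndependent (IntermediateField.adjoin k S) v :=
  (LinearIndependent.iff_fractionRing (Algebra.adjoin k S) _).1 hv

/-- This bounds `dim_k R / (y)` by `[F : k(y)]`, the upper half of the degree formula. Independence
over `k[y]` suffices, since denominators can be cleared. -/
lemma linearIndependent_of_quotient {y : R} (hy : y ≠ 0) {ι : Type*} {v : ι → R}
    (hv : LinearIndependent k (fun i => Ideal.Quotient.mk (Ideal.span {y}) (v i))) :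
    LinearIndependent k⟮algebraMap R F y⟯ (fun i => algebraMap R F (v i)) := by
  refine linearIndependent_intermediateFieldAdjoin ?_
  rw [linearIndependent_iff']
  intro s g hg i hi
  have hex : ∀ i, ∃ p : k[X], aeval (algebraMap R F y) p = (g i : F) := fun i =>
    (Algebra.adjoin_singleton_eq_range_aeval k (algebraMap R F y)).le (g i).2
  choose p hp using hex
  have h0 : ∑ i ∈ s, aeval y (p i) * v i = 0 := by
    apply FaithfulSMul.algebraMap_injective R F
    rw [map_sum, map_zero, ← hg]
    refine Finset.sum_congr rfl fun i _ => ?_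
    rw [map_mul, ← aeval_algebraMap_apply, hp]
    rfl
  have := aeval_eq_zero_of_linearIndependent_quotient (F := F) hy hv s p h0 i hi
  apply Subtype.ext
  rw [← hp, this]
  simp

variable [OneVariable k F]

lemma rank_quotient_le {y : R} (hy : Transcendental k (algebraMap R F y)) :
    Module.rank k (R ⧸ Ideal.span {y}) ≤ Module.finrank k⟮algebraMap R F y⟯ F := by
  have := OneVariable.finite_adjoin _ hy
  have hy0 : y ≠ 0 := by
    rintro rfl
    exact hy (by rw [map_zero]; exact isAlgebraic_zero)
  refine rank_le fun s hs => ?_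
  have h := linearIndependent_of_quotient (F := F) hy0 (v := fun i : s => Quotient.out i.1)
    (by simpa using hs)
  simpa using h.fintype_card_le_finrank

lemma finite_quotient {y : R} (hy : Transcendental k (algebraMap R F y)) :
    Module.Finite k (R ⧸ Ideal.span {y}) :=
  Module.rank_lt_aleph0_iff.1 ((rank_quotient_le hy).trans_lt Cardinal.natCast_lt_aleph0)

lemma finrank_quotient_le {y : R} (hy : Transcendental k (algebraMap R F y)) :
    Module.finrank k (R ⧸ Ideal.span {y}) ≤ Module.finrank k⟮algebraMap R F y⟯ F :=
  Module.finrank_le_of_rank_le (rank_quotient_le hy)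

variable (k F)

include F in
lemma isUnit_of_isAlgebraic {y : R} (hy0 : y ≠ 0) (hy : IsAlgebraic k y) : IsUnit y := by
  have : IsDomain R := (FaithfulSMul.algebraMap_injective R F).isDomain
  have : Algebra.IsIntegral k (Algebra.adjoin k {y}) :=
    Algebra.IsIntegral.adjoin fun x hx => by
      rw [Set.mem_singleton_iff.1 hx]
      exact isAlgebraic_iff_isIntegral.1 hy
  have hf : IsField (Algebra.adjoin k {y}) := isField_of_isIntegral_of_isField' (Field.toIsField k)
  obtain ⟨z, hz⟩ := hf.mul_inv_cancel (a := ⟨y, Algebra.self_mem_adjoin_singleton k y⟩)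
    (fun h => hy0 (congrArg Subtype.val h))
  exact IsUnit.of_mul_eq_one _ (congrArg Subtype.val hz)

include F in
/-- The quotients of `R` by nonzero ideals are finite over the constant field. -/
lemma finite_quotient_ideal {I : Ideal R} (hI : I ≠ ⊥) : Module.Finite k (R ⧸ I) := by
  obtain ⟨y, hyI, hy⟩ := Submodule.exists_mem_ne_zero_of_ne_bot hI
  by_cases halg : IsAlgebraic k y
  · have : I = ⊤ := Ideal.eq_top_of_isUnit_mem _ hyI (isUnit_of_isAlgebraic k F hy halg)
    subst this
    have : Subsingleton (R ⧸ (⊤ : Ideal R)) := inferInstance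
    infer_instance
  · have hy' : Transcendental k (algebraMap R F y) :=
      (transcendental_algebraMap_iff (FaithfulSMul.algebraMap_injective R F)).2 halg
    have := finite_quotient hy'
    have hle : Ideal.span {y} ≤ I := (Ideal.span_singleton_le_iff_mem I).2 hyI
    exact Module.Finite.of_surjective (Ideal.Quotient.factorₐ k hle).toLinearMap
      (Ideal.Quotient.factor_surjective hle)

-- Modulo a single nonzero element `y` of an ideal the ring is finite-dimensional over `k`, so the
-- ideal is generated by `y` and finitely many further elements.
include k F in
lemma isNoetherianRing_of_oneVariable : IsNoetherianRing R := by
  rw [isNoetherianRing_iff_ideal_fg]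
  intro I
  by_cases hI : I = ⊥
  · rw [hI]; exact Submodule.fg_bot
  obtain ⟨y, hyI, hy⟩ := Submodule.exists_mem_ne_zero_of_ne_bot hI
  have hfin : Module.Finite k (R ⧸ Ideal.span {y}) :=
    finite_quotient_ideal k F (by simpa using hy)
  refine Submodule.fg_of_fg_map_of_fg_inf_ker (Ideal.span {y}).mkQ ?_ ?_
  · have : IsNoetherian R (R ⧸ Ideal.span {y}) := isNoetherian_of_tower k inferInstance
    exact IsNoetherian.noetherian _
  · rw [Submodule.ker_mkQ, inf_eq_right.2 ((Ideal.span_singleton_le_iff_mem I).2 hyI)]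
    exact Submodule.fg_span_singleton y

include k F in
lemma dimensionLEOne_of_oneVariable : Ring.DimensionLEOne R where
  maximalOfPrime {p} hp hpp := by
    have := finite_quotient_ideal k F hp
    have : IsDomain (R ⧸ p) := Ideal.Quotient.isDomain p
    have : Algebra.IsIntegral k (R ⧸ p) := inferInstance
    exact Ideal.Quotient.maximal_of_isField p (isField_of_isIntegral_of_isField' (Field.toIsField k))

include k F in
/-- Every integrally closed `k`-subalgebra of a field of one variable is a Dedekind domain. -/
theorem isDedekindDomain_of_oneVariable [IsIntegrallyClosed R] : IsDedekindDomain R :=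
  have : IsDomain R := (FaithfulSMul.algebraMap_injective R F).isDomain
  have := isNoetherianRing_of_oneVariable k F (R := R)
  have := dimensionLEOne_of_oneVariable k F (R := R)
  { }

end OneVariable

end DrinfeldElliptic

/-! ### Places, centers and divisors of ideals -/

namespace DrinfeldElliptic

open IsDedekindDomain UniqueFactorizationMonoid

namespace Place

variable {k F : Type*} [Field k] [Field F] [Algebra k F]

instance algebraRing (P : Place k F) : Algebra k P.ring :=
  ((algebraMap k F).codRestrict P.ring.toSubring P.algebraMap_mem).toAlgebra

lemma degree_eq (P : Place k F) :
    P.degree = Module.finrank k (IsLocalRing.ResidueField P.ring) := rfl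

lemma ord_inv (P : Place k F) (x : F) : P.ord x⁻¹ = -P.ord x := by simp [ord]

lemma ord_div (P : Place k F) {x y : F} (hx : x ≠ 0) (hy : y ≠ 0) :
    P.ord (x / y) = P.ord x - P.ord y := by
  rw [div_eq_mul_inv, P.ord_mul hx (inv_ne_zero hy), P.ord_inv]; ring

lemma ord_pow (P : Place k F) (x : F) (n : ℕ) : P.ord (x ^ n) = n * P.ord x := by
  simp [ord]

lemma mem_ring_iff_ord (P : Place k F) {x : F} (hx : x ≠ 0) : x ∈ P.ring ↔ 0 ≤ P.ord x := by
  have hx' : P.valuation x ≠ 0 := (Valuation.ne_zero_iff _).2 hx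
  rw [mem_ring_iff, ord, ← WithZero.log_le_log hx' one_ne_zero, WithZero.log_one]
  omega

lemma mem_maximalIdeal_iff (P : Place k F) (x : P.ring) :
    x ∈ IsLocalRing.maximalIdeal P.ring ↔ P.valuation x < 1 :=
  ((IsDiscreteValuationRing.maximalIdeal P.ring).valuation_lt_one_iff_mem (K := F) x).symm

lemma exists_ord_eq_one (P : Place k F) : ∃ x : F, x ≠ 0 ∧ P.ord x = 1 := by
  obtain ⟨x, hx⟩ := (IsDiscreteValuationRing.maximalIdeal P.ring).valuation_exists_uniformizer F
  refine ⟨x, ?_, ?_⟩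
  · rintro rfl
    rw [map_zero] at hx
    exact WithZero.exp_ne_zero hx.symm
  · rw [ord, valuation, hx, WithZero.log_exp, neg_neg]

lemma ext_of_le {P Q : Place k F} (h : P.ring ≤ Q.ring) : P = Q :=
  Place.ext (ValuationSubring.eq_of_le_of_ne_top _ h Q.ring_ne_top)

/-- The two valuations have the same units, so `w` is a power of the normalized valuation, with
exponent fixed by a uniformizer. That `w` takes the value `exp (-1)` forces the exponent to be one.
-/
lemma valuation_eq_of_ring_eq (P : Place k F) (w : Valuation F ℤᵐ⁰)
    (hw : ∀ x, w x ≤ 1 ↔ x ∈ P.ring) {x₀ : F} (hx₀ : w x₀ = WithZero.exp (-1)) :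
    P.valuation = w := by
  have hone : ∀ x, P.valuation x = 1 → w x = 1 := by
    intro x hx
    have hx0 : x ≠ 0 := by rintro rfl; simp at hx
    refine le_antisymm ((hw x).2 ((P.mem_ring_iff x).2 hx.le)) ?_
    have := (hw x⁻¹).2 ((P.mem_ring_iff _).2 (by rw [map_inv₀, hx, inv_one]))
    rw [map_inv₀] at this
    exact (inv_le_one₀ (zero_lt_iff.2 ((Valuation.ne_zero_iff _).2 hx0))).1 this
  obtain ⟨p, hp⟩ := (IsDiscreteValuationRing.maximalIdeal P.ring).valuation_exists_uniformizer F
  change P.valuation p = _ at hp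
  have hp0 : p ≠ 0 := by
    rintro rfl; rw [map_zero] at hp; exact WithZero.exp_ne_zero hp.symm
  have hwp0 : w p ≠ 0 := (Valuation.ne_zero_iff _).2 hp0
  have key : ∀ x, x ≠ 0 → WithZero.log (w x) = -WithZero.log (P.valuation x) *
      WithZero.log (w p) := by
    intro x hx
    have hx' : P.valuation x ≠ 0 := (Valuation.ne_zero_iff _).2 hx
    have h1 := hone (x * p ^ (WithZero.log (P.valuation x))) (by
      rw [map_mul, map_zpow₀, hp, ← WithZero.exp_zsmul]
      nth_rw 1 [← WithZero.exp_log hx']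
      rw [← WithZero.exp_add]
      simp)
    rw [map_mul, map_zpow₀] at h1
    have h2 := congrArg WithZero.log h1
    rw [WithZero.log_mul ((Valuation.ne_zero_iff _).2 hx) (zpow_ne_zero _ hwp0),
      WithZero.log_zpow, WithZero.log_one] at h2
    simp only [smul_eq_mul] at h2
    linarith
  have hx₀0 : x₀ ≠ 0 := by
    rintro rfl; rw [map_zero] at hx₀; exact WithZero.exp_ne_zero hx₀.symm
  have hlt : WithZero.log (w p) < 0 := by
    by_contra! hge
    have : w p⁻¹ ≤ 1 := by
      rw [← WithZero.log_le_log (by simpa using hwp0) one_ne_zero, map_inv₀, WithZero.log_inv,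
        WithZero.log_one]
      omega
    have h3 := (P.mem_ring_iff _).1 ((hw _).1 this)
    rw [map_inv₀, hp, ← WithZero.exp_neg, ← WithZero.exp_zero, WithZero.exp_le_exp] at h3
    omega
  have hunit : WithZero.log (w p) = -1 := by
    have h4 := key x₀ hx₀0
    rw [hx₀, WithZero.log_exp] at h4
    have h5 : WithZero.log (w p) ∣ 1 := ⟨WithZero.log (P.valuation x₀), by linarith⟩
    rcases Int.isUnit_iff.1 (isUnit_of_dvd_one h5) with h | h <;> omega
  ext x
  by_cases hx : x = 0
  · simp [hx]
  have h := key x hx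
  rw [hunit, mul_neg, neg_mul, neg_neg, mul_one] at h
  rw [← WithZero.exp_log ((Valuation.ne_zero_iff P.valuation).2 hx), ← h,
    WithZero.exp_log ((Valuation.ne_zero_iff w).2 hx)]

/-! ### Places and prime ideals -/

section Center

variable (R : Type*) [CommRing R] [Algebra R F]

/-- The place `Q` is finite for `R`: the ring `R` is contained in the valuation ring of `Q`. -/
def Contains (Q : Place k F) : Prop := ∀ r : R, algebraMap R F r ∈ Q.ring

variable {R}

/-- The inclusion of `R` into the valuation ring of a place that is finite for `R`. -/
def toRing {Q : Place k F} (hQ : Q.Contains R) : R →+* Q.ring :=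
  (algebraMap R F).codRestrict Q.ring.toSubring hQ

/-- The prime ideal of `R` attached to a place that is finite for `R`. -/
def center {Q : Place k F} (hQ : Q.Contains R) : Ideal R :=
  (IsLocalRing.maximalIdeal Q.ring).comap (toRing hQ)

instance {Q : Place k F} (hQ : Q.Contains R) : (center hQ).IsPrime := Ideal.comap_isPrime _ _

lemma mem_center {Q : Place k F} (hQ : Q.Contains R) (r : R) :
    r ∈ center hQ ↔ Q.valuation (algebraMap R F r) < 1 :=
  Q.mem_maximalIdeal_iff (toRing hQ r)

variable [IsDedekindDomain R] [IsFractionRing R F]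

lemma center_ne_bot {Q : Place k F} (hQ : Q.Contains R) : center hQ ≠ ⊥ := by
  intro h
  apply Q.ring_ne_top
  rw [eq_top_iff]
  intro x _
  obtain ⟨a, b, hb, rfl⟩ := IsFractionRing.div_surjective (A := R) x
  have hb0 : b ≠ 0 := nonZeroDivisors.ne_zero hb
  have hb' : ¬ Q.valuation (algebraMap R F b) < 1 := by
    rw [← mem_center hQ, h]; exact hb0
  rw [Q.mem_ring_iff, map_div₀]
  have h1 := (Q.mem_ring_iff _).1 (hQ a)
  have h2 := le_antisymm ((Q.mem_ring_iff _).1 (hQ b)) (not_lt.1 hb')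
  rw [h2, div_one]
  exact h1

/-- The center of a place, as a point of the height one spectrum. -/
def centerSpec {Q : Place k F} (hQ : Q.Contains R) : HeightOneSpectrum R :=
  ⟨center hQ, inferInstance, center_ne_bot hQ⟩

variable [Algebra k R] [IsScalarTower k R F]

variable (k F) in
/-- The place attached to a nonzero prime ideal. -/
def ofPrime (v : HeightOneSpectrum R) : Place k F where
  ring := (v.valuation F).valuationSubring
  algebraMap_mem a := by
    rw [Valuation.mem_valuationSubring_iff, IsScalarTower.algebraMap_apply k R F]
    exact v.valuation_le_one _
  dvr := Valuation.valuationSubring_isDiscreteValuationRing (v.valuation F)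

lemma ofPrime_valuation (v : HeightOneSpectrum R) : (ofPrime k F v).valuation = v.valuation F := by
  obtain ⟨x, hx⟩ := v.valuation_exists_uniformizer F
  exact valuation_eq_of_ring_eq _ _ (fun _ => Iff.rfl) hx

lemma ofPrime_contains (v : HeightOneSpectrum R) : (ofPrime k F v).Contains R :=
  fun r => v.valuation_le_one r

lemma center_ofPrime (v : HeightOneSpectrum R) : center (ofPrime_contains (k := k) (F := F) v) =
    v.asIdeal := by
  ext r
  rw [mem_center, ofPrime_valuation, v.valuation_lt_one_iff_mem]

/-- The localization of `R` at the center lies in the valuation ring of `Q`, and a discrete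
valuation ring has no larger proper subring of its fraction field to be contained in. -/
lemma ofPrime_centerSpec {Q : Place k F} (hQ : Q.Contains R) : ofPrime k F (centerSpec hQ) = Q := by
  refine ext_of_le fun x hx => ?_
  obtain ⟨n, d, hnd⟩ := (centerSpec hQ).exists_primeCompl_mul_eq_of_integer x hx
  have hd : ¬ Q.valuation (algebraMap R F d) < 1 := fun h => d.2 ((mem_center hQ _).2 h)
  have hd1 := le_antisymm ((Q.mem_ring_iff _).1 (hQ d)) (not_lt.1 hd)
  have := congrArg Q.valuation hnd
  rw [map_mul, hd1, mul_one] at this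
  rw [Q.mem_ring_iff, this]
  exact (Q.mem_ring_iff _).1 (hQ n)

lemma valuation_eq_center {Q : Place k F} (hQ : Q.Contains R) :
    Q.valuation = (centerSpec hQ).valuation F := by
  conv_lhs => rw [← ofPrime_centerSpec hQ]
  exact ofPrime_valuation _

lemma eq_of_center_eq {P Q : Place k F} (hP : P.Contains R) (hQ : Q.Contains R)
    (h : center hP = center hQ) : P = Q := by
  have : centerSpec hP = centerSpec hQ := HeightOneSpectrum.ext h
  rw [← ofPrime_centerSpec hP, this, ofPrime_centerSpec hQ]

/-- The residue map `R → k(Q)` is surjective. -/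
lemma residue_comp_surjective {Q : Place k F} (hQ : Q.Contains R) :
    Function.Surjective ((IsLocalRing.residue Q.ring).comp (toRing hQ)) := by
  intro z
  obtain ⟨x, rfl⟩ := IsLocalRing.residue_surjective z
  have hx : (centerSpec hQ).valuation F x ≤ 1 := by
    rw [← valuation_eq_center hQ, ← Q.mem_ring_iff]; exact x.2
  obtain ⟨n, d, hnd⟩ := (centerSpec hQ).exists_primeCompl_mul_eq_of_integer (x : F) hx
  have hmax : (center hQ).IsMaximal :=
    Ring.DimensionLEOne.maximalOfPrime (center_ne_bot hQ) inferInstance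
  -- The center is maximal, so the denominator `d` has an inverse `e` modulo it, and `n e` has the
  -- same residue as `n / d`.
  obtain ⟨e, he⟩ := Ideal.Quotient.exists_inv (I := center hQ) (a := Ideal.Quotient.mk _ d)
    (fun h => d.2 (Ideal.Quotient.eq_zero_iff_mem.1 h))
  obtain ⟨e, rfl⟩ := Ideal.Quotient.mk_surjective e
  rw [← map_mul, ← map_one (Ideal.Quotient.mk _), Ideal.Quotient.eq] at he
  refine ⟨n * e, ?_⟩
  have h1 : x * toRing hQ d = toRing hQ n := Subtype.ext hnd
  have h2 : IsLocalRing.residue Q.ring (toRing hQ (d * e - 1)) = 0 :=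
    (IsLocalRing.residue_eq_zero_iff _).2 he
  rw [map_sub, map_sub, sub_eq_zero, map_one, map_one, map_mul] at h2
  rw [RingHom.comp_apply, map_mul, ← h1, mul_assoc, map_mul, h2, mul_one]

lemma ker_residue_comp {Q : Place k F} (hQ : Q.Contains R) :
    RingHom.ker ((IsLocalRing.residue Q.ring).comp (toRing hQ)) = center hQ := by
  ext r
  rw [RingHom.mem_ker, RingHom.comp_apply, IsLocalRing.residue_eq_zero_iff]
  rfl

/-- The residue field of a place, as a quotient of a ring for which the place is finite. -/
def quotientCenterEquiv {Q : Place k F} (hQ : Q.Contains R) :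
    (R ⧸ center hQ) ≃+* IsLocalRing.ResidueField Q.ring :=
  (Ideal.quotEquivOfEq (ker_residue_comp hQ).symm).trans
    (RingHom.quotientKerEquivOfSurjective (residue_comp_surjective hQ))

lemma degree_eq_finrank_quotient {Q : Place k F} (hQ : Q.Contains R) :
    Q.degree = Module.finrank k (R ⧸ center hQ) := by
  rw [degree_eq]
  refine (Algebra.finrank_eq_of_equiv_equiv (RingEquiv.refl k) (quotientCenterEquiv hQ) ?_).symm
  ext a
  change IsLocalRing.residue Q.ring (algebraMap k Q.ring a) = IsLocalRing.residue Q.ring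
    (toRing hQ (algebraMap k R a))
  congr 1
  exact Subtype.ext (IsScalarTower.algebraMap_apply k R F a)

lemma self_contains (P : Place k F) : P.Contains P.ring := fun r => r.2

lemma contains_self_iff {P Q : Place k F} : Q.Contains P.ring ↔ Q = P :=
  ⟨fun h => (ext_of_le fun x hx => h ⟨x, hx⟩).symm, fun h => h ▸ self_contains _⟩

end Center

end Place

/-! ### The divisor of an ideal -/

section IdealDivisor

variable (k F : Type*) [Field k] [Field F] [Algebra k F] {R : Type*} [CommRing R]
  [IsDedekindDomain R] [Algebra k R] [Algebra R F] [IsScalarTower k R F] [IsFractionRing R F]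

open scoped Classical in
/-- The divisor of a prime ideal. -/
def primeDivisor (p : Ideal R) : Divisor k F :=
  if h : p.IsPrime ∧ p ≠ ⊥ then Finsupp.single (Place.ofPrime k F ⟨p, h.1, h.2⟩) 1 else 0

/-- The divisor of a nonzero ideal, supported on the places that are finite for `R`. -/
def idealDivisor (I : Ideal R) : Divisor k F :=
  ((normalizedFactors I).map (primeDivisor k F)).sum

variable {k F}

lemma primeDivisor_asIdeal (v : HeightOneSpectrum R) :
    primeDivisor k F v.asIdeal = Finsupp.single (Place.ofPrime k F v) 1 :=
  dif_pos ⟨v.isPrime, v.ne_bot⟩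

lemma idealDivisor_top : idealDivisor k F (⊤ : Ideal R) = 0 := by
  rw [idealDivisor, ← Ideal.one_eq_top, normalizedFactors_one]; simp

lemma idealDivisor_mul {I J : Ideal R} (hI : I ≠ ⊥) (hJ : J ≠ ⊥) :
    idealDivisor k F (I * J) = idealDivisor k F I + idealDivisor k F J := by
  rw [idealDivisor, normalizedFactors_mul hI hJ, Multiset.map_add, Multiset.sum_add]; rfl

lemma idealDivisor_prime (v : HeightOneSpectrum R) :
    idealDivisor k F v.asIdeal = Finsupp.single (Place.ofPrime k F v) 1 := by
  rw [idealDivisor, normalizedFactors_irreducible v.irreducible, normalize_eq]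
  simp [primeDivisor_asIdeal]

lemma idealDivisor_center {Q : Place k F} (hQ : Q.Contains R) :
    idealDivisor k F (Place.center hQ) = Finsupp.single Q 1 := by
  have := idealDivisor_prime (k := k) (F := F) (Place.centerSpec hQ)
  rwa [Place.ofPrime_centerSpec] at this

/-- An induction principle for nonzero ideals of a Dedekind domain. -/
lemma ideal_induction {p : Ideal R → Prop} (htop : p ⊤)
    (hmul : ∀ (v : HeightOneSpectrum R) (I : Ideal R), I ≠ ⊥ → p I → p (v.asIdeal * I))
    {I : Ideal R} (hI : I ≠ ⊥) : p I := by
  revert hI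
  refine induction_on_prime I (fun h => absurd rfl h) (fun J hJ _ => ?_)
    fun J q hJ hq ih _ => hmul ⟨q, Ideal.isPrime_of_prime hq, hq.ne_zero⟩ J hJ (ih hJ)
  rw [Ideal.isUnit_iff.1 hJ]
  exact htop

lemma idealDivisor_apply {I : Ideal R} (hI : I ≠ ⊥) {Q : Place k F} (hQ : Q.Contains R) :
    idealDivisor k F I Q = multiplicity (Place.center hQ) I := by
  have hp : Prime (Place.center hQ) := (Place.centerSpec hQ).prime
  refine ideal_induction (p := fun I => idealDivisor k F I Q = multiplicity (Place.center hQ) I)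
    ?_ ?_ hI
  · rw [idealDivisor_top, ← Ideal.one_eq_top, multiplicity_of_one_right hp.not_isUnit]
    simp
  · intro v J hJ ih
    have hfin : FiniteMultiplicity (Place.center hQ) (v.asIdeal * J) :=
      FiniteMultiplicity.of_prime_left hp (mul_ne_zero v.ne_bot hJ)
    rw [multiplicity_mul hp hfin, idealDivisor_mul v.ne_bot hJ, Finsupp.add_apply, ih,
      idealDivisor_prime, Nat.cast_add, add_left_inj]
    by_cases h : Place.ofPrime k F v = Q
    · have hc : Place.center hQ = v.asIdeal := by
        subst h; exact Place.center_ofPrime v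
      rw [h, hc, multiplicity_self]
      simp
    · rw [Finsupp.single_eq_of_ne' h, eq_comm, Nat.cast_eq_zero, multiplicity_eq_zero]
      intro hdvd
      apply h
      have hle := Ideal.le_of_dvd hdvd
      have hmax : v.asIdeal.IsMaximal := v.isMaximal
      have := hmax.eq_of_le (Ideal.IsPrime.ne_top inferInstance) hle
      refine Place.eq_of_center_eq (Place.ofPrime_contains v) hQ ?_
      rw [Place.center_ofPrime, this]

lemma idealDivisor_apply_of_not_contains {I : Ideal R} (hI : I ≠ ⊥) {Q : Place k F}
    (hQ : ¬ Q.Contains R) : idealDivisor k F I Q = 0 := by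
  refine ideal_induction (p := fun I => idealDivisor k F I Q = 0) ?_ ?_ hI
  · rw [idealDivisor_top]; rfl
  · intro v J hJ ih
    rw [idealDivisor_mul v.ne_bot hJ, Finsupp.add_apply, ih, idealDivisor_prime, add_zero]
    refine Finsupp.single_eq_of_ne' ?_
    rintro rfl
    exact hQ (Place.ofPrime_contains v)

lemma idealDivisor_span {r : R} (hr : r ≠ 0) {Q : Place k F} (hQ : Q.Contains R) :
    idealDivisor k F (Ideal.span {r}) Q = Q.ord (algebraMap R F r) := by
  rw [idealDivisor_apply (by simpa using hr) hQ, Place.ord, Place.valuation_eq_center hQ,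
    HeightOneSpectrum.valuation_of_algebraMap,
    HeightOneSpectrum.intValuation_eq_exp_neg_multiplicity _ hr, WithZero.log_exp, neg_neg]
  rfl

lemma idealDivisor_injective {I J : Ideal R} (hI : I ≠ ⊥) (hJ : J ≠ ⊥)
    (h : idealDivisor k F I = idealDivisor k F J) : I = J := by
  suffices hle : ∀ {I J : Ideal R}, I ≠ ⊥ → J ≠ ⊥ → idealDivisor k F I = idealDivisor k F J →
      I ∣ J from dvd_antisymm' (hle hJ hI h.symm) (hle hI hJ h)
  intro I J hI hJ h
  rw [dvd_iff_normalizedFactors_le_normalizedFactors hI hJ, Multiset.le_iff_count]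
  intro p
  by_cases hp : p ∈ normalizedFactors I
  · have hpp := prime_of_normalized_factor p hp
    let v : HeightOneSpectrum R := ⟨p, Ideal.isPrime_of_prime hpp, hpp.ne_zero⟩
    have hm : ∀ {I : Ideal R}, I ≠ ⊥ → (Multiset.count p (normalizedFactors I) : ℤ) =
        idealDivisor k F I (Place.ofPrime k F v) := by
      intro I hI
      rw [idealDivisor_apply hI (Place.ofPrime_contains v), Place.center_ofPrime,
        multiplicity_eq_count_normalizedFactors hpp.irreducible hI, normalize_eq]
    have := (hm hI).trans ((DFunLike.congr_fun h _).trans (hm hJ).symm)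
    omega
  · rw [Multiset.count_eq_zero_of_notMem hp]
    exact Nat.zero_le _

end IdealDivisor

end DrinfeldElliptic

/-! ### The norm of divisors and the norm of ideals -/

namespace DrinfeldElliptic

open IsDedekindDomain UniqueFactorizationMonoid

section Norm

variable {k K L : Type*} [Field k] [Field K] [Field L] [Algebra k K] [Algebra k L] [Algebra K L]
  [IsScalarTower k K L] [Algebra.IsAlgebraic K L]

lemma divisorNorm_add (D E : Divisor k L) :
    divisorNorm K (D + E) = divisorNorm K D + divisorNorm K E := by
  classical
  refine Finsupp.sum_add_index' (fun Q => by simp) fun Q m n => ?_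
  rw [add_mul, Finsupp.single_add]

variable (k K L) in
/-- The norm of divisors, as a homomorphism. -/
def divisorNormHom : Divisor k L →+ Divisor k K where
  toFun := divisorNorm K
  map_zero' := Finsupp.sum_zero_index
  map_add' := divisorNorm_add

lemma divisorNormHom_apply (D : Divisor k L) : divisorNormHom k K L D = divisorNorm K D := rfl

lemma divisorNorm_single (Q : Place k L) (n : ℤ) : divisorNorm K (Finsupp.single Q n) =
    Finsupp.single (Q.under K) (n * (Q.inertiaDeg K : ℤ)) := by
  rw [divisorNorm, Finsupp.sum_single_index (by simp)]

lemma divisorNorm_apply_eq_zero {D : Divisor k L} {P : Place k K}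
    (h : ∀ Q : Place k L, Q.under K = P → D Q = 0) : divisorNorm K D P = 0 := by
  classical
  rw [divisorNorm, Finsupp.sum_apply, Finsupp.sum]
  refine Finset.sum_eq_zero fun Q hQ => ?_
  exact Finsupp.single_eq_of_ne' fun hP => Finsupp.mem_support_iff.1 hQ (h Q hP)

lemma divisorNorm_apply_congr {D E : Divisor k L} {P : Place k K}
    (h : ∀ Q : Place k L, Q.under K = P → D Q = E Q) :
    divisorNorm K D P = divisorNorm K E P := by
  have h0 : divisorNormHom k K L (D - E) P = 0 :=
    divisorNorm_apply_eq_zero fun Q hQ => by rw [Finsupp.sub_apply, h Q hQ, sub_self]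
  rw [map_sub, Finsupp.sub_apply, sub_eq_zero] at h0
  exact h0

variable {R S : Type*} [CommRing R] [CommRing S] [Algebra R K] [Algebra R S] [Algebra S L]
  [Algebra R L] [IsScalarTower R K L] [IsScalarTower R S L]

lemma Place.under_contains {Q : Place k L} (hQ : Q.Contains S) : (Q.under K).Contains R := by
  intro r
  change algebraMap K L (algebraMap R K r) ∈ Q.ring
  rw [← IsScalarTower.algebraMap_apply, IsScalarTower.algebraMap_apply R S L]
  exact hQ _

/-- An element integral over `R` is integral over the valuation ring of `Q`, which is integrally
closed. -/
lemma Place.contains_of_under [Algebra.IsIntegral R S] {Q : Place k L}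
    (hQ : (Q.under K).Contains R) : Q.Contains S := by
  intro s
  let f : R →+* Q.ring := (Q.ringMap K).comp (Place.toRing hQ)
  obtain ⟨p, hp, hps⟩ := Algebra.IsIntegral.isIntegral (R := R) s
  have hint : IsIntegral Q.ring (algebraMap S L s) := by
    refine ⟨p.map f, hp.map f, ?_⟩
    rw [Polynomial.eval₂_map]
    have h : (algebraMap Q.ring L).comp f = (algebraMap S L).comp (algebraMap R S) := by
      ext r
      change algebraMap K L (algebraMap R K r) = algebraMap S L (algebraMap R S r)
      rw [← IsScalarTower.algebraMap_apply, ← IsScalarTower.algebraMap_apply]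
    rw [h, ← Polynomial.hom_eval₂, hps, map_zero]
  obtain ⟨z, hz⟩ := IsIntegrallyClosed.isIntegral_iff.1 hint
  rw [← hz]
  exact z.2

lemma Place.center_under {Q : Place k L} (hQ : Q.Contains S) (hQ' : (Q.under K).Contains R) :
    Place.center hQ' = (Place.center hQ).under R := by
  ext r
  rw [Ideal.under_def, Ideal.mem_comap]
  change _ ∈ IsLocalRing.maximalIdeal _ ↔ _ ∈ IsLocalRing.maximalIdeal _
  rw [← not_iff_not, IsLocalRing.notMem_maximalIdeal, IsLocalRing.notMem_maximalIdeal,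
    ← isUnit_map_iff (Q.ringMap K)]
  have : Q.ringMap K (Place.toRing hQ' r) = Place.toRing hQ (algebraMap R S r) :=
    Subtype.ext (by
      change algebraMap K L (algebraMap R K r) = algebraMap S L (algebraMap R S r)
      rw [← IsScalarTower.algebraMap_apply, ← IsScalarTower.algebraMap_apply])
  rw [this]

variable [IsDedekindDomain R] [IsDedekindDomain S] [IsFractionRing R K] [IsFractionRing S L]
  [Algebra k R] [IsScalarTower k R K] [Algebra k S] [IsScalarTower k S L]

lemma Place.inertiaDeg_eq {Q : Place k L} (hQ : Q.Contains S) :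
    Q.inertiaDeg K = (Place.center hQ).inertiaDeg R := by
  have hQ' : (Q.under K).Contains R := Place.under_contains hQ
  have : (Place.center hQ).IsMaximal :=
    Ring.DimensionLEOne.maximalOfPrime (Place.center_ne_bot hQ) inferInstance
  have : (Place.center hQ').IsMaximal :=
    Ring.DimensionLEOne.maximalOfPrime (Place.center_ne_bot hQ') inferInstance
  have hlies : (Place.center hQ).LiesOver (Place.center hQ') := ⟨Place.center_under hQ hQ'⟩
  rw [Ideal.inertiaDeg_eq_of_isMaximal (Place.center hQ')]
  unfold Place.inertiaDeg
  let := (IsLocalRing.ResidueField.map (Q.ringMap K)).toAlgebra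
  refine (Algebra.finrank_eq_of_equiv_equiv (Place.quotientCenterEquiv hQ')
    (Place.quotientCenterEquiv hQ) ?_).symm
  ext r
  change IsLocalRing.residue Q.ring (Q.ringMap K (Place.toRing hQ' r)) =
    IsLocalRing.residue Q.ring (Place.toRing hQ (algebraMap R S r))
  congr 1
  refine Subtype.ext ?_
  change algebraMap K L (algebraMap R K r) = algebraMap S L (algebraMap R S r)
  rw [← IsScalarTower.algebraMap_apply, ← IsScalarTower.algebraMap_apply]

attribute [local instance] FractionRing.liftAlgebra

variable [Module.Finite R S] [IsGalois K L] [Module.IsTorsionFree R S]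

variable (K L) in
include K L in
lemma relNorm_prime (Q : Ideal S) [Q.IsPrime] (hQ : Q ≠ ⊥) :
    Ideal.relNorm R Q = (Q.under R) ^ Q.inertiaDeg R := by
  have : Q.IsMaximal := Ring.DimensionLEOne.maximalOfPrime hQ inferInstance
  have : (Q.under R).IsMaximal := Ideal.isMaximal_comap_of_isIntegral_of_isMaximal Q
  -- The formula for the relative norm of a prime is applied over `FractionRing`, so the Galois
  -- property is carried over from `L / K`.
  have : IsGalois (FractionRing R) (FractionRing S) := by
    refine IsGalois.of_equiv_equiv (F := K) (E := L)
      (f := (FractionRing.algEquiv R K).symm.toRingEquiv)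
      (g := (FractionRing.algEquiv S L).symm.toRingEquiv) ?_
    apply IsFractionRing.ringHom_ext (A := R)
    intro r
    simp only [RingHom.comp_apply]
    have h1 : (FractionRing.algEquiv R K).symm (algebraMap R K r) =
        algebraMap R (FractionRing R) r := AlgEquiv.commutes _ _
    have h2 : (FractionRing.algEquiv S L).symm (algebraMap S L (algebraMap R S r)) =
        algebraMap S (FractionRing S) (algebraMap R S r) := AlgEquiv.commutes _ _
    rw [← IsScalarTower.algebraMap_apply R K L, IsScalarTower.algebraMap_apply R S L]
    refine Eq.trans ?_ h2.symm
    refine (congrArg (algebraMap (FractionRing R) (FractionRing S)) h1).trans ?_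
    rw [← IsScalarTower.algebraMap_apply, ← IsScalarTower.algebraMap_apply]
  exact Ideal.relNorm_eq_pow_of_isPrime_isGalois Q (Q.under R)

/-- The norm of divisors corresponds to the norm of ideals. -/
lemma divisorNorm_idealDivisor {I : Ideal S} (hI : I ≠ ⊥) :
    divisorNorm K (idealDivisor k L I) = idealDivisor k K (Ideal.relNorm R I) := by
  refine ideal_induction (p := fun I => divisorNorm K (idealDivisor k L I) =
    idealDivisor k K (Ideal.relNorm R I)) ?_ ?_ hI
  · rw [Ideal.relNorm_top, idealDivisor_top, idealDivisor_top]
    exact (divisorNormHom k K L).map_zero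
  · intro v J hJ ih
    have hv : Ideal.relNorm R v.asIdeal ≠ ⊥ := by rw [Ne, Ideal.relNorm_eq_bot_iff]; exact v.ne_bot
    have hJ' : Ideal.relNorm R J ≠ ⊥ := by rwa [Ne, Ideal.relNorm_eq_bot_iff]
    rw [map_mul, idealDivisor_mul v.ne_bot hJ, divisorNorm_add, ih, idealDivisor_mul hv hJ',
      add_left_inj, idealDivisor_prime, divisorNorm_single]
    have hQ : (Place.ofPrime k L v).Contains S := Place.ofPrime_contains v
    have hQ' : ((Place.ofPrime k L v).under K).Contains R := Place.under_contains hQ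
    have hpow : ∀ n : ℕ, idealDivisor k K (Place.center hQ' ^ n) =
        Finsupp.single ((Place.ofPrime k L v).under K) (n : ℤ) := by
      intro n
      induction n with
      | zero => rw [pow_zero, Ideal.one_eq_top, idealDivisor_top]; simp
      | succ n ih =>
        rw [pow_succ, idealDivisor_mul (pow_ne_zero _ (Place.center_ne_bot hQ'))
          (Place.center_ne_bot hQ'), ih, idealDivisor_center, ← Finsupp.single_add]
        simp
    have hn : Ideal.relNorm R v.asIdeal =
        Place.center hQ' ^ (Place.ofPrime k L v).inertiaDeg K := by
      rw [relNorm_prime K L v.asIdeal v.ne_bot, Place.inertiaDeg_eq (R := R) hQ,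
        Place.center_under hQ hQ', Place.center_ofPrime]
    rw [hn, hpow, one_mul]

/-- Only the places above `P` contribute, and all of them are finite for `S`. Writing `x = a / b`
reduces the claim to `relNorm (a) = (N a)`. -/
lemma divisorNorm_principal_apply [FiniteDimensional K L] {x : L} (hx : x ≠ 0) {D : Divisor k L}
    (hD : ∀ Q : Place k L, Q.Contains S → D Q = Q.ord x) {P : Place k K} (hP : P.Contains R) :
    divisorNorm K D P = P.ord (Algebra.norm K x) := by
  obtain ⟨a, b, hb, rfl⟩ := IsFractionRing.div_surjective (A := S) x
  have hb0 : b ≠ 0 := nonZeroDivisors.ne_zero hb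
  have ha0 : a ≠ 0 := by rintro rfl; simp at hx
  have hinj := IsFractionRing.injective S L
  have hmem : ∀ a : S, a ≠ 0 → algebraMap S L a ≠ 0 := fun a ha =>
    (map_ne_zero_iff _ hinj).2 ha
  have h1 : divisorNorm K D P = divisorNormHom k K L
      (idealDivisor k L (Ideal.span {a}) - idealDivisor k L (Ideal.span {b})) P := by
    refine divisorNorm_apply_congr fun Q hQ => ?_
    have hQS : Q.Contains S := Place.contains_of_under (K := K) (R := R) (hQ ▸ hP)
    rw [hD Q hQS, Finsupp.sub_apply, idealDivisor_span ha0 hQS, idealDivisor_span hb0 hQS,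
      Q.ord_div (hmem a ha0) (hmem b hb0)]
  have h2 : ∀ a : S, a ≠ 0 → divisorNormHom k K L (idealDivisor k L (Ideal.span {a})) P =
      P.ord (Algebra.norm K (algebraMap S L a)) := by
    intro a ha
    have hn : Algebra.intNorm R S a ≠ 0 := by rwa [Ne, Algebra.intNorm_eq_zero]
    rw [divisorNormHom_apply, divisorNorm_idealDivisor (R := R) (by simpa using ha),
      Ideal.relNorm_singleton, idealDivisor_span hn hP, Algebra.algebraMap_intNorm (L := L)]
  have h3 := P.ord_mul (Algebra.norm_ne_zero_iff.2 hx) (Algebra.norm_ne_zero_iff.2 (hmem b hb0))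
  rw [← map_mul, div_mul_cancel₀ _ (hmem b hb0)] at h3
  rw [h1, map_sub, Finsupp.sub_apply, h2 a ha0, h2 b hb0, h3]
  ring

end Norm

section LocalNorm

variable {k K L : Type*} [Field k] [Field K] [Field L] [Algebra k K] [Algebra k L] [Algebra K L]
  [IsScalarTower k K L] [FiniteDimensional K L] [IsGalois K L]

instance (P : Place k K) : IsScalarTower k P.ring L :=
  IsScalarTower.of_algebraMap_eq fun a => IsScalarTower.algebraMap_apply k K L a

/-- The norm of the divisor of an element is the divisor of its norm. -/
theorem divisorNorm_principal {x : L} (hx : x ≠ 0) {D : Divisor k L}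
    (hD : ∀ Q : Place k L, D Q = Q.ord x) (P : Place k K) :
    divisorNorm K D P = P.ord (Algebra.norm K x) := by
  -- The claim is local at `P`, so `R` is taken to be the valuation ring of `P` and `S` its integral
  -- closure; no global ring is needed.
  have : IsFractionRing (integralClosure P.ring L) L :=
    IsIntegralClosure.isFractionRing_of_finite_extension P.ring K L _
  have : IsDedekindDomain (integralClosure P.ring L) :=
    IsIntegralClosure.isDedekindDomain P.ring K L _
  have : Module.Finite P.ring (integralClosure P.ring L) :=
    IsIntegralClosure.finite P.ring K L _
  exact divisorNorm_principal_apply (R := P.ring) (S := integralClosure P.ring L) hx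
    (fun Q _ => hD Q) P.self_contains

end LocalNorm

end DrinfeldElliptic

/-! ### Dimension counts and poles -/

namespace DrinfeldElliptic

open IsDedekindDomain UniqueFactorizationMonoid IntermediateField Polynomial

section Dimension

variable {k F : Type*} [Field k] [Field F] [Algebra k F] [OneVariable k F]
  {R : Type*} [CommRing R] [Algebra k R] [Algebra R F] [IsScalarTower k R F]

/-- Multiplicativity of the index of ideals. -/
lemma card_quotient_mul [IsDedekindDomain R] [Infinite R] (I J : Ideal R) :
    Nat.card (R ⧸ I * J) = Nat.card (R ⧸ I) * Nat.card (R ⧸ J) :=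
  multiplicative_of_coprime (fun I : Ideal R => Nat.card (R ⧸ I)) I J
    (Submodule.cardQuot_bot R R)
    (fun {I J} hI => by simp [Ideal.isUnit_iff.mp hI, Ideal.mul_top])
    (fun {I} _ hI =>
      have : Ideal.IsPrime I := Ideal.isPrime_of_prime hI
      cardQuot_pow_of_prime hI.ne_zero)
    fun {I J} hIJ => cardQuot_mul_of_coprime <| Ideal.isCoprime_iff_sup_eq.mpr
      (Ideal.isUnit_iff.mp
        (hIJ (Ideal.dvd_iff_le.mpr le_sup_left) (Ideal.dvd_iff_le.mpr le_sup_right)))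

variable (F) in
include F in
lemma finrank_quotient_mul [Finite k] [IsDedekindDomain R] [FaithfulSMul R F] {I J : Ideal R}
    (hI : I ≠ ⊥) (hJ : J ≠ ⊥) : Module.finrank k (R ⧸ I * J) =
      Module.finrank k (R ⧸ I) + Module.finrank k (R ⧸ J) := by
  rcases finite_or_infinite R with hR | hR
  -- The count of cosets is for infinite rings; a finite domain is a field, where every nonzero
  -- ideal is the whole ring and all dimensions vanish.
  · have hf : IsField R := Finite.isField_of_domain R
    have htop : ∀ I : Ideal R, I ≠ ⊥ → I = ⊤ := fun I hI =>
      ((Ring.isField_iff_isSimpleOrder_ideal.1 hf).eq_bot_or_eq_top I).resolve_left hI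
    have hs : Subsingleton (R ⧸ (⊤ : Ideal R)) := inferInstance
    rw [htop I hI, htop J hJ, ← Ideal.one_eq_top, one_mul, Ideal.one_eq_top,
      Module.finrank_zero_of_subsingleton]
  · have h := card_quotient_mul I J
    have := finite_quotient_ideal k F hI
    have := finite_quotient_ideal k F hJ
    have := finite_quotient_ideal k F (mul_ne_zero hI hJ)
    rw [Module.natCard_eq_pow_finrank (K := k), Module.natCard_eq_pow_finrank (K := k) (V := R ⧸ I),
      Module.natCard_eq_pow_finrank (K := k) (V := R ⧸ J), ← pow_add] at h
    exact Nat.pow_right_injective (Finite.one_lt_card (α := k)) h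

variable (F) in
include F in
lemma finrank_quotient_pow [Finite k] [IsDedekindDomain R] [FaithfulSMul R F] {I : Ideal R}
    (hI : I ≠ ⊥) (n : ℕ) : Module.finrank k (R ⧸ I ^ n) = n * Module.finrank k (R ⧸ I) := by
  induction n with
  | zero =>
    have hs : Subsingleton (R ⧸ (⊤ : Ideal R)) := inferInstance
    rw [pow_zero, Ideal.one_eq_top, zero_mul, Module.finrank_zero_of_subsingleton]
  | succ n ih =>
    rw [pow_succ, finrank_quotient_mul F (pow_ne_zero _ hI) hI, ih]; ring

lemma divisorDegree_single (P : Place k F) (n : ℤ) :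
    divisorDegree k F (Finsupp.single P n) = n * P.degree := by
  simp [divisorDegree]

/-- The dimension of the quotient by an ideal is the degree of the divisor of the ideal. -/
lemma divisorDegree_idealDivisor [Finite k] [IsDedekindDomain R] [IsFractionRing R F] {I : Ideal R}
    (hI : I ≠ ⊥) : divisorDegree k F (idealDivisor k F I) = Module.finrank k (R ⧸ I) := by
  have hfaith : FaithfulSMul R F := (faithfulSMul_iff_algebraMap_injective R F).2
    (IsFractionRing.injective R F)
  refine ideal_induction (p := fun I => divisorDegree k F (idealDivisor k F I) =
    Module.finrank k (R ⧸ I)) ?_ ?_ hI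
  · have hs : Subsingleton (R ⧸ (⊤ : Ideal R)) := inferInstance
    rw [idealDivisor_top, map_zero, Module.finrank_zero_of_subsingleton, Nat.cast_zero]
  · intro v J hJ ih
    rw [idealDivisor_mul v.ne_bot hJ, map_add, ih, finrank_quotient_mul F v.ne_bot hJ,
      idealDivisor_prime, Nat.cast_add, add_left_inj, divisorDegree_single, one_mul,
      Place.degree_eq_finrank_quotient (Place.ofPrime_contains v), Place.center_ofPrime]

/-- Multiplying a basis of `F` over `E` by a common denominator puts it inside `R` and keeps it
independent. -/
lemma exists_linearIndependent [IsDomain R] [IsFractionRing R F] (E : IntermediateField k F)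
    [FiniteDimensional E F] : ∃ v : Fin (Module.finrank E F) → R,
      LinearIndependent E (fun i => algebraMap R F (v i)) := by
  let b := Module.finBasis E F
  obtain ⟨d, hd⟩ := IsLocalization.exist_integer_multiples_of_finite (nonZeroDivisors R) b
  choose v hv using hd
  refine ⟨v, ?_⟩
  have hd0 : algebraMap R F d ≠ 0 := IsFractionRing.to_map_ne_zero_of_mem_nonZeroDivisors d.2
  have h : (fun i => algebraMap R F (v i)) =
      (LinearMap.mulLeft E (algebraMap R F d)) ∘ b := by
    ext i
    rw [hv i, Algebra.smul_def]
    rfl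
  rw [h]
  exact b.linearIndependent.map' _ (LinearMap.ker_eq_bot.2 (mul_right_injective₀ hd0))

/-- The linear combinations of a family with coefficients that are polynomials in `y` of degree
less than `n`. -/
def polyComb (y : R) {ι : Type*} [Fintype ι] (v : ι → R) (n : ℕ) :
    (ι → degreeLT k n) →ₗ[k] R :=
  ∑ i, (LinearMap.mulRight k (v i)) ∘ₗ (aeval y).toLinearMap ∘ₗ (degreeLT k n).subtype ∘ₗ
    LinearMap.proj i

lemma polyComb_apply (y : R) {ι : Type*} [Fintype ι] (v : ι → R) (n : ℕ)
    (p : ι → degreeLT k n) : polyComb y v n p = ∑ i, aeval y (p i : k[X]) * v i := by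
  simp [polyComb]

/-- Together with `finrank_polyCoeff` this yields spaces of dimension exactly `N n` inside `R`, the
source of all lower bounds below. -/
lemma polyComb_injective {y : R} (hy : Transcendental k (algebraMap R F y)) {ι : Type*}
    [Fintype ι] {v : ι → R}
    (hv : LinearIndependent k⟮algebraMap R F y⟯ (fun i => algebraMap R F (v i))) (n : ℕ) :
    Function.Injective (polyComb (k := k) y v n) := by
  rw [← LinearMap.ker_eq_bot, LinearMap.ker_eq_bot']
  intro p hp
  rw [polyComb_apply] at hp
  let g : k⟮algebraMap R F y⟯ := AdjoinSimple.gen k (algebraMap R F y)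
  have h := Fintype.linearIndependent_iff.1 hv (fun i => aeval g (p i : k[X])) (by
    rw [← map_zero (algebraMap R F), ← hp, map_sum]
    refine Finset.sum_congr rfl fun i _ => ?_
    rw [map_mul, ← aeval_algebraMap_apply, Algebra.smul_def, ← aeval_algebraMap_apply]
    rfl)
  funext i
  have h2 := congrArg (algebraMap k⟮algebraMap R F y⟯ F) (h i)
  rw [← aeval_algebraMap_apply, map_zero] at h2
  exact Subtype.ext (transcendental_iff.1 hy _ h2)

lemma finrank_polyCoeff (N n : ℕ) : Module.finrank k (Fin N → degreeLT k n) = N * n := by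
  rw [Module.finrank_pi_fintype]
  simp [(degreeLTEquiv k n).finrank_eq]

instance (n : ℕ) : Module.Finite k (degreeLT k n) := Module.Finite.equiv (degreeLTEquiv k n).symm

/-- `B` is the integral closure of `k[y]`. A place regular at `y` contains `B` because its ring is
integrally closed. Integral extensions reflect units and `y` is not a unit of `k[y]`, so `y⁻¹` stays
outside `B`. -/
lemma exists_dedekind_subalgebra {y : F} (hy : Transcendental k y) :
    ∃ B : Subalgebra k F, IsDedekindDomain B ∧ IsFractionRing B F ∧ y ∈ B ∧ y⁻¹ ∉ B ∧
      ∀ P : Place k F, y ∈ P.ring → ∀ b ∈ B, b ∈ P.ring := by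
  obtain ⟨C, hC⟩ : ∃ C : Subalgebra k F, C = Algebra.adjoin k {y} := ⟨_, rfl⟩
  have hfin := OneVariable.finite_adjoin y hy
  have halg : Algebra.IsAlgebraic C F := by
    subst hC
    have : Algebra.IsAlgebraic k⟮y⟯ F := inferInstance
    open scoped IntermediateField.algebraAdjoinAdjoin in
    exact (IsFractionRing.comap_isAlgebraic_iff (A := Algebra.adjoin k {y}) (K := k⟮y⟯)).2 this
  have hinj : ∀ x : C, algebraMap C F x = 0 → x = 0 := fun x hx => Subtype.ext hx
  have hyC : y ∈ C := hC ▸ Algebra.self_mem_adjoin_singleton k y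
  have hfrac' : IsFractionRing (integralClosure C F) F :=
    integralClosure.isFractionRing_of_algebraic hinj
  obtain ⟨B, hB⟩ : ∃ B : Subalgebra k F, ∀ x, x ∈ B ↔ x ∈ integralClosure C F :=
    ⟨(integralClosure C F).restrictScalars k, fun _ => Iff.rfl⟩
  have hfrac : IsFractionRing B F := IsFractionRing.of_field B F fun z => by
    obtain ⟨a, b, -, rfl⟩ := IsFractionRing.div_surjective (A := integralClosure C F) z
    exact ⟨⟨a, (hB _).2 a.2⟩, ⟨b, (hB _).2 b.2⟩, rfl⟩
  have hint : ∀ x : F, IsIntegral B x → x ∈ B := by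
    intro x ⟨p, hp, hpx⟩
    let f : B →+* integralClosure C F := (Subalgebra.val B).toRingHom.codRestrict
      (integralClosure C F).toSubring fun b => (hB _).1 b.2
    refine (hB _).2 (isIntegral_trans (A := integralClosure C F) x ⟨p.map f, hp.map f, ?_⟩)
    rw [Polynomial.eval₂_map]
    exact hpx
  have hic : IsIntegrallyClosed B := (isIntegrallyClosed_iff F).2 fun {x} hx => ⟨⟨x, hint x hx⟩, rfl⟩
  refine ⟨B, isDedekindDomain_of_oneVariable k F, hfrac,
    (hB _).2 (isIntegral_algebraMap (x := (⟨y, hyC⟩ : C))), ?_, ?_⟩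
  · intro hinv
    have hCint : Algebra.IsIntegral C (integralClosure C F) := inferInstance
    have hCf : FaithfulSMul C (integralClosure C F) :=
      (faithfulSMul_iff_algebraMap_injective _ _).2 fun a b h =>
        Subtype.ext (congrArg (algebraMap (integralClosure C F) F) h)
    have hloc : IsLocalHom (algebraMap C (integralClosure C F)) :=
      Algebra.IsIntegral.isLocalHom _ _
    rw [hB] at hinv
    have hy0 : y ≠ 0 := by rintro rfl; exact hy isAlgebraic_zero
    have hu : IsUnit (algebraMap C (integralClosure C F) ⟨y, hyC⟩) :=
      IsUnit.of_mul_eq_one ⟨y⁻¹, hinv⟩ (Subtype.ext (mul_inv_cancel₀ hy0))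
    obtain ⟨z, hz⟩ := (hloc.map_nonunit _ hu).exists_right_inv
    have hzC : (z : F) ∈ Algebra.adjoin k {y} := hC ▸ z.2
    rw [Algebra.adjoin_singleton_eq_range_aeval] at hzC
    obtain ⟨p, hp⟩ := hzC
    have hz' : y * (z : F) = 1 := congrArg Subtype.val hz
    have h0 : aeval y (X * p - 1) = 0 := by
      rw [map_sub, map_mul, aeval_X, map_one]
      change y * aeval y p - 1 = 0
      rw [show aeval y p = (z : F) from hp, hz', sub_self]
    have h1 := transcendental_iff.1 hy _ h0
    have h2 := congrArg (eval 0) h1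
    simp at h2
  · intro P hyP b hb
    have hCP : ∀ c : C, (c : F) ∈ P.ring := by
      intro c
      have hle : Algebra.adjoin k {y} ≤
          ({ P.ring.toSubring with algebraMap_mem' := P.algebraMap_mem } : Subalgebra k F) :=
        Algebra.adjoin_le (by simpa using hyP)
      exact hle (hC ▸ c.2)
    obtain ⟨p, hp, hpb⟩ := (hB _).1 hb
    let f : C →+* P.ring := Place.toRing (R := C) hCP
    have hint : IsIntegral P.ring b := by
      refine ⟨p.map f, hp.map f, ?_⟩
      rw [Polynomial.eval₂_map]
      exact hpb
    obtain ⟨z, hz⟩ := IsIntegrallyClosed.isIntegral_iff.1 hint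
    rw [← hz]
    exact z.2

/-- A transcendental element has a pole. -/
lemma exists_place_notMem {x : F} (hx : Transcendental k x) : ∃ P : Place k F, x ∉ P.ring := by
  have hy : Transcendental k x⁻¹ := fun h => hx (by simpa using h.inv)
  obtain ⟨B, hD, hfrac, hyB, hinv, -⟩ := exists_dedekind_subalgebra hy
  -- As a non-unit of `B`, the element `x⁻¹` lies in a maximal ideal; the place of that ideal is a
  -- zero of `x⁻¹`, hence a pole of `x`.
  have hnu : ¬ IsUnit (⟨x⁻¹, hyB⟩ : B) := by
    intro h
    obtain ⟨z, hz⟩ := h.exists_right_inv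
    have hz' : x⁻¹ * (z : F) = 1 := congrArg Subtype.val hz
    apply hinv
    rw [← eq_inv_of_mul_eq_one_right hz']
    exact z.2
  obtain ⟨M, hM, hxM⟩ := exists_max_ideal_of_mem_nonunits hnu
  have hx0 : x ≠ 0 := by rintro rfl; exact hx isAlgebraic_zero
  have hMbot : M ≠ ⊥ := by
    rintro rfl
    exact inv_ne_zero hx0 (congrArg Subtype.val ((Submodule.mem_bot B).1 hxM))
  let v : HeightOneSpectrum B := ⟨M, hM.isPrime, hMbot⟩
  refine ⟨Place.ofPrime k F v, fun h => ?_⟩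
  have h1 : (Place.ofPrime k F v).valuation x⁻¹ < 1 := by
    rw [Place.ofPrime_valuation]
    exact (v.valuation_lt_one_iff_mem (K := F) (⟨x⁻¹, hyB⟩ : B)).2 hxM
  have h2 := (Place.mem_ring_iff _ _).1 h
  rw [map_inv₀] at h1
  exact h1.not_ge ((one_le_inv₀ (zero_lt_iff.2 ((Valuation.ne_zero_iff _).2 hx0))).2 h2)

/-- A place at which a given transcendental element is not regular is one of finitely many. -/
lemma finite_poles {y : F} (hy : Transcendental k y) : {P : Place k F | y ∉ P.ring}.Finite := by
  have hy' : Transcendental k y⁻¹ := fun h => hy (by simpa using h.inv)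
  have hy0 : y ≠ 0 := by rintro rfl; exact hy isAlgebraic_zero
  obtain ⟨B, hD, hfrac, hyB, -, hB⟩ := exists_dedekind_subalgebra hy'
  -- The poles of `y` are zeros of `y⁻¹`, so they lie in the finite support of the divisor of the
  -- ideal `y⁻¹ B`.
  refine (idealDivisor k F (Ideal.span {(⟨y⁻¹, hyB⟩ : B)})).support.finite_toSet.subset ?_
  intro P hP
  have hP' : y⁻¹ ∈ P.ring := (P.ring.mem_or_inv_mem y).resolve_left hP
  have hPB : P.Contains B := fun b => hB P hP' _ b.2
  have hne : (⟨y⁻¹, hyB⟩ : B) ≠ 0 := fun h => inv_ne_zero hy0 (congrArg Subtype.val h)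
  rw [Finset.mem_coe, Finsupp.mem_support_iff, idealDivisor_span hne hPB]
  change P.ord y⁻¹ ≠ 0
  rw [P.ord_inv]
  rw [Set.mem_ofPred_eq, P.mem_ring_iff_ord hy0] at hP
  omega

/-- A sufficiently high power of `y` dominates a given element at all the poles of `y`. -/
lemma exists_pow_dominates {y : F} (hy : Transcendental k y) (b : F) :
    ∃ c : ℕ, ∀ n, c ≤ n → ∀ P : Place k F, y ∉ P.ring → b * (y ^ n)⁻¹ ∈ P.ring := by
  have hy0 : y ≠ 0 := by rintro rfl; exact hy isAlgebraic_zero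
  by_cases hb : b = 0
  · exact ⟨0, fun n _ P _ => by rw [hb, zero_mul]; exact zero_mem _⟩
  -- Each pole of `y` has order at least one, so the exponent only has to exceed the largest `|ord
  -- b|` over the finitely many poles.
  refine ⟨(finite_poles hy).toFinset.sup fun P => (P.ord b).natAbs, fun n hn P hP => ?_⟩
  have h1 : (P.ord b).natAbs ≤ n := (Finset.le_sup (f := fun P : Place k F => (P.ord b).natAbs)
    ((finite_poles hy).mem_toFinset.2 hP)).trans hn
  have hyn : y ^ n ≠ 0 := pow_ne_zero _ hy0
  rw [P.mem_ring_iff_ord (mul_ne_zero hb (inv_ne_zero hyn)), P.ord_mul hb (inv_ne_zero hyn),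
    P.ord_inv, P.ord_pow]
  rw [P.mem_ring_iff_ord hy0] at hP
  have h2 : (n : ℤ) ≤ n * -P.ord y := le_mul_of_one_le_right (by positivity) (by omega)
  have h3 : -P.ord b ≤ n := by omega
  linarith

end Dimension

end DrinfeldElliptic

/-! ### The ring of functions regular outside one place, and the product formula -/

namespace DrinfeldElliptic

open IsDedekindDomain UniqueFactorizationMonoid IntermediateField Polynomial

/-- Comparison of leading terms as `m` grows: the bounded shift `c + 1` cannot compensate a larger
slope. -/
lemma le_of_growth {N d c : ℕ} (h : ∀ m, N * m ≤ (m + c + 1) * d) : N ≤ d := by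
  by_contra! hlt
  -- If `N ≥ d + 1`, the inequality gives `m ≤ (c + 1) d`; this is the first `m` that violates it.
  have h1 := h ((c + 1) * d + 1)
  have h2 : (d + 1) * ((c + 1) * d + 1) ≤ N * ((c + 1) * d + 1) := Nat.mul_le_mul_right _ hlt
  nlinarith

section

variable {k F : Type*} [Field k] [Field F] [Algebra k F] {R : Type*} [CommRing R] [Algebra k R]
  [Algebra R F] [IsScalarTower k R F]

lemma Place.ord_algebraMap (P : Place k F) {a : k} (ha : a ≠ 0) : P.ord (algebraMap k F a) = 0 := by
  have h0 : algebraMap k F a ≠ 0 := (_root_.map_ne_zero _).2 ha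
  have h1 := (P.mem_ring_iff_ord h0).1 (P.algebraMap_mem a)
  have h2 := (P.mem_ring_iff_ord (inv_ne_zero h0)).1 (by
    rw [← map_inv₀]; exact P.algebraMap_mem _)
  rw [P.ord_inv] at h2
  omega

lemma Place.inv_mem_of_notMem (P : Place k F) {x : F} (hx : x ∉ P.ring) : x⁻¹ ∈ P.ring :=
  (P.ring.mem_or_inv_mem x).resolve_left hx

/-- A term `y ^ j v i` with `j < m` divided by `y ^ (m + c)` leaves `v i / y ^ (m + c - j)`, whose
exponent is at least `c`. -/
lemma polyComb_mul_inv_pow_mem {P : Place k F} {y : R} (hy : algebraMap R F y ≠ 0) {ι : Type*}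
    [Fintype ι] {v : ι → R} {c : ℕ}
    (hc : ∀ i n, c ≤ n → algebraMap R F (v i) * (algebraMap R F y ^ n)⁻¹ ∈ P.ring) {m : ℕ}
    (p : ι → degreeLT k m) :
    algebraMap R F (polyComb y v m p) * (algebraMap R F y ^ (m + c))⁻¹ ∈ P.ring := by
  rw [polyComb_apply, map_sum, Finset.sum_mul]
  refine sum_mem fun i _ => ?_
  by_cases hp : (p i : k[X]) = 0
  · rw [hp, map_zero, zero_mul, map_zero, zero_mul]
    exact zero_mem _
  have hdeg : (p i : k[X]).natDegree < m := by
    rw [natDegree_lt_iff_degree_lt hp]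
    exact mem_degreeLT.1 (p i).2
  rw [aeval_eq_sum_range' hdeg, Finset.sum_mul, map_sum, Finset.sum_mul]
  refine sum_mem fun j hj => ?_
  have hj' := Finset.mem_range.1 hj
  have h1 := hc i (m + c - j) (by omega)
  have h2 : algebraMap R F ((p i : k[X]).coeff j • y ^ j * v i) * (algebraMap R F y ^ (m + c))⁻¹ =
      algebraMap k F ((p i : k[X]).coeff j) *
        (algebraMap R F (v i) * (algebraMap R F y ^ (m + c - j))⁻¹) := by
    have h3 : algebraMap R F y ^ (m + c) =
        algebraMap R F y ^ j * algebraMap R F y ^ (m + c - j) := by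
      rw [← pow_add]; congr 1; omega
    rw [h3, Algebra.smul_def, map_mul, map_mul, map_pow, ← IsScalarTower.algebraMap_apply]
    field_simp
  rw [h2]
  exact mul_mem (P.algebraMap_mem _) h1

end

section Global

variable {k K : Type*} [Field k] [Finite k] [Field K] [Algebra k K] [OneVariable k K]
  (hK : IsFunctionField k K)

include hK

lemma IsFunctionField.transcendental_of_notMem {x : K} (hx : x ∉ Set.range (algebraMap k K)) :
    Transcendental k x := fun h => hx (hK.constants x h)

lemma IsFunctionField.mem_range_of_forall_mem {x : K} (hx : ∀ P : Place k K, x ∈ P.ring) :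
    x ∈ Set.range (algebraMap k K) := by
  by_contra h
  obtain ⟨P, hP⟩ := exists_place_notMem (hK.transcendental_of_notMem h)
  exact hP (hx P)

lemma IsFunctionField.transcendental_of_ord_ne_zero {x : K} (hx : x ≠ 0) {P : Place k K}
    (hP : P.ord x ≠ 0) : Transcendental k x := by
  refine hK.transcendental_of_notMem ?_
  rintro ⟨a, rfl⟩
  refine hP (P.ord_algebraMap ?_)
  rintro rfl
  exact hx (map_zero _)

variable (inf : Place k K)

/-- There is a nonconstant function whose only pole is `inf`. -/
theorem exists_transcendental_ringA : ∃ f : ringA inf, Transcendental k (f : K) := by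
  classical
  -- The function will be `b / y ^ (m + C)`, with `y` a uniformizer at `inf` and `b` vanishing
  -- enough at the other zeros of `y` to cancel the denominator there.
  obtain ⟨y, hy0, hyord⟩ := inf.exists_ord_eq_one
  have hy : Transcendental k y := hK.transcendental_of_ord_ne_zero hy0 (P := inf) (by omega)
  have hyinf : y ∈ inf.ring := (inf.mem_ring_iff_ord hy0).2 (by omega)
  obtain ⟨B, hD, hfrac, hyB, -, hB⟩ := exists_dedekind_subalgebra hy
  have hfin := OneVariable.finite_adjoin y hy
  let y' : B := ⟨y, hyB⟩
  have hy' : Transcendental k (algebraMap B K y') := hy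
  have hy'0 : y' ≠ 0 := fun h => hy0 (congrArg Subtype.val h)
  have hinfB : inf.Contains B := fun b => hB inf hyinf _ b.2
  have hp : Prime (Place.center hinfB) := (Place.centerSpec hinfB).prime
  have hspan : Ideal.span {y'} ≠ ⊥ := by simpa using hy'0
  have hfm : FiniteMultiplicity (Place.center hinfB) (Ideal.span {y'}) :=
    FiniteMultiplicity.of_prime_left hp hspan
  -- The ideal `(y)` is the center of `inf`, to the first power, times `I`; the factor `I` carries
  -- the zeros of `y` away from `inf`.
  obtain ⟨I, hI, hpI⟩ := hfm.exists_eq_pow_mul_and_not_dvd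
  have hI0 : I ≠ ⊥ := by rintro rfl; exact hpI (dvd_zero _)
  have hmul : multiplicity (Place.center hinfB) (Ideal.span {y'}) = 1 := by
    have := idealDivisor_apply (k := k) (F := K) hspan hinfB
    rw [idealDivisor_span hy'0 hinfB] at this
    change inf.ord y = _ at this
    omega
  rw [hmul, pow_one] at hI
  -- the dimension of `B / I` is less than the degree `N` of `K` over `k(y)`
  obtain ⟨v, hv⟩ := exists_linearIndependent (R := B) k⟮y⟯
  have hd : Module.finrank k (B ⧸ I) < Module.finrank k⟮y⟯ K := by
    have h1 := finrank_quotient_le hy'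
    rw [hI, finrank_quotient_mul K hp.ne_zero hI0] at h1
    have := finite_quotient_ideal k K hp.ne_zero
    have : Nontrivial (B ⧸ Place.center hinfB) := Ideal.Quotient.nontrivial_iff.2
      (Ideal.IsPrime.ne_top inferInstance)
    have h2 : 0 < Module.finrank k (B ⧸ Place.center hinfB) := Module.finrank_pos
    change _ ≤ Module.finrank k⟮y⟯ K at h1
    omega
  generalize Module.finrank k⟮y⟯ K = N at v hv hd
  choose c hc using fun i => exists_pow_dominates hy (v i : K)
  let C := Finset.univ.sup c
  have hC : ∀ i, c i ≤ C := fun i => Finset.le_sup (Finset.mem_univ i)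
  let d := Module.finrank k (B ⧸ I)
  -- The requirement `b ∈ I ^ (m + C)` costs at most `(m + C) d` dimensions out of at least `(d + 1)
  -- m`. The remainder is `m - C d = 2`, one more than the constants occupy.
  let m := C * d + 2
  let φ : (Fin N → degreeLT k m) →ₗ[k] B ⧸ I ^ (m + C) :=
    (Ideal.Quotient.mkₐ k (I ^ (m + C))).toLinearMap ∘ₗ polyComb y' v m
  let θ : (Fin N → degreeLT k m) →ₗ[k] K :=
    LinearMap.mulRight k (y ^ (m + C))⁻¹ ∘ₗ B.val.toLinearMap ∘ₗ polyComb y' v m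
  have hθ : Function.Injective θ :=
    (mul_left_injective₀ (inv_ne_zero (pow_ne_zero _ hy0))).comp
      (Subtype.val_injective.comp (polyComb_injective hy' hv m))
  have hker : 2 ≤ Module.finrank k (LinearMap.ker φ) := by
    have := finite_quotient_ideal k K (pow_ne_zero (m + C) hI0)
    have h1 := LinearMap.finrank_range_add_finrank_ker φ
    have h2 := Submodule.finrank_le (LinearMap.range φ)
    rw [finrank_quotient_pow K hI0] at h2
    rw [finrank_polyCoeff] at h1
    change _ ≤ (m + C) * d at h2
    have h3 : (d + 1) * m ≤ N * m := Nat.mul_le_mul_right _ hd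
    have h4 : (d + 1) * m = (m + C) * d + 2 := by simp only [m]; ring
    omega
  have hmem : ∀ p ∈ LinearMap.ker φ, ∀ P : Place k K, P ≠ inf → θ p ∈ P.ring := by
    intro p hpk P hP
    have hpI : polyComb y' v m p ∈ I ^ (m + C) := Ideal.Quotient.eq_zero_iff_mem.1 hpk
    change algebraMap B K (polyComb y' v m p) * (algebraMap B K y' ^ (m + C))⁻¹ ∈ P.ring
    -- Where `y` is regular, membership in `I ^ (m + C)` cancels the zeros of the denominator; at a
    -- pole of `y`, the choice of `C` bounds `b`.
    by_cases hyP : y ∈ P.ring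
    · have hPB : P.Contains B := fun b => hB P hyP _ b.2
      by_cases hb0 : polyComb y' v m p = 0
      · rw [hb0, map_zero, zero_mul]; exact zero_mem _
      have hb0' : algebraMap B K (polyComb y' v m p) ≠ 0 := fun h => hb0 (Subtype.ext h)
      have hyn0 : algebraMap B K y' ^ (m + C) ≠ 0 := pow_ne_zero _ hy0
      rw [P.mem_ring_iff_ord (mul_ne_zero hb0' (inv_ne_zero hyn0)),
        P.ord_mul hb0' (inv_ne_zero hyn0), P.ord_inv, P.ord_pow, ← idealDivisor_span hb0 hPB,
        ← idealDivisor_span hy'0 hPB]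
      have hpow : ∀ n : ℕ, idealDivisor k K (I ^ n) P = n * idealDivisor k K I P := by
        intro n
        induction n with
        | zero => rw [pow_zero, Ideal.one_eq_top, idealDivisor_top]; simp
        | succ n ih =>
          rw [pow_succ, idealDivisor_mul (pow_ne_zero _ hI0) hI0, Finsupp.add_apply, ih]
          push_cast; ring
      obtain ⟨J, hJ⟩ := Ideal.dvd_iff_le.2 ((Ideal.span_singleton_le_iff_mem _).2 hpI)
      have hJ0 : J ≠ ⊥ := by
        rintro rfl
        rw [Ideal.mul_bot, Ideal.span_singleton_eq_bot] at hJ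
        exact hb0 hJ
      have hJP := idealDivisor_apply (k := k) (F := K) hJ0 hPB
      rw [hJ, hI, idealDivisor_mul (pow_ne_zero _ hI0) hJ0, idealDivisor_mul hp.ne_zero hI0,
        idealDivisor_center, Finsupp.add_apply, Finsupp.add_apply, hpow,
        Finsupp.single_eq_of_ne hP, hJP]
      push_cast
      linarith [Int.natCast_nonneg (multiplicity (Place.center hPB) J)]
    · exact polyComb_mul_inv_pow_mem (P := P) hy0
        (fun i n hn => hc i n ((hC i).trans hn) P hyP) p
  obtain ⟨p, hp, hpc⟩ : ∃ p ∈ LinearMap.ker φ, θ p ∉ Set.range (algebraMap k K) := by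
    by_contra! h
    have hle : (LinearMap.ker φ).map θ ≤ k ∙ (1 : K) := by
      rintro _ ⟨p, hp, rfl⟩
      obtain ⟨a, ha⟩ := h p hp
      rw [← ha, Algebra.algebraMap_eq_smul_one]
      exact Submodule.smul_mem _ _ (Submodule.mem_span_singleton_self _)
    have h1 := Submodule.finrank_mono hle
    rw [finrank_span_singleton one_ne_zero,
      ← (Submodule.equivMapOfInjective θ hθ (LinearMap.ker φ)).finrank_eq] at h1
    omega
  exact ⟨⟨θ p, hmem p hp⟩, hK.transcendental_of_notMem hpc⟩

/-- For a nonconstant `f` in `A`, the integral closure of `k[f]` lies in `A`, since every place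
other than `inf` is regular at `f`; its fraction field is already `K`. -/
lemma isFractionRing_ringA : IsFractionRing (ringA inf) K := by
  obtain ⟨f, hf⟩ := exists_transcendental_ringA hK inf
  obtain ⟨B, -, hfrac, -, -, hB⟩ := exists_dedekind_subalgebra hf
  refine IsFractionRing.of_field _ K fun z => ?_
  obtain ⟨a, b, -, rfl⟩ := IsFractionRing.div_surjective (A := B) z
  exact ⟨⟨a, fun P hP => hB P (f.2 P hP) a a.2⟩, ⟨b, fun P hP => hB P (f.2 P hP) b b.2⟩, rfl⟩

omit hK in
lemma mem_ringA_of_isIntegral {x : K} (hx : IsIntegral (ringA inf) x) : x ∈ ringA inf := by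
  intro P hP
  obtain ⟨p, hp, hpx⟩ := hx
  let f : ringA inf →+* P.ring := Place.toRing (R := ringA inf) fun r => r.2 P hP
  have hint : IsIntegral P.ring x := by
    refine ⟨p.map f, hp.map f, ?_⟩
    rw [Polynomial.eval₂_map]
    exact hpx
  obtain ⟨z, hz⟩ := IsIntegrallyClosed.isIntegral_iff.1 hint
  rw [← hz]
  exact z.2

lemma isIntegrallyClosed_ringA : IsIntegrallyClosed (ringA inf) :=
  have := isFractionRing_ringA hK inf
  (isIntegrallyClosed_iff K).2 fun hx => ⟨⟨_, mem_ringA_of_isIntegral inf hx⟩, rfl⟩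

theorem isDedekindDomain_ringA : IsDedekindDomain (ringA inf) :=
  have := isIntegrallyClosed_ringA hK inf
  isDedekindDomain_of_oneVariable k K

lemma mem_range_of_mem_ringA (a : ringA inf) (ha : (a : K) ∈ inf.ring) :
    (a : K) ∈ Set.range (algebraMap k K) :=
  hK.mem_range_of_forall_mem fun P => by
    by_cases h : P = inf
    · rw [h]; exact ha
    · exact a.2 P h

/-- An element of `A` regular also at `inf` has no pole at all and is constant, but `A` contains a
nonconstant element. -/
lemma contains_ringA_iff {P : Place k K} : P.Contains (ringA inf) ↔ P ≠ inf := by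
  refine ⟨?_, fun h r => r.2 P h⟩
  rintro h rfl
  obtain ⟨f, hf⟩ := exists_transcendental_ringA hK P
  obtain ⟨a, ha⟩ := mem_range_of_mem_ringA hK P f (h f)
  exact hf (ha ▸ isAlgebraic_algebraMap a)

/-- If `f` has a pole at `inf` and `a f` does not, then `a` is regular at `inf`, hence constant; a
nonzero constant could not remove the pole. -/
lemma eq_zero_of_mul_mem {a : ringA inf} {f : K} (hf : f ∉ inf.ring)
    (haf : (a : K) * f ∈ inf.ring) : a = 0 := by
  by_contra ha
  have hf0 : f ≠ 0 := by rintro rfl; exact hf (zero_mem _)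
  have ha1 : (a : K) ∈ inf.ring := by
    have := mul_mem haf (inf.inv_mem_of_notMem hf)
    rwa [mul_assoc, mul_inv_cancel₀ hf0, mul_one] at this
  obtain ⟨c, hc⟩ := mem_range_of_mem_ringA hK inf a ha1
  have hc0 : c ≠ 0 := by
    rintro rfl
    rw [map_zero] at hc
    exact ha (Subtype.ext hc.symm)
  apply hf
  have h1 : f = algebraMap k K c⁻¹ * ((a : K) * f) := by
    rw [← hc, ← mul_assoc, ← map_mul, inv_mul_cancel₀ hc0, map_one, one_mul]
  rw [h1]
  exact mul_mem (inf.algebraMap_mem _) haf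

/-- The number of zeros, and the order of the pole, of a nonconstant element `f` of `A` are both
equal to the degree of `K` over `k(f)`. -/
lemma finrank_quotient_ringA {f : ringA inf} (hf : Transcendental k (f : K)) :
    Module.finrank k (ringA inf ⧸ Ideal.span {f}) = Module.finrank k⟮(f : K)⟯ K ∧
      -inf.ord (f : K) * inf.degree = Module.finrank k⟮(f : K)⟯ K := by
  classical
  have hD := isDedekindDomain_ringA hK inf
  have hfrac := isFractionRing_ringA hK inf
  have hfin := OneVariable.finite_adjoin _ hf
  have hfinf : (f : K) ∉ inf.ring := by
    intro h
    obtain ⟨a, ha⟩ := mem_range_of_mem_ringA hK inf f h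
    exact hf (ha ▸ isAlgebraic_algebraMap a)
  have hf0 : (f : K) ≠ 0 := by rintro h; exact hf (h ▸ isAlgebraic_zero)
  have hf0' : f ≠ 0 := fun h => hf0 (congrArg Subtype.val h)
  have hf' : Transcendental k (algebraMap (ringA inf) K f) := hf
  obtain ⟨v, hv⟩ := exists_linearIndependent (R := ringA inf) k⟮(f : K)⟯
  choose c hc using fun i => exists_pow_dominates hf (v i : K)
  let C := Finset.univ.sup c
  have hC : ∀ i, c i ≤ C := fun i => Finset.le_sup (Finset.mem_univ i)
  have hbound : ∀ m (p : Fin (Module.finrank k⟮(f : K)⟯ K) → degreeLT k m),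
      (polyComb f v m p : K) * ((f : K) ^ (m + C))⁻¹ ∈ inf.ring := fun m p =>
    polyComb_mul_inv_pow_mem (R := ringA inf) (P := inf) hf0
      (fun i n hn => hc i n ((hC i).trans hn) inf hfinf) p
  have hspan : Ideal.span {f} ≠ ⊥ := by simpa using hf0'
  constructor
  -- For the lower bound, a combination divisible by `f ^ (m + C + 1)` would have too large a pole
  -- at `inf`, so the space of dimension `N m` embeds in `A / (f ^ (m + C + 1))`.
  · refine le_antisymm (finrank_quotient_le hf') (le_of_growth (c := C) fun m => ?_)
    let φ : (Fin (Module.finrank k⟮(f : K)⟯ K) → degreeLT k m) →ₗ[k]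
        ringA inf ⧸ Ideal.span {f} ^ (m + C + 1) :=
      (Ideal.Quotient.mkₐ k _).toLinearMap ∘ₗ polyComb f v m
    have hφ : Function.Injective φ := by
      rw [← LinearMap.ker_eq_bot, LinearMap.ker_eq_bot']
      intro p hp
      have h1 : polyComb f v m p ∈ Ideal.span {f} ^ (m + C + 1) :=
        Ideal.Quotient.eq_zero_iff_mem.1 hp
      rw [Ideal.span_singleton_pow, Ideal.mem_span_singleton] at h1
      obtain ⟨a, ha⟩ := h1
      have h2 := hbound m p
      have h3 : a = 0 := by
        refine eq_zero_of_mul_mem hK inf hfinf ?_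
        convert h2 using 1
        rw [ha]
        push_cast
        rw [pow_succ (f : K) (m + C)]
        field_simp
      apply polyComb_injective hf' hv m
      rw [ha, h3, mul_zero, map_zero]
    have := finite_quotient_ideal k K (pow_ne_zero (m + C + 1) hspan)
    have h4 := LinearMap.finrank_le_finrank_of_injective hφ
    rwa [finrank_polyCoeff, finrank_quotient_pow K hspan] at h4
  -- The same count at the pole, in the valuation ring of `inf` with `y = f⁻¹`: combinations are
  -- divided by `f ^ (m + C)` to land there, and divisibility by `y ^ (m + C + 1)` would make `f`
  -- times the combination regular at `inf`.
  · let y : inf.ring := ⟨(f : K)⁻¹, inf.inv_mem_of_notMem hfinf⟩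
    have hy0 : y ≠ 0 := fun h => inv_ne_zero hf0 (congrArg Subtype.val h)
    have hyspan : Ideal.span {y} ≠ ⊥ := by simpa using hy0
    have hy : Transcendental k (algebraMap inf.ring K y) := fun h => by
      have h' : IsAlgebraic k (f : K)⁻¹ := h
      exact hf (inv_inv (f : K) ▸ h'.inv)
    have hfield : k⟮algebraMap inf.ring K y⟯ = k⟮(f : K)⟯ := by
      apply le_antisymm <;> rw [adjoin_simple_le_iff]
      · exact inv_mem (mem_adjoin_simple_self k _)
      · have := inv_mem (mem_adjoin_simple_self k (algebraMap inf.ring K y))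
        rwa [show (algebraMap inf.ring K y)⁻¹ = (f : K) from inv_inv _] at this
    have hdeg : (Module.finrank k (inf.ring ⧸ Ideal.span {y}) : ℤ) =
        -inf.ord (f : K) * inf.degree := by
      have h1 : idealDivisor k K (Ideal.span {y}) = Finsupp.single inf (-inf.ord (f : K)) := by
        ext P
        by_cases hP : P = inf
        · subst hP
          rw [idealDivisor_span hy0 P.self_contains, Finsupp.single_eq_same]
          exact P.ord_inv _
        · rw [Finsupp.single_eq_of_ne hP]
          exact idealDivisor_apply_of_not_contains hyspan fun h => hP (Place.contains_self_iff.1 h)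
      rw [← divisorDegree_idealDivisor (F := K) hyspan, h1, divisorDegree_single]
    rw [← hdeg]
    congr 1
    refine le_antisymm ((finrank_quotient_le hy).trans_eq (by rw [hfield]))
      (le_of_growth (c := C) fun m => ?_)
    let φ₀ : (Fin (Module.finrank k⟮(f : K)⟯ K) → degreeLT k m) →ₗ[k] inf.ring :=
      { toFun := fun p => ⟨(polyComb f v m p : K) * ((f : K) ^ (m + C))⁻¹, hbound m p⟩
        map_add' := fun p q => Subtype.ext (by
          change (polyComb f v m (p + q) : K) * _ = (polyComb f v m p : K) * _ + (polyComb f v m q : K) * _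
          rw [map_add]; push_cast; ring)
        map_smul' := fun a p => Subtype.ext (by
          rw [RingHom.id_apply, Algebra.smul_def]
          change (polyComb f v m (a • p) : K) * _ = algebraMap k K a * ((polyComb f v m p : K) * _)
          rw [map_smul, Algebra.smul_def]
          change algebraMap k K a * (polyComb f v m p : K) * _ = _
          ring) }
    let φ : (Fin (Module.finrank k⟮(f : K)⟯ K) → degreeLT k m) →ₗ[k]
        inf.ring ⧸ Ideal.span {y} ^ (m + C + 1) :=
      (Ideal.Quotient.mkₐ k _).toLinearMap ∘ₗ φ₀
    have hφ : Function.Injective φ := by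
      rw [← LinearMap.ker_eq_bot, LinearMap.ker_eq_bot']
      intro p hp
      have h1 : φ₀ p ∈ Ideal.span {y} ^ (m + C + 1) := Ideal.Quotient.eq_zero_iff_mem.1 hp
      rw [Ideal.span_singleton_pow, Ideal.mem_span_singleton] at h1
      obtain ⟨a, ha⟩ := h1
      have ha' : (polyComb f v m p : K) * ((f : K) ^ (m + C))⁻¹ =
        ((f : K)⁻¹) ^ (m + C + 1) * (a : K) := congrArg Subtype.val ha
      have h3 : polyComb f v m p = 0 := by
        refine eq_zero_of_mul_mem hK inf hfinf ?_
        convert a.2 using 1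
        rw [inv_pow, pow_succ] at ha'
        field_simp at ha'
        exact ha'
      apply polyComb_injective hf' hv m
      rw [h3, map_zero]
    have := finite_quotient_ideal k K (pow_ne_zero (m + C + 1) hyspan)
    have h4 := LinearMap.finrank_le_finrank_of_injective hφ
    rwa [finrank_polyCoeff, finrank_quotient_pow K hyspan] at h4

lemma finrank_quotient_ringA_eq_ord {a : ringA inf} (ha : a ≠ 0) :
    (Module.finrank k (ringA inf ⧸ Ideal.span {a}) : ℤ) = -inf.ord (a : K) * inf.degree := by
  by_cases hc : (a : K) ∈ Set.range (algebraMap k K)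
  · obtain ⟨c, hc⟩ := hc
    have hc0 : c ≠ 0 := by
      rintro rfl
      rw [map_zero] at hc
      exact ha (Subtype.ext hc.symm)
    have hu : IsUnit a := by
      have : a = algebraMap k (ringA inf) c := Subtype.ext hc.symm
      rw [this]
      exact (IsUnit.mk0 c hc0).map _
    have hs : Subsingleton (ringA inf ⧸ (⊤ : Ideal (ringA inf))) := inferInstance
    rw [Ideal.span_singleton_eq_top.2 hu, Module.finrank_zero_of_subsingleton, ← hc,
      inf.ord_algebraMap hc0]
    simp
  · have h := finrank_quotient_ringA hK inf (hK.transcendental_of_notMem hc)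
    rw [h.1, h.2]

include inf in
/-- A principal divisor has degree `0`. -/
theorem divisorDegree_principal {g : K} (hg : g ≠ 0) {D : Divisor k K}
    (hD : ∀ P : Place k K, D P = P.ord g) : divisorDegree k K D = 0 := by
  have hDd := isDedekindDomain_ringA hK inf
  have hfrac := isFractionRing_ringA hK inf
  obtain ⟨a, b, hb, rfl⟩ := IsFractionRing.div_surjective (A := ringA inf) g
  have hb0 : b ≠ 0 := nonZeroDivisors.ne_zero hb
  have ha0 : a ≠ 0 := by rintro rfl; simp at hg
  have hinj := IsFractionRing.injective (ringA inf) K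
  have hmem : ∀ a : ringA inf, a ≠ 0 → algebraMap (ringA inf) K a ≠ 0 := fun a ha =>
    (map_ne_zero_iff _ hinj).2 ha
  have hspan : ∀ a : ringA inf, a ≠ 0 → Ideal.span {a} ≠ ⊥ := fun a ha => by simpa using ha
  -- Away from `inf` the divisor of `a / b` is given by the ideals `(a)` and `(b)`; the degree of
  -- each cancels against its own term at `inf`.
  have h1 : D = idealDivisor k K (Ideal.span {a}) - idealDivisor k K (Ideal.span {b}) +
      Finsupp.single inf (inf.ord (a : K) - inf.ord (b : K)) := by
    ext P
    rw [hD, P.ord_div (hmem a ha0) (hmem b hb0), Finsupp.add_apply, Finsupp.sub_apply]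
    by_cases hP : P = inf
    · have hP' : ¬ P.Contains (ringA inf) := fun h => (contains_ringA_iff hK inf).1 h hP
      rw [idealDivisor_apply_of_not_contains (hspan a ha0) hP',
        idealDivisor_apply_of_not_contains (hspan b hb0) hP', hP, Finsupp.single_eq_same]
      simp
    · have hP' : P.Contains (ringA inf) := (contains_ringA_iff hK inf).2 hP
      rw [idealDivisor_span ha0 hP', idealDivisor_span hb0 hP', Finsupp.single_eq_of_ne hP]
      simp
  rw [h1, map_add, map_sub, divisorDegree_idealDivisor (hspan a ha0),
    divisorDegree_idealDivisor (hspan b hb0), divisorDegree_single,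
    finrank_quotient_ringA_eq_ord hK inf ha0, finrank_quotient_ringA_eq_ord hK inf hb0]
  ring

/-- Either `h` or `h⁻¹` is regular at `inf`, and it then has no poles. -/
lemma isUnit_ringA_mem_range {h : K} (h0 : h ≠ 0) (hord : ∀ P : Place k K, P ≠ inf → P.ord h = 0) :
    h ∈ Set.range (algebraMap k K) := by
  have hmem : ∀ h : K, h ≠ 0 → (∀ P : Place k K, P ≠ inf → P.ord h = 0) → h ∈ inf.ring →
      h ∈ Set.range (algebraMap k K) := fun h h0 hord hinf =>
    mem_range_of_mem_ringA hK inf ⟨h, fun P hP => (P.mem_ring_iff_ord h0).2 (hord P hP).ge⟩ hinf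
  rcases inf.ring.mem_or_inv_mem h with hh | hh
  · exact hmem h h0 hord hh
  · obtain ⟨a, ha⟩ := hmem h⁻¹ (inv_ne_zero h0)
      (fun P hP => by rw [P.ord_inv, hord P hP, neg_zero]) hh
    exact ⟨a⁻¹, by rw [map_inv₀, ha, inv_inv]⟩

end Global

end DrinfeldElliptic

/-! ### The constants of degree two and the conjugation -/

namespace DrinfeldElliptic

open IsDedekindDomain UniqueFactorizationMonoid IntermediateField Polynomial

section FiniteConstants

variable (k : Type*) {F : Type*} [Field k] [Finite k] [Field F] [Algebra k F]

/-- The Frobenius endomorphism `x ↦ x ^ q` of a field containing `k = 𝔽_q`. -/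
def frob (F : Type*) [Field F] [Algebra k F] : F →ₐ[k] F :=
  letI := Fintype.ofFinite k
  FiniteField.frobeniusAlgHom k F

lemma frob_apply (x : F) : frob k F x = x ^ Nat.card k := by
  let := Fintype.ofFinite k
  rw [Nat.card_eq_fintype_card]
  rfl

lemma frob_frob (x : F) : frob k F (frob k F x) = x ^ (Nat.card k ^ 2) := by
  rw [frob_apply, frob_apply, ← pow_mul, sq]

-- The elements of `k` already account for all `q` possible roots of `X ^ q - X`.
variable {k} in
lemma mem_range_of_frob_eq {x : F} (hx : frob k F x = x) : x ∈ Set.range (algebraMap k F) := by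
  let := Fintype.ofFinite k
  rw [frob_apply, Nat.card_eq_fintype_card] at hx
  by_contra hx'
  classical
  have hq := FiniteField.X_pow_card_sub_X_ne_zero F (Fintype.one_lt_card (α := k))
  have hdeg := FiniteField.X_pow_card_sub_X_natDegree_eq F (Fintype.one_lt_card (α := k))
  let s : Finset F := insert x (Finset.univ.map ⟨algebraMap k F, (algebraMap k F).injective⟩)
  have hs : s.card = Fintype.card k + 1 := by
    rw [Finset.card_insert_of_notMem, Finset.card_map, Finset.card_univ]
    simpa using hx'
  have hsub : s.val ≤ (X ^ Fintype.card k - X : F[X]).roots := by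
    rw [Finset.val_le_iff_val_subset]
    intro y hy
    rw [mem_roots hq, IsRoot.def, eval_sub, eval_pow, eval_X, sub_eq_zero]
    rcases Finset.mem_insert.1 hy with rfl | hy
    · exact hx
    · obtain ⟨a, -, rfl⟩ := Finset.mem_map.1 hy
      change algebraMap k F a ^ _ = algebraMap k F a
      rw [← map_pow, FiniteField.pow_card]
  have h1 := (Multiset.card_le_card hsub).trans (card_roots' _)
  rw [hdeg] at h1
  change s.card ≤ _ at h1
  omega

/-- `ε` is an element of `𝔽_{q²}` not in `𝔽_q`. -/
structure IsQuadConst (ε : F) : Prop where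
  pow_sq : ε ^ (Nat.card k ^ 2) = ε
  pow_ne : ε ^ Nat.card k ≠ ε

variable {k} {ε : F}

lemma IsQuadConst.frob_frob (hε : IsQuadConst k ε) : frob k F (frob k F ε) = ε := by
  rw [DrinfeldElliptic.frob_frob, hε.pow_sq]

lemma IsQuadConst.frob_ne (hε : IsQuadConst k ε) : frob k F ε ≠ ε := by
  rw [frob_apply]; exact hε.pow_ne

lemma IsQuadConst.sub_ne_zero (hε : IsQuadConst k ε) : frob k F ε - ε ≠ 0 :=
  _root_.sub_ne_zero.2 hε.frob_ne

lemma IsQuadConst.map {F' : Type*} [Field F'] [Algebra k F'] (hε : IsQuadConst k ε) (f : F →+* F') :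
    IsQuadConst k (f ε) :=
  ⟨by rw [← map_pow, hε.pow_sq], by rw [← map_pow]; exact f.injective.ne hε.pow_ne⟩

lemma IsQuadConst.frob_mem (hε : IsQuadConst k ε) : IsQuadConst k (frob k F ε) :=
  hε.map (frob k F).toRingHom

/-- Applying Frobenius to `x = u + v ε` forces `v = (x ^ q - x) / (ε ^ q - ε)`; this quotient and `x
- v ε` are both fixed by Frobenius. -/
lemma IsQuadConst.exists_eq (hε : IsQuadConst k ε) {x : F} (hx : x ^ (Nat.card k ^ 2) = x) :
    ∃ u v : k, x = algebraMap k F u + algebraMap k F v * ε := by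
  rw [← DrinfeldElliptic.frob_frob] at hx
  obtain ⟨v, hv⟩ := mem_range_of_frob_eq (k := k) (x := (frob k F x - x) / (frob k F ε - ε)) (by
    rw [map_div₀, map_sub, map_sub, hx, hε.frob_frob, ← neg_sub, ← neg_sub (frob k F ε),
      neg_div_neg_eq])
  have hv' : algebraMap k F v * (frob k F ε - ε) = frob k F x - x := by
    rw [hv, div_mul_cancel₀ _ hε.sub_ne_zero]
  obtain ⟨u, hu⟩ := mem_range_of_frob_eq (k := k) (x := x - algebraMap k F v * ε) (by
    rw [map_sub, map_mul, AlgHom.commutes]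
    linear_combination -hv')
  exact ⟨u, v, by rw [hu]; ring⟩

lemma IsQuadConst.exists_trace (hε : IsQuadConst k ε) :
    ∃ T : k, algebraMap k F T = frob k F ε + ε :=
  mem_range_of_frob_eq (by rw [map_add, hε.frob_frob, add_comm])

lemma IsQuadConst.exists_norm (hε : IsQuadConst k ε) :
    ∃ D : k, algebraMap k F D = frob k F ε * ε :=
  mem_range_of_frob_eq (by rw [map_mul, hε.frob_frob, mul_comm])

lemma IsQuadConst.isIntegral (hε : IsQuadConst k ε) : IsIntegral k ε := by
  obtain ⟨T, hT⟩ := hε.exists_trace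
  obtain ⟨D, hD⟩ := hε.exists_norm
  refine ⟨X ^ 2 - C T * X + C D, ?_, ?_⟩
  · monicity!
  · simp only [eval₂_add, eval₂_sub, eval₂_mul, eval₂_pow, eval₂_X, eval₂_C, hT, hD]
    ring

lemma IsQuadConst.notMem_range (hε : IsQuadConst k ε) : ε ∉ Set.range (algebraMap k F) := by
  rintro ⟨a, rfl⟩
  exact hε.frob_ne (AlgHom.commutes _ _)

/-- An element of a finite field extension of odd degree of `k` that lies in `𝔽_{q²}` is in `k`. -/
lemma frob_eq_of_odd_finrank (h : Odd (Module.finrank k F)) {x : F}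
    (hx : x ^ (Nat.card k ^ 2) = x) : frob k F x = x := by
  have : Module.Finite k F := Module.finite_of_finrank_pos h.pos
  have : Finite F := Module.finite_of_finite k
  let := Fintype.ofFinite F
  obtain ⟨m, hm⟩ := h
  have h1 := FiniteField.pow_card x
  rw [← Nat.card_eq_fintype_card, Module.natCard_eq_pow_finrank (K := k), hm, pow_add, pow_mul,
    pow_one] at h1
  rw [pow_mul] at h1
  -- The field has `q ^ (2 m + 1)` elements, so `x = x ^ (q ^ (2 m + 1))`; the even part of the
  -- exponent acts trivially on `x`, leaving `x ^ q`.
  have h2 : ∀ m : ℕ, x ^ (Nat.card k ^ 2) ^ m = x := by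
    intro m
    induction m with
    | zero => simp
    | succ m ih => rw [pow_succ, pow_mul, ih, hx]
  rw [h2] at h1
  rw [frob_apply, h1]

end FiniteConstants

section QuadraticExtension

variable {k K L : Type*} [Field k] [Finite k] [Field K] [Field L] [Algebra k K] [Algebra K L]
  [Algebra k L] [IsScalarTower k K L]

lemma isQuadConst_of_notMem {ε : L} (h1 : ε ^ (Nat.card k ^ 2) = ε)
    (h2 : ε ∉ Set.range (algebraMap K L)) : IsQuadConst k ε := by
  refine ⟨h1, fun h => h2 ?_⟩
  rw [← frob_apply] at h
  obtain ⟨a, rfl⟩ := mem_range_of_frob_eq h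
  exact ⟨algebraMap k K a, (IsScalarTower.algebraMap_apply k K L a).symm⟩

variable {ε : L}

lemma IsQuadConst.notMem_range_of_constants (hK : IsFunctionField k K) (hε : IsQuadConst k ε) :
    ε ∉ Set.range (algebraMap K L) := by
  rintro ⟨x, rfl⟩
  obtain ⟨a, rfl⟩ := hK.constants x
    ((isAlgebraic_algebraMap_iff (algebraMap K L).injective).1 hε.isIntegral.isAlgebraic)
  exact hε.frob_ne (by rw [← IsScalarTower.algebraMap_apply k K L, AlgHom.commutes])

variable [Algebra.IsQuadraticExtension K L]

lemma adjoin_eq_top_of_notMem (hε : ε ∉ Set.range (algebraMap K L)) : K⟮ε⟯ = ⊤ := by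
  have h2 : (Module.finrank K L).Prime := by
    rw [Algebra.IsQuadraticExtension.finrank_eq_two K L]; exact Nat.prime_two
  refine ((IntermediateField.isSimpleOrder_of_finrank_prime K L h2).eq_bot_or_eq_top _).resolve_left
    fun h => hε ?_
  have := mem_adjoin_simple_self K ε
  rw [h] at this
  exact mem_bot.1 this

lemma IsQuadConst.isSeparable (hε : IsQuadConst k ε) : IsSeparable K ε := by
  have hε2 := hε.pow_sq
  let := Fintype.ofFinite k
  obtain ⟨p, _, n, hp, hn⟩ := FiniteField.card' k
  have : CharP K p := charP_of_injective_algebraMap (algebraMap k K).injective p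
  refine (galois_poly_separable (K := K) p (Nat.card k ^ 2) ?_).of_dvd (minpoly.dvd K ε ?_)
  · rw [Nat.card_eq_fintype_card, hn]
    exact dvd_pow (dvd_pow_self _ n.pos.ne') two_ne_zero
  · rw [map_sub, map_pow, aeval_X, hε2, sub_self]

lemma IsQuadConst.isGalois (hK : IsFunctionField k K) (hε : IsQuadConst k ε) : IsGalois K L := by
  have h1 := (isSeparable_adjoin_simple_iff_isSeparable K L).2 (hε.isSeparable (K := K))
  rw [adjoin_eq_top_of_notMem (hε.notMem_range_of_constants hK)] at h1
  have : Algebra.IsSeparable K L :=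
    Algebra.IsSeparable.of_algHom K (⊤ : IntermediateField K L) topEquiv.symm.toAlgHom
  infer_instance

/-- A nontrivial automorphism permutes the roots `ε`, `ε ^ q` of `X ^ 2 - T X + D`, whose
coefficients are constants. -/
lemma exists_conjugation (hK : IsFunctionField k K) (hε : IsQuadConst k ε) :
    ∃ σ : L ≃ₐ[K] L, σ ε = frob k L ε := by
  have := hε.isGalois hK
  obtain ⟨σ, hσ⟩ : ∃ σ : L ≃ₐ[K] L, σ ε ≠ ε := by
    by_contra! h
    exact hε.notMem_range_of_constants hK ((IsGalois.mem_range_algebraMap_iff_fixed ε).2 h)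
  refine ⟨σ, ?_⟩
  obtain ⟨T, hT⟩ := hε.exists_trace
  obtain ⟨D, hD⟩ := hε.exists_norm
  have hσc : ∀ a : k, σ (algebraMap k L a) = algebraMap k L a := fun a => by
    rw [IsScalarTower.algebraMap_apply k K L, AlgEquiv.commutes]
  have h1 : ε ^ 2 - algebraMap k L T * ε + algebraMap k L D = 0 := by rw [hT, hD]; ring
  have h2 := congrArg σ h1
  rw [map_add, map_sub, map_mul, map_pow, hσc, hσc, map_zero, hT, hD] at h2
  have h3 : (σ ε - ε) * (σ ε - frob k L ε) = 0 := by linear_combination h2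
  exact sub_eq_zero.1 ((mul_eq_zero.1 h3).resolve_left (sub_ne_zero.2 hσ))

end QuadraticExtension

end DrinfeldElliptic

/-! ### Degrees in the constant extension and the inert place -/

namespace DrinfeldElliptic

open IsDedekindDomain UniqueFactorizationMonoid

section Degrees

variable {k K L : Type*} [Field k] [Finite k] [Field K] [Field L] [Algebra k K] [Algebra K L]
  [Algebra k L] [IsScalarTower k K L]

namespace Place

lemma finite_residueField [OneVariable k K] (P : Place k K) :
    Module.Finite k (IsLocalRing.ResidueField P.ring) :=
  finite_quotient_ideal k K (IsDiscreteValuationRing.not_a_field P.ring)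

lemma center_eq_maximalIdeal {P Q : Place k K} (h : P.Contains Q.ring) :
    center h = IsLocalRing.maximalIdeal Q.ring := by
  obtain rfl := contains_self_iff.1 h
  rfl

lemma degree_pos [OneVariable k K] (P : Place k K) : 0 < P.degree := by
  have := P.finite_residueField
  rw [degree_eq]
  exact Module.finrank_pos

/-- In a residue field of odd degree the image of `ε` would be fixed by Frobenius, so `ε ^ q - ε`
would vanish there; but it is a unit. -/
lemma even_degree {ε : L} (hε : IsQuadConst k ε) (Q : Place k L) : Even Q.degree := by
  rw [← Nat.not_odd_iff_even, degree_eq]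
  intro hodd
  have hεQ : ε ∈ Q.ring := by
    obtain ⟨z, hz⟩ := IsIntegrallyClosed.isIntegral_iff.1 (hε.isIntegral.tower_top (A := Q.ring))
    rw [← hz]
    exact z.2
  have h1 := frob_eq_of_odd_finrank hodd (x := IsLocalRing.residue Q.ring ⟨ε, hεQ⟩) (by
    rw [← map_pow]
    congr 1
    exact Subtype.ext hε.pow_sq)
  rw [frob_apply, ← map_pow, ← sub_eq_zero, ← map_sub, IsLocalRing.residue_eq_zero_iff] at h1
  refine h1 ?_
  -- The difference `ε ^ q - ε` is nonzero and equal to its own `q²`-th power.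
  refine IsUnit.of_pow_eq_one (n := Nat.card k ^ 2 - 1) (Subtype.ext ?_) ?_
  · change (ε ^ Nat.card k - ε) ^ (Nat.card k ^ 2 - 1) = 1
    rw [← frob_apply]
    refine mul_left_cancel₀ hε.sub_ne_zero ?_
    have h0 : 0 < Nat.card k ^ 2 := pow_pos Nat.card_pos 2
    rw [← pow_succ', Nat.sub_add_cancel h0, ← DrinfeldElliptic.frob_frob, map_sub, map_sub,
      hε.frob_frob, mul_one]
  · have : 1 < Nat.card k := Finite.one_lt_card
    have : 1 < Nat.card k ^ 2 := Nat.one_lt_pow two_ne_zero this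
    omega

variable [FiniteDimensional K L]

lemma degree_under_mul_inertiaDeg (Q : Place k L) :
    (Q.under K).degree * Q.inertiaDeg K = Q.degree := by
  rw [degree_eq, degree_eq]
  let := (IsLocalRing.ResidueField.map (Q.ringMap K)).toAlgebra
  have : IsScalarTower k (IsLocalRing.ResidueField (Q.under K).ring)
      (IsLocalRing.ResidueField Q.ring) := by
    refine IsScalarTower.of_algebraMap_eq fun a => ?_
    change IsLocalRing.residue Q.ring _ = IsLocalRing.residue Q.ring _
    congr 1
    exact Subtype.ext (IsScalarTower.algebraMap_apply k K L a)
  exact Module.finrank_mul_finrank k (IsLocalRing.ResidueField (Q.under K).ring)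
    (IsLocalRing.ResidueField Q.ring)

end Place

variable [FiniteDimensional K L]

lemma divisorDegree_divisorNorm [OneVariable k K] [OneVariable k L] (D : Divisor k L) :
    divisorDegree k K (divisorNorm K D) = divisorDegree k L D := by
  have : (divisorDegree k K).comp (divisorNormHom k K L) = divisorDegree k L := by
    ext Q
    simp only [AddMonoidHom.comp_apply, Finsupp.singleAddHom_apply]
    rw [divisorNormHom_apply, divisorNorm_single, divisorDegree_single, divisorDegree_single,
      ← Q.degree_under_mul_inertiaDeg (K := K)]
    push_cast
    ring
  exact DFunLike.congr_fun this D

lemma even_divisorDegree [OneVariable k L] {ε : L} (hε : IsQuadConst k ε) (D : Divisor k L) :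
    Even (divisorDegree k L D) := by
  induction D using Finsupp.induction_linear with
  | zero => simp
  | add D E hD hE => rw [map_add]; exact hD.add hE
  | single Q n =>
    rw [divisorDegree_single]
    exact ((Int.even_coe_nat _).2 (Q.even_degree hε)).mul_left n

/-- A place of odd degree is inert in the quadratic constant extension. -/
theorem exists_unique_place_above [OneVariable k L] [Algebra.IsQuadraticExtension K L]
    [IsGalois K L] {ε : L} (hε : IsQuadConst k ε) {inf : Place k K} (hinf : Odd inf.degree) :
    ∃ Q : Place k L, Q.under K = inf ∧ Q.inertiaDeg K = 2 ∧
      ∀ Q' : Place k L, Q'.under K = inf → Q' = Q := by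
  let R := inf.ring
  let S := integralClosure R L
  have : IsFractionRing S L :=
    IsIntegralClosure.isFractionRing_of_finite_extension R K L _
  have : IsDedekindDomain S := IsIntegralClosure.isDedekindDomain R K L _
  have : Module.Finite R S := IsIntegralClosure.finite R K L _
  let p : Ideal S := (IsLocalRing.maximalIdeal R).map (algebraMap R S)
  -- The extended ideal `p` has norm `m ^ 2`, while a prime above `m` has norm `m ^ f`. Once `f ≥ 2`
  -- is known, no room is left for a second factor of `p`.
  have hp : Ideal.relNorm R p = IsLocalRing.maximalIdeal R ^ 2 := by
    rw [Ideal.relNorm_algebraMap, ← IsFractionRing.finrank_eq R K S L,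
      Algebra.IsQuadraticExtension.finrank_eq_two K L]
  have hm0 : IsLocalRing.maximalIdeal R ≠ ⊥ := IsDiscreteValuationRing.not_a_field R
  have hmu : ¬ IsUnit (IsLocalRing.maximalIdeal R) := by
    rw [Ideal.isUnit_iff]; exact Ideal.IsPrime.ne_top inferInstance
  have hinj : ∀ m n : ℕ, IsLocalRing.maximalIdeal R ^ m = IsLocalRing.maximalIdeal R ^ n → m = n :=
    fun m n h => pow_injective_of_not_isUnit hmu hm0 h
  have key : ∀ (Q : Place k L), Q.under K = inf → ∃ hQ : Q.Contains S,
      Place.center hQ = p ∧ Q.inertiaDeg K = 2 := by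
    intro Q hQ
    have hQR : (Q.under K).Contains R := by rw [Place.contains_self_iff, hQ]
    have hQS : Q.Contains S := Place.contains_of_under hQR
    have hu : (Place.center hQS).under R = IsLocalRing.maximalIdeal R := by
      rw [← Place.center_under hQS hQR, Place.center_eq_maximalIdeal]
    have h1 : Ideal.relNorm R (Place.center hQS) = IsLocalRing.maximalIdeal R ^ Q.inertiaDeg K := by
      rw [relNorm_prime K L _ (Place.center_ne_bot hQS), hu, Place.inertiaDeg_eq (R := R) hQS]
    have h2 : p ≤ Place.center hQS := by
      rw [Ideal.map_le_iff_le_comap]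
      exact hu.ge
    obtain ⟨J, hJ⟩ := Ideal.dvd_iff_le.2 h2
    have hfpos : 0 < Q.inertiaDeg K := by
      rw [Nat.pos_iff_ne_zero]
      intro h
      have := Q.degree_under_mul_inertiaDeg (K := K)
      rw [h] at this
      exact Q.degree_pos.ne (by simpa using this)
    -- The degree of `Q` is even and equals `f` times the odd degree of `inf`.
    have hfeven : Even (Q.inertiaDeg K) := by
      have h := Q.even_degree hε
      rw [← Q.degree_under_mul_inertiaDeg (K := K), hQ, Nat.even_mul] at h
      exact h.resolve_left (Nat.not_even_iff_odd.2 hinf)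
    have hf2 : 2 ≤ Q.inertiaDeg K := by
      obtain ⟨r, hr⟩ := hfeven; omega
    have h3 : IsLocalRing.maximalIdeal R ^ 2 =
        IsLocalRing.maximalIdeal R ^ 2 * (IsLocalRing.maximalIdeal R ^ (Q.inertiaDeg K - 2) *
          Ideal.relNorm R J) := by
      rw [← mul_assoc, ← pow_add, Nat.add_sub_cancel' hf2, ← h1, ← map_mul, ← hJ, hp]
    have h4 : IsLocalRing.maximalIdeal R ^ (Q.inertiaDeg K - 2) * Ideal.relNorm R J = 1 :=
      (mul_left_cancel₀ (pow_ne_zero 2 hm0) (by rw [← h3, mul_one])).symm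
    have h5 : Ideal.relNorm R J = ⊤ := Ideal.isUnit_iff.1 (IsUnit.of_mul_eq_one_right _ h4)
    have h6 : J = ⊤ := by
      by_contra hne
      have := Ideal.relNorm_le_comap R J
      rw [h5, top_le_iff, Ideal.comap_eq_top_iff] at this
      exact hne this
    rw [h6, Ideal.mul_top] at hJ
    exact ⟨hQS, hJ.symm, hinj _ _ (by rw [← h1, ← hJ, hp])⟩
  obtain ⟨q, hq, hpq⟩ := Ideal.exists_le_maximal p (fun h => by
    rw [h, Ideal.relNorm_top] at hp
    exact hmu (IsUnit.of_mul_eq_one _ (by rw [← sq, ← hp, Ideal.one_eq_top])))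
  have hq0 : q ≠ ⊥ := fun h => by
    rw [h, le_bot_iff] at hpq
    rw [hpq, Ideal.relNorm_bot] at hp
    exact pow_ne_zero 2 hm0 hp.symm
  let v : HeightOneSpectrum S := ⟨q, hq.isPrime, hq0⟩
  have hv : (Place.ofPrime k L v).Contains S := Place.ofPrime_contains v
  have hu : (Place.ofPrime k L v).under K = inf :=
    Place.contains_self_iff.1 (Place.under_contains (R := R) hv)
  obtain ⟨h1, h2, h3⟩ := key _ hu
  refine ⟨_, hu, h3, fun Q' hQ' => ?_⟩
  obtain ⟨h1', h2', h3'⟩ := key _ hQ'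
  exact Place.eq_of_center_eq h1' h1 (by rw [h2, h2'])

end Degrees

section Principal

variable {k K L : Type*} [Field k] [Finite k] [Field K] [Field L] [Algebra k K] [Algebra K L]
  [Algebra k L] [IsScalarTower k K L] [FiniteDimensional K L] [IsGalois K L] [OneVariable k K]
  [OneVariable k L]

/-- The norm preserves degrees and sends the divisor of `x` to that of the norm of `x`, so the case
of `K` suffices. -/
theorem divisorDegree_principal_extension (hK : IsFunctionField k K) (inf : Place k K) {x : L}
    (hx : x ≠ 0) {D : Divisor k L} (hD : ∀ Q : Place k L, D Q = Q.ord x) :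
    divisorDegree k L D = 0 := by
  rw [← divisorDegree_divisorNorm (K := K)]
  exact divisorDegree_principal hK inf (Algebra.norm_ne_zero_iff.2 hx) (divisorNorm_principal hx hD)

end Principal

end DrinfeldElliptic

/-! ### Ideals of an étale quadratic algebra as lattices -/

namespace DrinfeldElliptic

section QuadraticLattice

variable {R S : Type*} [CommRing R] [CommRing S] [Algebra R S]

/-- `e` generates the quadratic `R`-algebra `S` with conjugation `τ`, and has unit discriminant. -/
structure IsEtaleGenerator (e : S) (τ : S ≃ₐ[R] S) : Prop where
  exists_eq : ∀ z : S, ∃ x y : R, z = algebraMap R S x + algebraMap R S y * e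
  eq_zero : ∀ x y : R, algebraMap R S x + algebraMap R S y * e = 0 → x = 0 ∧ y = 0
  trace : ∃ T : R, algebraMap R S T = τ e + e
  norm : ∃ D : R, algebraMap R S D = τ e * e
  isUnit : IsUnit (τ e - e)
  finrank : Module.finrank R S = 2

/-- `J = I₁ + I₂ (e + s)`. -/
def IsLattice (e : S) (J : Ideal S) (I₁ I₂ : Ideal R) (s : R) : Prop :=
  ∀ z : S, z ∈ J ↔ ∃ x ∈ I₁, ∃ y ∈ I₂,
    z = algebraMap R S x + algebraMap R S y * (e + algebraMap R S s)

namespace IsEtaleGenerator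

variable {e : S} {τ : S ≃ₐ[R] S} (he : IsEtaleGenerator e τ)

include he

lemma eq_of_eq {x y x' y' s : R} (h : algebraMap R S x + algebraMap R S y * (e + algebraMap R S s) =
    algebraMap R S x' + algebraMap R S y' * (e + algebraMap R S s)) : x = x' ∧ y = y' := by
  have h1 : algebraMap R S (x - x' + (y - y') * s) + algebraMap R S (y - y') * e = 0 := by
    simp only [map_add, map_sub, map_mul]
    linear_combination h
  obtain ⟨h2, h3⟩ := he.eq_zero _ _ h1
  rw [h3, zero_mul, add_zero] at h2
  exact ⟨sub_eq_zero.1 h2, sub_eq_zero.1 h3⟩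

lemma exists_norm_add (s : R) :
    ∃ n : R, algebraMap R S n = (τ e + algebraMap R S s) * (e + algebraMap R S s) := by
  obtain ⟨T, hT⟩ := he.trace
  obtain ⟨D, hD⟩ := he.norm
  refine ⟨D + s * T + s ^ 2, ?_⟩
  simp only [map_add, map_mul, map_pow, hT, hD]
  ring

variable {J : Ideal S} {I₁ I₂ : Ideal R} {s : R}

lemma algebraMap_mem_iff (hJ : IsLattice e J I₁ I₂ s) (x : R) : algebraMap R S x ∈ J ↔ x ∈ I₁ := by
  constructor
  · intro hx
    obtain ⟨x', hx', y', hy', h⟩ := (hJ _).1 hx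
    obtain ⟨rfl, -⟩ := he.eq_of_eq (x := x) (y := 0) (x' := x') (y' := y') (s := s)
      (by rw [map_zero, zero_mul, add_zero]; exact h)
    exact hx'
  · intro hx
    exact (hJ _).2 ⟨x, hx, 0, zero_mem _, by simp⟩

lemma mul_add_mem_iff (hJ : IsLattice e J I₁ I₂ s) (y : R) :
    algebraMap R S y * (e + algebraMap R S s) ∈ J ↔ y ∈ I₂ := by
  constructor
  · intro hx
    obtain ⟨x', hx', y', hy', h⟩ := (hJ _).1 hx
    obtain ⟨-, rfl⟩ := he.eq_of_eq (x := 0) (y := y) (x' := x') (y' := y') (s := s)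
      (by rw [map_zero, zero_add]; exact h)
    exact hy'
  · intro hy
    exact (hJ _).2 ⟨0, zero_mem _, y, hy, by simp⟩

lemma le_of_isLattice (hJ : IsLattice e J I₁ I₂ s) : I₁ ≤ I₂ := fun x hx =>
  (he.mul_add_mem_iff hJ x).1 (J.mul_mem_right _ ((he.algebraMap_mem_iff hJ x).2 hx))

lemma mul_norm_mem (hJ : IsLattice e J I₁ I₂ s) {n : R}
    (hn : algebraMap R S n = (τ e + algebraMap R S s) * (e + algebraMap R S s)) {y : R}
    (hy : y ∈ I₂) : y * n ∈ I₁ := by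
  rw [← he.algebraMap_mem_iff hJ, map_mul, hn]
  have := J.mul_mem_left (τ e + algebraMap R S s) ((he.mul_add_mem_iff hJ y).2 hy)
  convert this using 1
  ring

/-- The product of a lattice with its conjugate. -/
lemma mul_map_eq (hJ : IsLattice e J I₁ I₂ s) :
    J * J.map τ = (I₁ * I₂).map (algebraMap R S) := by
  obtain ⟨n, hn⟩ := he.exists_norm_add s
  have hI : ∀ x ∈ I₁, ∀ y ∈ I₂, algebraMap R S (x * y) ∈ (I₁ * I₂).map (algebraMap R S) :=
    fun x hx y hy => Ideal.mem_map_of_mem _ (Ideal.mul_mem_mul hx hy)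
  apply le_antisymm
  · refine Ideal.mul_le.2 fun z hz z' hz' => ?_
    obtain ⟨w, hw, rfl⟩ := (Ideal.mem_map_of_equiv τ _).1 hz'
    obtain ⟨x, hx, y, hy, rfl⟩ := (hJ _).1 hz
    obtain ⟨x', hx', y', hy', rfl⟩ := (hJ _).1 hw
    have h1 : (algebraMap R S x + algebraMap R S y * (e + algebraMap R S s)) *
        τ (algebraMap R S x' + algebraMap R S y' * (e + algebraMap R S s)) =
        algebraMap R S (x * x') + algebraMap R S (x * y') * (τ e + algebraMap R S s) +
          algebraMap R S (x' * y) * (e + algebraMap R S s) + algebraMap R S (y * n * y') := by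
      simp only [map_add, map_mul, AlgEquiv.commutes, hn]
      ring
    rw [h1]
    exact add_mem (add_mem (add_mem (hI _ hx _ (he.le_of_isLattice hJ hx'))
      (Ideal.mul_mem_right _ _ (hI _ hx _ hy'))) (Ideal.mul_mem_right _ _ (hI _ hx' _ hy)))
      (hI _ (he.mul_norm_mem hJ hn hy) _ hy')
  · refine Ideal.map_le_iff_le_comap.2 (Ideal.mul_le.2 fun x hx y hy => ?_)
    rw [Ideal.mem_comap]
    have hxJ := (he.algebraMap_mem_iff hJ x).2 hx
    have hyJ := (he.mul_add_mem_iff hJ y).2 hy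
    have h1 := Ideal.mul_mem_mul hxJ (Ideal.mem_map_of_mem τ hyJ)
    have h2 := Ideal.mul_mem_mul hyJ (Ideal.mem_map_of_mem τ hxJ)
    -- The elements `x τ(y (e + s))` and `y (e + s) τ(x)` lie in the product, and their difference
    -- is `x y (τ e - e)`; the unit factor can be dropped.
    rw [← Ideal.mul_unit_mem_iff_mem _ he.isUnit]
    have h3 := sub_mem h1 h2
    rw [map_mul, map_add, AlgEquiv.commutes, AlgEquiv.commutes, AlgEquiv.commutes] at h3
    convert h3 using 1
    rw [map_mul]
    ring

omit he in
lemma exists_combination {I I' : Ideal R} {y₁ y₂ c : R} (hI : I = Ideal.span {y₁, y₂})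
    (hc : c ∈ I * I') : ∃ q₁ ∈ I', ∃ q₂ ∈ I', c = y₁ * q₁ + y₂ * q₂ := by
  rw [hI, Ideal.span_insert, Ideal.sup_mul] at hc
  obtain ⟨_, h1, _, h2, rfl⟩ := Submodule.mem_sup.1 hc
  obtain ⟨q₁, hq₁, rfl⟩ := Ideal.mem_span_singleton_mul.1 h1
  obtain ⟨q₂, hq₂, rfl⟩ := Ideal.mem_span_singleton_mul.1 h2
  exact ⟨q₁, hq₁, q₂, hq₂, rfl⟩

variable [IsDedekindDomain R] [IsDedekindDomain S] [Module.Finite R S] [Module.IsTorsionFree R S]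

/-- `I₁` is the contraction of `J` and `I₂` the ideal of its `e`-coordinates. The projection `J →
I₂` splits because `I₂` is invertible, and since `e I₁ ⊆ J` the splitting has the form `y ↦ y (e +
s)` with `s` in `R`. -/
theorem exists_isLattice (hJ : J ≠ ⊥) :
    ∃ I₁ I₂ : Ideal R, ∃ s : R, I₁ ≠ ⊥ ∧ I₂ ≠ ⊥ ∧ IsLattice e J I₁ I₂ s := by
  let I₁ : Ideal R := J.comap (algebraMap R S)
  let I₂ : Ideal R :=
    { carrier := {y | ∃ x : R, algebraMap R S x + algebraMap R S y * e ∈ J}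
      zero_mem' := ⟨0, by simp⟩
      add_mem' := by
        rintro y y' ⟨x, hx⟩ ⟨x', hx'⟩
        refine ⟨x + x', ?_⟩
        convert add_mem hx hx' using 1
        rw [map_add, map_add]; ring
      smul_mem' := by
        rintro r y ⟨x, hx⟩
        refine ⟨r * x, ?_⟩
        convert J.mul_mem_left (algebraMap R S r) hx using 1
        rw [smul_eq_mul, map_mul, map_mul]; ring }
  have hI₁ : I₁ ≠ ⊥ := fun h => by
    have h1 := Ideal.relNorm_le_comap R J
    change _ ≤ I₁ at h1
    rw [h, le_bot_iff, Ideal.relNorm_eq_bot_iff] at h1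
    exact hJ h1
  have hle : I₁ ≤ I₂ := fun x hx => ⟨0, by
    rw [map_zero, zero_add]; exact J.mul_mem_right _ hx⟩
  have hI₂ : I₂ ≠ ⊥ := fun h => hI₁ (le_bot_iff.1 (h ▸ hle))
  obtain ⟨c, hc, hc0⟩ := Submodule.exists_mem_ne_zero_of_ne_bot hI₂
  obtain ⟨y₂, hy⟩ := IsDedekindDomain.exists_eq_span_pair hc hc0
  obtain ⟨I', hI'⟩ := Ideal.dvd_iff_le.2 ((Ideal.span_singleton_le_iff_mem _).2 hc)
  -- With `I₂ I' = (c)`, the relation `c = c q₁ + y₂ q₂` is a dual basis of `I₂`; it yields the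
  -- linear section `y ↦ y N / c + y e`.
  obtain ⟨q₁, hq₁, q₂, hq₂, hcq⟩ := exists_combination hy
    (hI'.le (Ideal.mem_span_singleton_self c))
  obtain ⟨x₁, hx₁⟩ := hc
  obtain ⟨x₂, hx₂⟩ : y₂ ∈ I₂ := by rw [hy]; exact Ideal.subset_span (by simp)
  let N := q₁ * x₁ + q₂ * x₂
  have key : ∀ y ∈ I₂, ∃ n : R, c * n = y * N ∧ algebraMap R S n + algebraMap R S y * e ∈ J := by
    intro y hyI
    have hdvd : ∀ q ∈ I', ∃ r, q * y = c * r := fun q hq => by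
      have h1 : y * q ∈ I₂ * I' := Ideal.mul_mem_mul hyI hq
      rw [← hI', Ideal.mem_span_singleton] at h1
      obtain ⟨r, hr⟩ := h1
      exact ⟨r, by rw [mul_comm, hr]⟩
    obtain ⟨r₁, hr₁⟩ := hdvd q₁ hq₁
    obtain ⟨r₂, hr₂⟩ := hdvd q₂ hq₂
    have hy' : r₁ * c + r₂ * y₂ = y := by
      refine mul_left_cancel₀ hc0 ?_
      linear_combination (-c) * hr₁ - y₂ * hr₂ - y * hcq
    refine ⟨r₁ * x₁ + r₂ * x₂, ?_, ?_⟩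
    · simp only [N]
      linear_combination (-x₁) * hr₁ - x₂ * hr₂
    · convert add_mem (J.mul_mem_left (algebraMap R S r₁) hx₁)
        (J.mul_mem_left (algebraMap R S r₂) hx₂) using 1
      rw [← hy']
      simp only [map_add, map_mul]
      ring
  -- For `x` in `I₁`, both the lift of `x` and `x e` lie in `J`, so `x N / c` lies in `I₁`. Hence `N
  -- I₁ ⊆ c I₁`, and `I₁` cancels.
  obtain ⟨s, hs⟩ : c ∣ N := by
    have h1 : Ideal.span {N} * I₁ ≤ Ideal.span {c} * I₁ := by
      intro z hz
      obtain ⟨x, hx, rfl⟩ := Ideal.mem_span_singleton_mul.1 hz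
      obtain ⟨n, hn, hnJ⟩ := key x (hle hx)
      rw [mul_comm N, ← hn]
      refine Ideal.mem_span_singleton_mul.2 ⟨n, ?_, rfl⟩
      have h2 := sub_mem hnJ (J.mul_mem_right e hx)
      rwa [add_sub_cancel_right] at h2
    rw [← Ideal.dvd_iff_le, mul_dvd_mul_iff_right (by exact hI₁), Ideal.dvd_iff_le,
      Ideal.span_singleton_le_span_singleton] at h1
    exact h1
  have key' : ∀ y ∈ I₂, algebraMap R S y * (e + algebraMap R S s) ∈ J := fun y hyI => by
    obtain ⟨n, hn, hnJ⟩ := key y hyI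
    rw [hs, ← mul_assoc, mul_comm y c, mul_assoc] at hn
    rw [mul_left_cancel₀ hc0 hn] at hnJ
    convert hnJ using 1
    rw [map_mul]; ring
  refine ⟨I₁, I₂, s, hI₁, hI₂, fun z => ⟨fun hz => ?_, ?_⟩⟩
  · obtain ⟨x, y, rfl⟩ := he.exists_eq z
    have hyI : y ∈ I₂ := ⟨x, hz⟩
    refine ⟨x - y * s, ?_, y, hyI, by rw [map_sub, map_mul]; ring⟩
    have h1 := sub_mem hz (key' y hyI)
    change algebraMap R S _ ∈ J
    convert h1 using 1
    rw [map_sub, map_mul]; ring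
  · rintro ⟨x, hx, y, hyI, rfl⟩
    exact add_mem hx (key' y hyI)

/-- Taking norms in `J τ(J) = (I₁ I₂) S` gives `N(J) ^ 2 = (I₁ I₂) ^ 2`, and square roots of ideals
are unique. -/
lemma relNorm_eq (hJ : IsLattice e J I₁ I₂ s) : Ideal.relNorm R J = I₁ * I₂ := by
  have h1 := congrArg (Ideal.relNorm R) (he.mul_map_eq hJ)
  rw [map_mul, Ideal.relNorm_map_algEquiv, Ideal.relNorm_algebraMap, he.finrank, ← sq] at h1
  exact pow_left_injective two_ne_zero h1

/-- A rank two lattice `I₁ ⊕ I₂` with `I₁ I₂ = (a)` is free: writing `a = y₁ x₂ + y₂ x₁`, the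
vectors `(x₁, y₁)` and `(-x₂, y₂)` have determinant `a`, and Cramer's rule expresses every element
with coefficients in `R`. -/
lemma exists_basis (hJ0 : J ≠ ⊥) {a : R} (ha : a ≠ 0) (hJ : Ideal.relNorm R J = Ideal.span {a}) :
    ∃ α ∈ J, ∃ β ∈ J, β ≠ 0 ∧ ∀ z ∈ J, ∃ c d : R, z = algebraMap R S c * α + algebraMap R S d * β := by
  obtain ⟨I₁, I₂, s, hI₁, hI₂, hlat⟩ := he.exists_isLattice hJ0
  rw [he.relNorm_eq hlat] at hJ
  obtain ⟨y₁, hy₁, hy0⟩ := Submodule.exists_mem_ne_zero_of_ne_bot hI₂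
  obtain ⟨y₂, hy⟩ := IsDedekindDomain.exists_eq_span_pair hy₁ hy0
  have hy₂ : y₂ ∈ I₂ := by rw [hy]; exact Ideal.subset_span (by simp)
  obtain ⟨x₂, hx₂, x₁, hx₁, hax⟩ := exists_combination hy (I' := I₁) (c := a)
    (by rw [mul_comm, hJ]; exact Ideal.mem_span_singleton_self a)
  refine ⟨_, (hlat _).2 ⟨x₁, hx₁, y₁, hy₁, rfl⟩, _, (hlat _).2 ⟨-x₂, neg_mem hx₂, y₂, hy₂, rfl⟩,
    fun h0 => ha ?_, fun z hz => ?_⟩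
  · obtain ⟨h1, h2⟩ := he.eq_of_eq (x := -x₂) (y := y₂) (x' := 0) (y' := 0) (s := s)
      (by rw [h0]; simp)
    rw [hax, h2, neg_eq_zero.1 h1]
    simp
  obtain ⟨x, hx, y, hyI, rfl⟩ := (hlat _).1 hz
  have hdvd : ∀ u ∈ I₁ * I₂, ∃ c, u = a * c := fun u hu => by
    rw [hJ, Ideal.mem_span_singleton] at hu; exact hu
  obtain ⟨c, hc⟩ := hdvd (x * y₂ + x₂ * y) (add_mem (Ideal.mul_mem_mul hx hy₂)
    (Ideal.mul_mem_mul hx₂ hyI))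
  obtain ⟨d, hd⟩ := hdvd (x₁ * y - x * y₁) (sub_mem (Ideal.mul_mem_mul hx₁ hyI)
    (Ideal.mul_mem_mul hx hy₁))
  have h1 : x = c * x₁ + d * -x₂ := by
    refine mul_left_cancel₀ ha ?_
    linear_combination x * hax + x₁ * hc - x₂ * hd
  have h2 : y = c * y₁ + d * y₂ := by
    refine mul_left_cancel₀ ha ?_
    linear_combination y * hax + y₁ * hc + y₂ * hd
  refine ⟨c, d, ?_⟩
  conv_lhs => rw [h1, h2]
  simp only [map_add, map_mul]
  ring

end IsEtaleGenerator

end QuadraticLattice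

end DrinfeldElliptic

/-! ### Ideal classes, their norm, and classes of lattice ideals -/

namespace DrinfeldElliptic

open scoped nonZeroDivisors

section IdealClass

variable {R : Type*} [CommRing R] [IsDedekindDomain R]

lemma idealClass_eq_mk0 {I : Ideal R} (hI : I ≠ ⊥) :
    idealClass I = ClassGroup.mk0 ⟨I, mem_nonZeroDivisors_iff_ne_zero.2 hI⟩ := dif_neg hI

lemma idealClass_mul {I J : Ideal R} (hI : I ≠ ⊥) (hJ : J ≠ ⊥) :
    idealClass (I * J) = idealClass I * idealClass J := by
  rw [idealClass_eq_mk0 hI, idealClass_eq_mk0 hJ, idealClass_eq_mk0 (mul_ne_zero hI hJ), ← map_mul]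
  rfl

lemma idealClass_span_singleton {a : R} (ha : a ≠ 0) : idealClass (Ideal.span {a}) = 1 := by
  have h : Ideal.span {a} ≠ ⊥ := by simpa using ha
  rw [idealClass_eq_mk0 h, ClassGroup.mk0_eq_one_iff]
  exact ⟨⟨a, rfl⟩⟩

lemma idealClass_top : idealClass (⊤ : Ideal R) = 1 := by
  rw [← Ideal.span_singleton_one, idealClass_span_singleton one_ne_zero]

lemma idealClass_pow {I : Ideal R} (hI : I ≠ ⊥) (n : ℕ) : idealClass (I ^ n) = idealClass I ^ n := by
  induction n with
  | zero => rw [pow_zero, pow_zero, Ideal.one_eq_top, idealClass_top]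
  | succ n ih => rw [pow_succ, pow_succ, idealClass_mul (pow_ne_zero n hI) hI, ih]

lemma idealClass_eq_iff {I J : Ideal R} (hI : I ≠ ⊥) (hJ : J ≠ ⊥) :
    idealClass I = idealClass J ↔ ∃ x y : R, x ≠ 0 ∧ y ≠ 0 ∧
      Ideal.span {x} * I = Ideal.span {y} * J := by
  rw [idealClass_eq_mk0 hI, idealClass_eq_mk0 hJ, ClassGroup.mk0_eq_mk0_iff]
  constructor
  · rintro ⟨x, y, hx, hy, h⟩
    exact ⟨x, y, hx, hy, h⟩
  · rintro ⟨x, y, hx, hy, h⟩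
    exact ⟨x, y, hx, hy, h⟩

lemma idealClass_eq_one_iff {I : Ideal R} (hI : I ≠ ⊥) :
    idealClass I = 1 ↔ ∃ a : R, a ≠ 0 ∧ I = Ideal.span {a} := by
  constructor
  · intro h
    rw [idealClass_eq_mk0 hI, ClassGroup.mk0_eq_one_iff] at h
    obtain ⟨a, ha⟩ := h.1
    refine ⟨a, ?_, ha⟩
    rintro rfl
    exact hI (by rw [ha]; simp)
  · rintro ⟨a, ha, rfl⟩
    exact idealClass_span_singleton ha

lemma exists_idealClass_eq (c : ClassGroup R) : ∃ I : Ideal R, I ≠ ⊥ ∧ idealClass I = c := by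
  obtain ⟨⟨I, hI⟩, rfl⟩ := ClassGroup.mk0_surjective c
  exact ⟨I, mem_nonZeroDivisors_iff_ne_zero.1 hI,
    idealClass_eq_mk0 (mem_nonZeroDivisors_iff_ne_zero.1 hI)⟩

variable (R) {S : Type*} [CommRing S] [IsDedekindDomain S] [Algebra R S] [Module.Finite R S]
  [Module.IsTorsionFree R S]

lemma idealClass_relNorm_congr {I J : Ideal S} (hI : I ≠ ⊥) (hJ : J ≠ ⊥)
    (h : idealClass I = idealClass J) :
    idealClass (Ideal.relNorm R I) = idealClass (Ideal.relNorm R J) := by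
  obtain ⟨x, y, hx, hy, hxy⟩ := (idealClass_eq_iff hI hJ).1 h
  have h0 : ∀ {I : Ideal S}, I ≠ ⊥ → Ideal.relNorm R I ≠ ⊥ := fun hI => by
    rwa [Ne, Ideal.relNorm_eq_bot_iff]
  have h1 : ∀ {x : S}, x ≠ 0 → Algebra.intNorm R S x ≠ 0 := fun {x} hx h => by
    have := h0 (I := Ideal.span {x}) (by simpa using hx)
    rw [Ideal.relNorm_singleton, h] at this
    simp at this
  rw [idealClass_eq_iff (h0 hI) (h0 hJ)]
  refine ⟨_, _, h1 hx, h1 hy, ?_⟩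
  rw [← Ideal.relNorm_singleton, ← Ideal.relNorm_singleton, ← map_mul, ← map_mul, hxy]

/-- The norm on ideal class groups. -/
def classNorm : ClassGroup S →* ClassGroup R where
  toFun c := idealClass (Ideal.relNorm R (exists_idealClass_eq c).choose)
  map_one' := by
    have h := (exists_idealClass_eq (1 : ClassGroup S)).choose_spec
    rw [idealClass_relNorm_congr R h.1 (J := ⊤) top_ne_bot (by rw [h.2, idealClass_top]),
      Ideal.relNorm_top, idealClass_top]
  map_mul' c d := by
    have h := (exists_idealClass_eq (c * d)).choose_spec
    have h0 : ∀ {I : Ideal S}, I ≠ ⊥ → Ideal.relNorm R I ≠ ⊥ := fun hI => by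
      rwa [Ne, Ideal.relNorm_eq_bot_iff]
    have hc := (exists_idealClass_eq c).choose_spec
    have hd := (exists_idealClass_eq d).choose_spec
    rw [idealClass_relNorm_congr R h.1 (mul_ne_zero hc.1 hd.1)
      (by rw [h.2, idealClass_mul hc.1 hd.1, hc.2, hd.2]), map_mul, idealClass_mul (h0 hc.1) (h0 hd.1)]

lemma classNorm_idealClass {I : Ideal S} (hI : I ≠ ⊥) :
    classNorm R (idealClass I) = idealClass (Ideal.relNorm R I) :=
  idealClass_relNorm_congr R (exists_idealClass_eq _).choose_spec.1 hI
    (exists_idealClass_eq (idealClass I)).choose_spec.2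

end IdealClass

section QuadraticLattice

variable {R S : Type*} [CommRing R] [CommRing S] [Algebra R S]

/-- The ideal `t R + (e + s) R`, provided that this is an ideal. -/
def latticeIdeal (e : S) (s t : R) : Ideal S :=
  Ideal.span {algebraMap R S t, e + algebraMap R S s}

namespace IsEtaleGenerator

variable {e : S} {τ : S ≃ₐ[R] S} (he : IsEtaleGenerator e τ)

include he

/-- The norm condition is exactly what makes `t R + (e + s) R` stable under `e`, so it is the ideal
spanned by its two generators. -/
lemma isLattice_latticeIdeal {s t : R} (h : ∃ t' : R, (τ e + algebraMap R S s) *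
    (e + algebraMap R S s) = algebraMap R S t * algebraMap R S t') :
    IsLattice e (latticeIdeal e s t) (Ideal.span {t}) ⊤ s := by
  obtain ⟨t', ht⟩ := h
  obtain ⟨T, hT⟩ := he.trace
  intro z
  rw [latticeIdeal, Ideal.mem_span_pair]
  constructor
  · rintro ⟨a, b, rfl⟩
    obtain ⟨a₀, a₁, rfl⟩ := he.exists_eq a
    obtain ⟨b₀, b₁, rfl⟩ := he.exists_eq b
    refine ⟨t * (a₀ - a₁ * s - b₁ * t'), Ideal.mul_mem_right _ _ (Ideal.mem_span_singleton_self t),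
      a₁ * t + b₀ + b₁ * (T + s), trivial, ?_⟩
    simp only [map_add, map_mul, map_sub, hT]
    linear_combination (-algebraMap R S b₁) * ht
  · rintro ⟨x, hx, y, -, rfl⟩
    obtain ⟨x, rfl⟩ := Ideal.mem_span_singleton.1 hx
    exact ⟨algebraMap R S x, algebraMap R S y, by rw [map_mul]; ring⟩

lemma mem_latticeIdeal {s t : R} (h : ∃ t' : R, (τ e + algebraMap R S s) *
    (e + algebraMap R S s) = algebraMap R S t * algebraMap R S t') (z : S) :
    z ∈ latticeIdeal e s t ↔ ∃ a b : R, z = algebraMap R S t * algebraMap R S a +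
      (e + algebraMap R S s) * algebraMap R S b := by
  rw [he.isLattice_latticeIdeal h]
  constructor
  · rintro ⟨x, hx, y, -, rfl⟩
    obtain ⟨x, rfl⟩ := Ideal.mem_span_singleton.1 hx
    exact ⟨x, y, by rw [map_mul]; ring⟩
  · rintro ⟨a, b, rfl⟩
    exact ⟨t * a, Ideal.mul_mem_right _ _ (Ideal.mem_span_singleton_self t), b, trivial,
      by rw [map_mul]; ring⟩

lemma eq_zero_of_combination [IsDomain R] {s t p q : R} (ht : t ≠ 0)
    (h : algebraMap R S p * (e + algebraMap R S s) + algebraMap R S q * algebraMap R S t = 0) :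
    p = 0 ∧ q = 0 := by
  obtain ⟨h1, h2⟩ := he.eq_of_eq (x := q * t) (y := p) (x' := 0) (y' := 0) (s := s)
    (by rw [map_mul, map_zero, zero_mul, add_zero, ← h]; ring)
  exact ⟨h2, (mul_eq_zero.1 h1).resolve_right ht⟩

lemma injective_algebraMap : Function.Injective (algebraMap R S) := by
  rw [injective_iff_map_eq_zero]
  intro a ha
  exact (he.eq_zero a 0 (by rw [ha]; simp)).1

lemma latticeIdeal_ne_bot {s t : R} (ht : t ≠ 0) : latticeIdeal e s t ≠ ⊥ := by
  intro h
  have h1 : algebraMap R S t ∈ latticeIdeal e s t := Ideal.subset_span (by simp)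
  rw [h, Ideal.mem_bot] at h1
  exact ht (he.injective_algebraMap (by rw [h1, map_zero]))

lemma map_latticeIdeal (s t : R) :
    (latticeIdeal e s t).map τ = Ideal.span {algebraMap R S t, τ e + algebraMap R S s} := by
  rw [latticeIdeal, Ideal.map_span, Set.image_pair]
  simp

variable [IsDedekindDomain R] [IsDedekindDomain S] [Module.Finite R S] [Module.IsTorsionFree R S]

/-- Here `I₁ = (t)` and `I₂ = R`, so the product of the ideal with its conjugate is `t S`, which is
principal. -/
lemma idealClass_map_latticeIdeal {s t : R} (ht : t ≠ 0) (h : ∃ t' : R, (τ e + algebraMap R S s) *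
    (e + algebraMap R S s) = algebraMap R S t * algebraMap R S t') :
    idealClass ((latticeIdeal e s t).map τ) = (idealClass (latticeIdeal e s t))⁻¹ := by
  have h1 := he.mul_map_eq (he.isLattice_latticeIdeal h)
  rw [Ideal.mul_top, Ideal.map_span, Set.image_singleton] at h1
  have h0 := he.latticeIdeal_ne_bot (s := s) ht
  have ht' : algebraMap R S t ≠ 0 := (map_ne_zero_iff _ he.injective_algebraMap).2 ht
  have h2 : (latticeIdeal e s t).map τ ≠ ⊥ := by
    intro h2
    rw [h2, Ideal.mul_bot, eq_comm, Ideal.span_singleton_eq_bot] at h1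
    exact ht' h1
  rw [eq_inv_iff_mul_eq_one, mul_comm, ← idealClass_mul h0 h2, h1, idealClass_span_singleton ht']

lemma classNorm_latticeIdeal {s t : R} (ht : t ≠ 0) (h : ∃ t' : R, (τ e + algebraMap R S s) *
    (e + algebraMap R S s) = algebraMap R S t * algebraMap R S t') :
    classNorm R (idealClass (latticeIdeal e s t)) = 1 := by
  rw [classNorm_idealClass R (he.latticeIdeal_ne_bot ht), he.relNorm_eq (he.isLattice_latticeIdeal h),
    Ideal.mul_top, idealClass_span_singleton ht]

/-- A principal norm gives an `R`-basis `α, β` of an ideal in the class. Scaling by `β` turns it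
into `α / β, 1`, and stability under `e` puts `α / β` in the form `(e + s) / t`. -/
theorem exists_latticeIdeal {c : ClassGroup S} (hc : classNorm R c = 1) :
    ∃ s t : R, t ≠ 0 ∧ (∃ t' : R, (τ e + algebraMap R S s) * (e + algebraMap R S s) =
      algebraMap R S t * algebraMap R S t') ∧ idealClass (latticeIdeal e s t) = c := by
  obtain ⟨J, hJ0, rfl⟩ := exists_idealClass_eq c
  rw [classNorm_idealClass R hJ0,
    idealClass_eq_one_iff (by rwa [Ne, Ideal.relNorm_eq_bot_iff])] at hc
  obtain ⟨a, ha, hJ⟩ := hc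
  obtain ⟨α, hα, β, hβ, hβ0, hspan⟩ := he.exists_basis hJ0 ha hJ
  obtain ⟨t, s', hts⟩ := hspan (e * β) (J.mul_mem_left e hβ)
  -- Expanding the conjugate multiple of `α` in the basis shows that the norm of `e - s'` is `t d`,
  -- which is the norm condition.
  obtain ⟨c, d, hcd⟩ := hspan ((τ e - algebraMap R S s') * α) (J.mul_mem_left _ hα)
  obtain ⟨n, hn⟩ := he.exists_norm_add (-s')
  rw [map_neg] at hn
  have h1 : (e - algebraMap R S s') * β = algebraMap R S t * α := by linear_combination hts
  have h2 : n = t * d := by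
    have h3 : algebraMap R S n * β = (algebraMap R S (c * -s' + t * d) +
        algebraMap R S c * e) * β := by
      rw [hn, map_add, map_mul, map_mul, map_neg]
      linear_combination (τ e - algebraMap R S s' - algebraMap R S c) * h1 + algebraMap R S t * hcd
    have h4 := mul_right_cancel₀ hβ0 h3
    obtain ⟨h5, h6⟩ := he.eq_zero (c * -s' + t * d - n) c (by rw [map_sub, h4]; ring)
    rw [h6] at h5
    linear_combination -h5
  have ht : t ≠ 0 := by
    rintro rfl
    rw [map_zero, zero_mul, mul_eq_zero] at h1
    have := he.eq_zero (-s') 1 (by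
      rw [map_neg, map_one, one_mul]; linear_combination h1.resolve_right hβ0)
    exact one_ne_zero this.2
  have h3 : ∃ t' : R, (τ e + algebraMap R S (-s')) * (e + algebraMap R S (-s')) =
      algebraMap R S t * algebraMap R S t' :=
    ⟨d, by rw [← map_mul, ← h2, hn, map_neg]⟩
  refine ⟨-s', t, ht, h3, ?_⟩
  rw [idealClass_eq_iff (he.latticeIdeal_ne_bot ht) hJ0]
  -- Since `(e - s') β = t α`, multiplying `t R + (e - s') R` by `β` gives `t (R β + R α) = t J`.
  refine ⟨β, algebraMap R S t, hβ0, (map_ne_zero_iff _ he.injective_algebraMap).2 ht, ?_⟩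
  ext z
  rw [Ideal.mem_span_singleton_mul, Ideal.mem_span_singleton_mul]
  constructor
  · rintro ⟨w, hw, rfl⟩
    obtain ⟨x, y, rfl⟩ := (he.mem_latticeIdeal h3 w).1 hw
    refine ⟨algebraMap R S x * β + algebraMap R S y * α,
      add_mem (J.mul_mem_left _ hβ) (J.mul_mem_left _ hα), ?_⟩
    rw [map_neg]
    linear_combination (-algebraMap R S y) * h1
  · rintro ⟨w, hw, rfl⟩
    obtain ⟨x, y, rfl⟩ := hspan w hw
    refine ⟨_, (he.mem_latticeIdeal h3 _).2 ⟨y, x, rfl⟩, ?_⟩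
    rw [map_neg]
    linear_combination (algebraMap R S x) * h1

/-- Equal classes mean that the two lattices agree after scaling. Their bases then differ by an
invertible matrix, and eliminating the scalars leaves the cleared form of `g ω = ω'`. -/
theorem idealClass_latticeIdeal_eq_iff {s t s' t' : R} (ht : t ≠ 0) (ht' : t' ≠ 0)
    (h : ∃ u : R, (τ e + algebraMap R S s) * (e + algebraMap R S s) =
      algebraMap R S t * algebraMap R S u)
    (h' : ∃ u : R, (τ e + algebraMap R S s') * (e + algebraMap R S s') =
      algebraMap R S t' * algebraMap R S u) :
    idealClass (latticeIdeal e s t) = idealClass (latticeIdeal e s' t') ↔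
      ∃ g : GL (Fin 2) R,
        (e + algebraMap R S s') * (algebraMap R S (g.val 1 0) * (e + algebraMap R S s) +
          algebraMap R S (g.val 1 1) * algebraMap R S t) =
        algebraMap R S t' * (algebraMap R S (g.val 0 0) * (e + algebraMap R S s) +
          algebraMap R S (g.val 0 1) * algebraMap R S t) := by
  rw [idealClass_eq_iff (he.latticeIdeal_ne_bot ht) (he.latticeIdeal_ne_bot ht')]
  have hmem : ∀ {s t : R}, e + algebraMap R S s ∈ latticeIdeal e s t ∧
      algebraMap R S t ∈ latticeIdeal e s t :=
    ⟨Ideal.subset_span (by simp), Ideal.subset_span (by simp)⟩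
  constructor
  · rintro ⟨x, y, hx, hy, hxy⟩
    have key : ∀ z ∈ latticeIdeal e s' t', ∃ a b : R, y * z = x * (algebraMap R S a *
        (e + algebraMap R S s) + algebraMap R S b * algebraMap R S t) := fun z hz => by
      have h1 := Ideal.mul_mem_mul (Ideal.mem_span_singleton_self y) hz
      rw [← hxy, Ideal.mem_span_singleton_mul] at h1
      obtain ⟨w, hw, hwz⟩ := h1
      obtain ⟨b, a, rfl⟩ := (he.mem_latticeIdeal h w).1 hw
      exact ⟨a, b, by rw [← hwz]; ring⟩
    have key' : ∀ z ∈ latticeIdeal e s t, ∃ a b : R, x * z = y * (algebraMap R S a *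
        (e + algebraMap R S s') + algebraMap R S b * algebraMap R S t') := fun z hz => by
      have h1 := Ideal.mul_mem_mul (Ideal.mem_span_singleton_self x) hz
      rw [hxy, Ideal.mem_span_singleton_mul] at h1
      obtain ⟨w, hw, hwz⟩ := h1
      obtain ⟨b, a, rfl⟩ := (he.mem_latticeIdeal h' w).1 hw
      exact ⟨a, b, by rw [← hwz]; ring⟩
    obtain ⟨a, b, hab⟩ := key _ hmem.1
    obtain ⟨c, d, hcd⟩ := key _ hmem.2
    obtain ⟨a', b', hab'⟩ := key' _ hmem.1
    obtain ⟨c', d', hcd'⟩ := key' _ hmem.2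
    -- Comparing coefficients of the independent elements `e + s` and `t` shows that the two
    -- transition matrices are inverse to each other.
    have h1 := he.eq_zero_of_combination (s := s) (p := a' * a + b' * c - 1) (q := a' * b + b' * d) ht
      (by
        refine mul_left_cancel₀ hx ?_
        simp only [map_add, map_mul, map_sub, map_one]
        linear_combination (-algebraMap R S a') * hab - (algebraMap R S b') * hcd - hab')
    have h2 := he.eq_zero_of_combination (s := s) (p := c' * a + d' * c) (q := c' * b + d' * d - 1) ht
      (by
        refine mul_left_cancel₀ hx ?_
        simp only [map_add, map_mul, map_sub, map_one]
        linear_combination (-algebraMap R S c') * hab - (algebraMap R S d') * hcd - hcd')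
    have hM : !![a', b'; c', d'] * !![a, b; c, d] = (1 : Matrix (Fin 2) (Fin 2) R) := by
      rw [Matrix.mul_fin_two, Matrix.one_fin_two, sub_eq_zero.1 h1.1, h1.2, h2.1, sub_eq_zero.1 h2.2]
    refine ⟨⟨!![a, b; c, d], !![a', b'; c', d'], mul_eq_one_comm.1 hM, hM⟩, ?_⟩
    refine mul_left_cancel₀ (mul_ne_zero hx hy) ?_
    simp only [Matrix.of_apply, Matrix.cons_val', Matrix.cons_val_zero, Matrix.cons_val_one,
      Matrix.cons_val_fin_one]
    linear_combination (y * algebraMap R S t') * hab - (y * (e + algebraMap R S s')) * hcd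
  · rintro ⟨g, hg⟩
    set a := g.val 0 0
    set b := g.val 0 1
    set c := g.val 1 0
    set d := g.val 1 1
    obtain ⟨v, hv⟩ := ((Matrix.isUnit_iff_isUnit_det _).1 g.isUnit).exists_right_inv
    rw [Matrix.det_fin_two] at hv
    change (a * d - b * c) * v = 1 at hv
    have hv' : (algebraMap R S a * algebraMap R S d - algebraMap R S b * algebraMap R S c) *
        algebraMap R S v = 1 := by
      rw [← map_mul, ← map_mul, ← map_sub, ← map_mul, hv, map_one]
    have hδ : algebraMap R S c * (e + algebraMap R S s) + algebraMap R S d * algebraMap R S t ≠ 0 := by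
      intro h0
      obtain ⟨h1, h2⟩ := he.eq_zero_of_combination ht h0
      rw [h1, h2] at hv
      simp at hv
    -- The scalars are `t'` and the denominator `c (e + s) + d t`, which is nonzero because the
    -- determinant is a unit.
    refine ⟨_, _, (map_ne_zero_iff _ he.injective_algebraMap).2 ht', hδ, ?_⟩
    ext z
    rw [Ideal.mem_span_singleton_mul, Ideal.mem_span_singleton_mul]
    constructor
    · rintro ⟨w, hw, rfl⟩
      obtain ⟨x, y, rfl⟩ := (he.mem_latticeIdeal h w).1 hw
      refine ⟨_, (he.mem_latticeIdeal h' _).2 ⟨v * (a * x - b * y), v * (d * y - c * x), rfl⟩, ?_⟩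
      simp only [map_mul, map_sub]
      linear_combination (algebraMap R S v * (algebraMap R S d * algebraMap R S y -
        algebraMap R S c * algebraMap R S x)) * hg + (algebraMap R S t' *
        (algebraMap R S t * algebraMap R S x + (e + algebraMap R S s) * algebraMap R S y)) * hv'
    · rintro ⟨w, hw, rfl⟩
      obtain ⟨x, y, rfl⟩ := (he.mem_latticeIdeal h' w).1 hw
      refine ⟨_, (he.mem_latticeIdeal h _).2 ⟨d * x + b * y, c * x + a * y, rfl⟩, ?_⟩
      simp only [map_mul, map_add]
      linear_combination (-algebraMap R S y) * hg

end IsEtaleGenerator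

end QuadraticLattice

end DrinfeldElliptic

/-! ### The integral closure in the constant extension is étale over `A` -/

namespace DrinfeldElliptic

section ConstantExtension

variable {k K L : Type*} [Field k] [Finite k] [Field K] [Field L] [Algebra k K] [Algebra K L]
  [Algebra k L] [IsScalarTower k K L] [Algebra.IsQuadraticExtension K L] {ε : L}

lemma IsQuadConst.exists_coordinates (hK : IsFunctionField k K) (hε : IsQuadConst k ε) (x : L) :
    ∃ a b : K, x = algebraMap K L a + algebraMap K L b * ε := by
  have hli : LinearIndependent K ![1, ε] := by
    rw [LinearIndependent.pair_iff]
    intro a b hab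
    rw [Algebra.smul_def, Algebra.smul_def, mul_one] at hab
    have hb : b = 0 := by
      by_contra hb
      refine hε.notMem_range_of_constants hK ⟨-a / b, ?_⟩
      have hb' : algebraMap K L b ≠ 0 := by simpa using hb
      rw [map_div₀, map_neg, div_eq_iff hb']
      linear_combination -hab
    rw [hb, map_zero, zero_mul, add_zero, map_eq_zero] at hab
    exact ⟨hab, hb⟩
  have hspan := hli.span_eq_top_of_card_eq_finrank
    (by rw [Algebra.IsQuadraticExtension.finrank_eq_two K L]; rfl)
  have hx : x ∈ Submodule.span K (Set.range ![1, ε]) := hspan ▸ Submodule.mem_top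
  rw [Matrix.range_cons, Matrix.range_cons, Matrix.range_empty, Set.union_empty,
    Set.singleton_union, Submodule.mem_span_pair] at hx
  obtain ⟨a, b, rfl⟩ := hx
  exact ⟨a, b, by rw [Algebra.smul_def, Algebra.smul_def, mul_one]⟩

lemma IsQuadConst.eq_zero_of_add_mul_eq_zero (hK : IsFunctionField k K) (hε : IsQuadConst k ε)
    {a b : K} (h : algebraMap K L a + algebraMap K L b * ε = 0) : a = 0 ∧ b = 0 := by
  have hb : b = 0 := by
    by_contra hb
    refine hε.notMem_range_of_constants hK ⟨-a / b, ?_⟩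
    have hb' : algebraMap K L b ≠ 0 := by simpa using hb
    rw [map_div₀, map_neg, div_eq_iff hb']
    linear_combination -h
  rw [hb, map_zero, zero_mul, add_zero, map_eq_zero] at h
  exact ⟨h, hb⟩

variable (inf : Place k K)

instance : IsScalarTower k (ringA inf) L :=
  IsScalarTower.of_algebraMap_eq fun a => IsScalarTower.algebraMap_apply k K L a

instance : IsScalarTower (ringA inf) K L := IsScalarTower.of_algebraMap_eq fun _ => rfl

instance : IsScalarTower (ringA inf) (ringAt L inf) L := IsScalarTower.of_algebraMap_eq fun _ => rfl

instance : IsIntegralClosure (ringAt L inf) (ringA inf) L := integralClosure.isIntegralClosure _ _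

instance : Module.IsTorsionFree (ringA inf) (ringAt L inf) := by
  rw [Module.isTorsionFree_iff_algebraMap_injective]
  intro x y h
  exact Subtype.ext ((algebraMap K L).injective (congrArg Subtype.val h))

lemma IsQuadConst.isIntegral_ringA (hε : IsQuadConst k ε) : IsIntegral (ringA inf) ε :=
  hε.isIntegral.tower_top

/-- The conjugation of `L / K` on `Ã`. -/
abbrev conjRingAt (σ : L ≃ₐ[K] L) : ringAt L inf ≃ₐ[ringA inf] ringAt L inf :=
  AlgEquiv.mapIntegralClosure (σ.restrictScalars (ringA inf))

lemma isFractionRing_ringAt [OneVariable k K] (hK : IsFunctionField k K) :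
    IsFractionRing (ringAt L inf) L :=
  have := isFractionRing_ringA hK inf
  IsIntegralClosure.isFractionRing_of_finite_extension (ringA inf) K L _

lemma isDedekindDomain_ringAt [OneVariable k K] (hK : IsFunctionField k K) (hε : IsQuadConst k ε) :
    IsDedekindDomain (ringAt L inf) :=
  have := isFractionRing_ringA hK inf
  have := isDedekindDomain_ringA hK inf
  have := hε.isGalois hK
  IsIntegralClosure.isDedekindDomain (ringA inf) K L _

lemma finite_ringAt [OneVariable k K] (hK : IsFunctionField k K) (hε : IsQuadConst k ε) :
    Module.Finite (ringA inf) (ringAt L inf) :=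
  have := isFractionRing_ringA hK inf
  have := isDedekindDomain_ringA hK inf
  have := hε.isGalois hK
  IsIntegralClosure.finite (ringA inf) K L _

/-- The discriminant `(ε ^ q - ε) ^ 2` is a nonzero constant, so `ε ^ q - ε` is a unit. An integral
`x = a + b ε` therefore has integral `b = (σ x - x) / (ε ^ q - ε)`, and then integral `a`; both lie
in the integrally closed ring `A`. -/
theorem isEtaleGenerator_ringAt [OneVariable k K] (hK : IsFunctionField k K)
    (hε : IsQuadConst k ε) {σ : L ≃ₐ[K] L} (hσ : σ ε = frob k L ε) :
    IsEtaleGenerator (R := ringA inf) (⟨ε, hε.isIntegral_ringA inf⟩ : ringAt L inf)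
      (conjRingAt inf σ) := by
  have hfrac := isFractionRing_ringA hK inf
  have hfrac' := isFractionRing_ringAt (L := L) inf hK
  have hσσ : σ (frob k L ε) = ε := by
    rw [frob_apply, map_pow, hσ, ← frob_apply, hε.frob_frob]
  obtain ⟨T, hT⟩ := hε.exists_trace
  obtain ⟨D, hD⟩ := hε.exists_norm
  obtain ⟨Δ, hΔ⟩ := mem_range_of_frob_eq (k := k) (x := (frob k L ε - ε) ^ 2) (by
    rw [map_pow, map_sub, hε.frob_frob]; ring)
  have hΔ0 : algebraMap k L Δ ≠ 0 := by rw [hΔ]; exact pow_ne_zero 2 hε.sub_ne_zero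
  have hΔ0' : Δ ≠ 0 := by rintro rfl; simp at hΔ0
  have hinv : IsIntegral (ringA inf) (frob k L ε - ε)⁻¹ := by
    have h1 : (frob k L ε - ε)⁻¹ = algebraMap k L Δ⁻¹ * (frob k L ε - ε) := by
      rw [map_inv₀, hΔ]
      field_simp [hε.sub_ne_zero]
    rw [h1]
    have h2 : IsIntegral (ringA inf) (algebraMap k L Δ⁻¹) := (isIntegral_algebraMap (R := k)).tower_top
    exact h2.mul ((hε.frob_mem.isIntegral_ringA inf).sub (hε.isIntegral_ringA inf))
  refine ⟨?_, ?_, ?_, ?_, ?_, ?_⟩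
  · rintro ⟨x, hx⟩
    obtain ⟨a, b, rfl⟩ := hε.exists_coordinates hK x
    have hx' : IsIntegral (ringA inf) (algebraMap K L a + algebraMap K L b * frob k L ε) := by
      have := hx.map (σ.restrictScalars (ringA inf)).toAlgHom
      convert this using 1
      change _ = σ _
      rw [map_add, map_mul, AlgEquiv.commutes, AlgEquiv.commutes, hσ]
    have hb : IsIntegral (ringA inf) (algebraMap K L b) := by
      have : algebraMap K L b = ((algebraMap K L a + algebraMap K L b * frob k L ε) -
          (algebraMap K L a + algebraMap K L b * ε)) * (frob k L ε - ε)⁻¹ := by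
        rw [eq_mul_inv_iff_mul_eq₀ hε.sub_ne_zero]; ring
      rw [this]
      exact (hx'.sub hx).mul hinv
    have ha : IsIntegral (ringA inf) (algebraMap K L a) := by
      have : algebraMap K L a = (algebraMap K L a + algebraMap K L b * ε) - algebraMap K L b * ε := by
        ring
      rw [this]
      exact IsIntegral.sub hx (hb.mul (hε.isIntegral_ringA inf))
    have ha' := mem_ringA_of_isIntegral inf
      ((isIntegral_algebraMap_iff (algebraMap K L).injective).1 ha)
    have hb' := mem_ringA_of_isIntegral inf
      ((isIntegral_algebraMap_iff (algebraMap K L).injective).1 hb)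
    exact ⟨⟨a, ha'⟩, ⟨b, hb'⟩, rfl⟩
  · intro x y h
    obtain ⟨h1, h2⟩ := hε.eq_zero_of_add_mul_eq_zero hK (a := (x : K)) (b := (y : K))
      (congrArg Subtype.val h)
    exact ⟨Subtype.ext h1, Subtype.ext h2⟩
  · refine ⟨algebraMap k _ T, Subtype.ext ?_⟩
    change algebraMap K L (algebraMap k K T) = σ ε + ε
    rw [← IsScalarTower.algebraMap_apply, hσ, hT]
  · refine ⟨algebraMap k _ D, Subtype.ext ?_⟩
    change algebraMap K L (algebraMap k K D) = σ ε * ε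
    rw [← IsScalarTower.algebraMap_apply, hσ, hD]
  · refine IsUnit.of_mul_eq_one ⟨(frob k L ε - ε)⁻¹, hinv⟩ (Subtype.ext ?_)
    change (σ ε - ε) * (frob k L ε - ε)⁻¹ = 1
    rw [hσ, mul_inv_cancel₀ hε.sub_ne_zero]
  · rw [← IsFractionRing.finrank_eq (ringA inf) K (ringAt L inf) L,
      Algebra.IsQuadraticExtension.finrank_eq_two K L]

end ConstantExtension

end DrinfeldElliptic

/-! ### Quadratic constants and the completion at the chosen place -/

namespace DrinfeldElliptic

open Polynomial

/-- An irreducible monic polynomial over a complete nonarchimedean field with integral constant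
coefficient has integral coefficients. -/
lemma norm_coeff_le_one_of_irreducible {F : Type*} [NontriviallyNormedField F] [CompleteSpace F]
    [IsUltrametricDist F] {p : F[X]} (hp : p.Monic) (hirr : Irreducible p) (h0 : ‖p.coeff 0‖ ≤ 1)
    (n : ℕ) : ‖p.coeff n‖ ≤ 1 := by
  obtain ⟨x, hx⟩ := IsAlgClosed.exists_aeval_eq_zero (AlgebraicClosure F) p
    (degree_pos_of_irreducible hirr).ne'
  have hmin : p = minpoly F x := minpoly.eq_of_irreducible_of_monic hirr hx hp
  refine (spectralValue_le_one_iff hp).1 ?_ n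
  -- By completeness the norm of a root is a power of the norm of the constant coefficient, and a
  -- spectral value at most one bounds all coefficients.
  have h1 := spectralNorm.spectralNorm_eq_norm_coeff_zero_rpow F (AlgebraicClosure F) x
  rw [spectralNorm, ← hmin] at h1
  rw [h1]
  exact Real.rpow_le_one (norm_nonneg _) h0 (by positivity)

section Completion

variable {k K : Type*} [Field k] [Field K] [Algebra k K] (inf : Place k K)

lemma norm_toKinf (x : K) : ‖toKinf inf x‖ = inf.abv x :=
  UniformSpace.Completion.norm_coe (E := WithAbs inf.abv) _

lemma Place.abv_le_one_iff (x : K) : inf.abv x ≤ 1 ↔ x ∈ inf.ring := by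
  rw [inf.mem_ring_iff]
  change ((WithZeroMulInt.toNNReal (ne_zero_of_lt one_lt_two) (inf.valuation x) : NNReal) : ℝ) ≤ 1 ↔ _
  rw [← NNReal.coe_one, NNReal.coe_le_coe, WithZeroMulInt.toNNReal_le_one_iff one_lt_two]

lemma Place.abv_lt_one_iff (x : inf.ring) :
    inf.abv x < 1 ↔ x ∈ IsLocalRing.maximalIdeal inf.ring :=
  (IsDiscreteValuationRing.maximalIdeal inf.ring).adicAbv_coe_lt_one_iff one_lt_two x

lemma exists_norm_sub_lt_one (x : Kinf inf) : ∃ y : K, ‖x - toKinf inf y‖ < 1 := by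
  obtain ⟨y, hy⟩ := (UniformSpace.Completion.denseRange_coe (α := WithAbs inf.abv)).exists_dist_lt x
    one_pos
  exact ⟨y.ofAbs, by rw [← dist_eq_norm]; exact hy⟩

variable [Finite k]

/-- At a place of odd degree, the completion contains no element of `𝔽_{q²} - 𝔽_q`. -/
lemma pow_card_eq_of_odd_degree (hinf : Odd inf.degree) {x : Kinf inf}
    (hx : x ^ (Nat.card k ^ 2) = x) : x ^ Nat.card k = x := by
  let : Algebra k (Kinf inf) := ((toKinf inf).comp (algebraMap k K)).toAlgebra
  have hq : 1 < Nat.card k := Finite.one_lt_card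
  have hq2 : 1 < Nat.card k ^ 2 := Nat.one_lt_pow two_ne_zero hq
  have hunit : ∀ u : Kinf inf, u ^ (Nat.card k ^ 2) = u → u ≠ 0 → ‖u‖ = 1 := by
    intro u hu hu0
    have h1 : u ^ (Nat.card k ^ 2 - 1) = 1 := by
      refine mul_left_cancel₀ hu0 ?_
      rw [← pow_succ', Nat.sub_add_cancel hq2.le, hu, mul_one]
    have h2 := congrArg norm h1
    rw [norm_pow, norm_one] at h2
    exact (pow_eq_one_iff_of_nonneg (norm_nonneg u) (by omega)).1 h2
  have hsub : ∀ a b : Kinf inf, ‖a - b‖ ≤ max ‖a‖ ‖b‖ := fun a b => by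
    have := dist_triangle_max a 0 b
    rwa [dist_zero_right, dist_zero_left, dist_eq_norm] at this
  have hadd : ∀ a b : Kinf inf, ‖a‖ < 1 → ‖b‖ < 1 → ‖a - b‖ < 1 := fun a b ha hb =>
    (hsub a b).trans_lt (max_lt ha hb)
  have hpow : ∀ (a : Kinf inf) (n : ℕ), n ≠ 0 → ‖a‖ < 1 → ‖a ^ n‖ < 1 := fun a n hn ha => by
    rw [norm_pow]; exact pow_lt_one₀ (norm_nonneg a) ha hn
  by_contra hne
  have hx1 : ‖x‖ ≤ 1 := by
    by_cases hx0 : x = 0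
    · simp [hx0]
    · exact (hunit x hx hx0).le
  -- Approximating `x` by `y` in `K` moves the question to the residue field of `inf`, which has odd
  -- degree over `k`.
  obtain ⟨y, hy⟩ := exists_norm_sub_lt_one inf x
  set δ := x - toKinf inf y with hδ
  have hyx : toKinf inf y = x - δ := by rw [hδ]; ring
  have hyR : y ∈ inf.ring := by
    rw [← inf.abv_le_one_iff, ← norm_toKinf, hyx]
    exact (hsub _ _).trans (max_le hx1 hy.le)
  have hres : (IsLocalRing.residue inf.ring ⟨y, hyR⟩) ^ (Nat.card k ^ 2) =
      IsLocalRing.residue inf.ring ⟨y, hyR⟩ := by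
    rw [← map_pow, ← sub_eq_zero, ← map_sub, IsLocalRing.residue_eq_zero_iff,
      ← inf.abv_lt_one_iff, ← norm_toKinf]
    change ‖toKinf inf (y ^ (Nat.card k ^ 2) - y)‖ < 1
    have h1 : toKinf inf (y ^ (Nat.card k ^ 2) - y) = δ - δ ^ (Nat.card k ^ 2) := by
      rw [map_sub, map_pow, hyx, ← frob_frob, map_sub, map_sub, frob_frob, frob_frob, hx]
      ring
    rw [h1]
    exact hadd _ _ hy (hpow _ _ (by omega) hy)
  have hres' := frob_eq_of_odd_finrank (k := k) hinf hres
  rw [frob_apply, ← map_pow, ← sub_eq_zero, ← map_sub, IsLocalRing.residue_eq_zero_iff,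
    ← inf.abv_lt_one_iff, ← norm_toKinf] at hres'
  change ‖toKinf inf (y ^ Nat.card k - y)‖ < 1 at hres'
  have h2 : x ^ Nat.card k - x = toKinf inf (y ^ Nat.card k - y) - (δ - δ ^ Nat.card k) := by
    rw [map_sub, map_pow, hyx, ← frob_apply, ← frob_apply, map_sub, frob_apply, frob_apply]
    ring
  have h3 : ‖x ^ Nat.card k - x‖ < 1 := by
    rw [h2]
    exact hadd _ _ hres' (hadd _ _ hy (hpow _ _ (by omega) hy))
  -- If `x ^ q - x` were nonzero, being fixed by the `q²`-power map it would have norm one, but its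
  -- norm is less than one.
  refine h3.ne (hunit _ ?_ (sub_ne_zero.2 hne))
  have hfx : frob k (Kinf inf) (frob k (Kinf inf) x) = x := by rw [frob_frob, hx]
  rw [← frob_apply, ← frob_frob, map_sub, map_sub, hfx]

instance : Algebra k (Cinf inf) := ((algebraMap K (Cinf inf)).comp (algebraMap k K)).toAlgebra

instance : IsScalarTower k K (Cinf inf) := IsScalarTower.of_algebraMap_eq fun _ => rfl

lemma algebraMap_mem_range (x : K) :
    algebraMap K (Cinf inf) x ∈ (Kinf.toCinf inf).fieldRange := ⟨toKinf inf x, rfl⟩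

lemma IsQuadConst.notMem_range_toCinf (hinf : Odd inf.degree) {ε : Cinf inf}
    (hε : IsQuadConst k ε) : ε ∉ Set.range (Kinf.toCinf inf) := by
  rintro ⟨x, rfl⟩
  refine hε.pow_ne ?_
  rw [← map_pow, pow_card_eq_of_odd_degree inf hinf]
  refine (Kinf.toCinf inf).injective ?_
  rw [map_pow, hε.pow_sq]

variable {inf}

/-- A point of `Ω` that satisfies a monic quadratic equation over `A` with constant constant term
is a constant. -/
lemma isQuadConst_of_quadratic (hK : IsFunctionField k K) [OneVariable k K] {T : ringA inf} {D : k}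
    {x : Cinf inf} (hx : x ∉ Set.range (Kinf.toCinf inf))
    (h : x ^ 2 - algebraMap K _ (T : K) * x + algebraMap k _ D = 0) :
    IsQuadConst k x ∧ algebraMap K _ (T : K) = frob k _ x + x := by
  let T' := toKinf inf (T : K)
  let D' := toKinf inf (algebraMap k K D)
  let p : (Kinf inf)[X] := X ^ 2 - C T' * X + C D'
  have hmonic : p.Monic := by simp only [p]; monicity!
  have hdeg : p.natDegree = 2 := by simp only [p]; compute_degree!
  have hirr : Irreducible p := by
    -- A root `r` in `K_∞` would make `x` equal to `r` or to `T - r`, both in `K_∞`.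
    refine irreducible_of_degree_le_three_of_not_isRoot (by simp [hdeg]) fun r hr => ?_
    have h1 : r ^ 2 - T' * r + D' = 0 := by simpa [p] using hr
    have h2 := congrArg (Kinf.toCinf inf) h1
    rw [map_add, map_sub, map_mul, map_pow, map_zero] at h2
    have h3 : (x - Kinf.toCinf inf r) * (x - (Kinf.toCinf inf (T' - r))) = 0 := by
      rw [map_sub]
      change _ = _ at h
      change _ ^ 2 - algebraMap K _ (T : K) * _ + algebraMap k _ D = 0 at h2
      change (x - Kinf.toCinf inf r) * (x - (algebraMap K _ (T : K) - Kinf.toCinf inf r)) = 0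
      linear_combination h - h2
    rcases mul_eq_zero.1 h3 with h4 | h4
    · exact hx ⟨r, (sub_eq_zero.1 h4).symm⟩
    · exact hx ⟨_, (sub_eq_zero.1 h4).symm⟩
  have hD1 : ‖D'‖ ≤ 1 := by
    rw [norm_toKinf, inf.abv_le_one_iff]; exact inf.algebraMap_mem D
  -- The trace becomes integral at `inf`; as an element of `A` it is then a constant.
  have hT := norm_coeff_le_one_of_irreducible hmonic hirr (by simpa [p] using hD1) 1
  have hT1 : ‖T'‖ ≤ 1 := by simpa [p, coeff_X, coeff_C] using hT
  rw [norm_toKinf, inf.abv_le_one_iff] at hT1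
  obtain ⟨u, hu⟩ := mem_range_of_mem_ringA hK inf T hT1
  rw [← hu, ← IsScalarTower.algebraMap_apply] at h ⊢
  have h1 := congrArg (frob k (Cinf inf)) h
  rw [map_add, map_sub, map_mul, map_pow, map_zero, AlgHom.commutes, AlgHom.commutes] at h1
  have hne : frob k _ x ≠ x := fun h2 => by
    obtain ⟨a, rfl⟩ := mem_range_of_frob_eq h2
    exact hx (algebraMap_mem_range inf (algebraMap k K a))
  -- With constant coefficients, Frobenius permutes the roots; it moves `x`, so it sends `x` to the
  -- other root.
  have h2 : (frob k _ x - x) * (frob k _ x + x - algebraMap k _ u) = 0 := by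
    linear_combination h1 - h
  have h3 := sub_eq_zero.1 ((mul_eq_zero.1 h2).resolve_left (sub_ne_zero.2 hne))
  refine ⟨⟨?_, by rwa [← frob_apply]⟩, h3.symm⟩
  have h4 := congrArg (frob k (Cinf inf)) h3
  rw [map_add, AlgHom.commutes, ← h3] at h4
  rw [← frob_frob]
  linear_combination h4

end Completion

end DrinfeldElliptic

/-! ### Elliptic points and their representations -/

namespace DrinfeldElliptic

section EllipticPoints

variable {k K L : Type*} [Field k] [Finite k] [Field K] [Field L] [Algebra k K] [Algebra K L]
  [Algebra k L] [IsScalarTower k K L] [Algebra.IsQuadraticExtension K L] {inf : Place k K}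
  {ι : L →ₐ[K] Cinf inf} {ε : L} {s t : ringA inf} {ω : Omega inf}

lemma map_algebraMap_const (ι : L →ₐ[K] Cinf inf) (a : k) :
    ι (algebraMap k L a) = algebraMap k (Cinf inf) a := by
  rw [IsScalarTower.algebraMap_apply k K L, AlgHom.commutes]; rfl

lemma exists_algebraMap_eq_of_isUnit [OneVariable k K] (hK : IsFunctionField k K) {D : ringA inf}
    (hD : IsUnit D) : ∃ a : k, a ≠ 0 ∧ algebraMap k (ringA inf) a = D := by
  obtain ⟨E, hDE⟩ := hD.exists_right_inv
  have hDE' : (D : K) * E = 1 := congrArg Subtype.val hDE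
  have hD0 : (D : K) ≠ 0 := left_ne_zero_of_mul_eq_one hDE'
  have hE0 : (E : K) ≠ 0 := right_ne_zero_of_mul_eq_one hDE'
  obtain ⟨a, ha⟩ := isUnit_ringA_mem_range hK inf hD0 fun P hP => by
    have h1 := P.ord_mul hD0 hE0
    rw [hDE', P.ord_one] at h1
    have h2 := (P.mem_ring_iff_ord hD0).1 (D.2 P hP)
    have h3 := (P.mem_ring_iff_ord hE0).1 (E.2 P hP)
    omega
  exact ⟨a, by rintro rfl; exact hD0 (by rw [← ha, map_zero]), Subtype.ext ha⟩

/-- The norm condition in the definition of a representation. -/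
def NormCondition (k : Type*) {K L : Type*} [Field k] [Field K] [Field L] [Algebra k K]
    [Algebra K L] {inf : Place k K} (ε : L) (s t : ringA inf) : Prop :=
  ∃ t' : ringA inf, (ε ^ Nat.card k + algebraMap K L s) * (ε + algebraMap K L s)
    = algebraMap K L t * algebraMap K L t'

/-- If `c = 0`, the fixed point equation is linear: it puts `ω` in `K` unless `a = d` and `b = 0`,
and then the matrix is scalar. -/
lemma exists_fixed_equation [OneVariable k K] (hK : IsFunctionField k K) (hω : IsElliptic ω) :
    ∃ (a b c d : ringA inf) (D : k), algebraMap K (Cinf inf) c ≠ 0 ∧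
      algebraMap K (Cinf inf) a * ω.1 + algebraMap K (Cinf inf) b =
        ω.1 * (algebraMap K (Cinf inf) c * ω.1 + algebraMap K (Cinf inf) d) ∧
      algebraMap k (Cinf inf) D = algebraMap K (Cinf inf) a * algebraMap K (Cinf inf) d -
        algebraMap K (Cinf inf) b * algebraMap K (Cinf inf) c := by
  obtain ⟨g, hg, hns⟩ := hω
  have hfix : moebius g ω.1 = ω.1 := congrArg Subtype.val (MulAction.mem_stabilizer_iff.1 hg :)
  rw [moebius, div_eq_iff (denom_ne_zero g ω)] at hfix
  obtain ⟨D, hD0, hD⟩ := exists_algebraMap_eq_of_isUnit hK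
    ((Matrix.isUnit_iff_isUnit_det _).1 g.isUnit)
  rw [Matrix.det_fin_two] at hD
  have hns' : ∀ a : ringA inf, g.val 0 0 = a → g.val 0 1 = 0 → g.val 1 0 = 0 → g.val 1 1 ≠ a := by
    intro a h1 h2 h3 h4
    refine hns a ?_
    rw [Matrix.eta_fin_two g.val, h1, h2, h3, h4]
    ext i j
    fin_cases i <;> fin_cases j <;> simp
  simp only [entry] at hfix
  generalize g.val 0 0 = a at *
  generalize g.val 0 1 = b at *
  generalize g.val 1 0 = c at *
  generalize g.val 1 1 = d at *
  have hmemK : ∀ x : K, algebraMap K (Cinf inf) x ∈ (Kinf.toCinf inf).fieldRange :=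
    algebraMap_mem_range inf
  have hinjA : ∀ x y : ringA inf, algebraMap K (Cinf inf) x = algebraMap K (Cinf inf) y → x = y :=
    fun x y h => Subtype.ext ((algebraMap K (Cinf inf)).injective h)
  have hzero : algebraMap K (Cinf inf) ((0 : ringA inf) : K) = 0 := map_zero _
  refine ⟨a, b, c, d, D, fun hc0 => ?_, hfix, ?_⟩
  · rw [hc0, zero_mul, zero_add] at hfix
    have had : a = d := by
      by_contra had
      have had' : algebraMap K (Cinf inf) d - algebraMap K (Cinf inf) a ≠ 0 :=
        fun h => had (hinjA _ _ (sub_eq_zero.1 h)).symm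
      apply ω.2
      have h1 : ω.1 = algebraMap K (Cinf inf) b /
          (algebraMap K (Cinf inf) d - algebraMap K (Cinf inf) a) := by
        rw [eq_div_iff had']
        linear_combination -hfix
      have h2 : ω.1 ∈ (Kinf.toCinf inf).fieldRange := by
        rw [h1]; exact div_mem (hmemK _) (sub_mem (hmemK _) (hmemK _))
      exact h2
    have hb0 : b = 0 := hinjA _ _ (by
      rw [← had] at hfix
      rw [hzero]
      linear_combination hfix)
    exact hns' a rfl hb0 (hinjA _ _ (by rw [hzero, hc0])) had.symm
  · have h : algebraMap k K D = (a : K) * d - b * c := congrArg Subtype.val hD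
    rw [IsScalarTower.algebraMap_apply k K (Cinf inf), h, map_sub, map_mul, map_mul]

/-- The eigenvalue `x = c ω + d` of the stabilizing matrix is a root of its characteristic
polynomial, whose constant term is constant; so `x` lies in `𝔽_{q²}` and is a combination of `1` and
`ε`. -/
theorem exists_isRepresentation [OneVariable k K] (hK : IsFunctionField k K)
    (hε : IsQuadConst k ε) (hω : IsElliptic ω) :
    ∃ s t : ringA inf, IsRepresentation ι ε s t ω := by
  obtain ⟨a, b, c, d, D, hc0, hfix, hD⟩ := exists_fixed_equation hK hω
  have hmemK : ∀ x : K, algebraMap K (Cinf inf) x ∈ (Kinf.toCinf inf).fieldRange :=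
    algebraMap_mem_range inf
  obtain ⟨x, hx⟩ : ∃ x, x = algebraMap K (Cinf inf) c * ω.1 + algebraMap K (Cinf inf) d := ⟨_, rfl⟩
  have hxK : x ∉ Set.range (Kinf.toCinf inf) := by
    intro h
    apply ω.2
    have h1 : ω.1 = (x - algebraMap K (Cinf inf) d) / algebraMap K (Cinf inf) c := by
      rw [eq_div_iff hc0, hx]; ring
    have h2 : ω.1 ∈ (Kinf.toCinf inf).fieldRange := by
      rw [h1]; exact div_mem (sub_mem h (hmemK _)) (hmemK _)
    exact h2
  have hT : algebraMap K (Cinf inf) ((a + d : ringA inf) : K) =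
      algebraMap K (Cinf inf) a + algebraMap K (Cinf inf) d := map_add _ _ _
  obtain ⟨hxq, hxT⟩ := isQuadConst_of_quadratic hK (T := a + d) (D := D) hxK (by
    rw [hT, hD, hx]
    linear_combination (-algebraMap K (Cinf inf) c) * hfix)
  rw [hT] at hxT
  obtain ⟨u, v, huv⟩ := (hε.map ι.toRingHom).exists_eq hxq.pow_sq
  change x = _ + _ * ι ε at huv
  have hv : v ≠ 0 := by
    rintro rfl
    rw [map_zero, zero_mul, add_zero] at huv
    exact hxK (huv ▸ hmemK (algebraMap k K u))
  have hvC : algebraMap k (Cinf inf) v ≠ 0 := by simpa using hv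
  have huv' : frob k _ x = algebraMap k _ u + algebraMap k _ v * ι ε ^ Nat.card k := by
    rw [huv, map_add, map_mul, AlgHom.commutes, AlgHom.commutes, frob_apply]
  have hcoe : ∀ (r : k) (z : ringA inf), algebraMap K (Cinf inf)
      ((algebraMap k (ringA inf) r * z : ringA inf) : K) =
        algebraMap k (Cinf inf) r * algebraMap K (Cinf inf) z := fun r z => map_mul _ _ _
  have h1 : algebraMap K (Cinf inf) ((algebraMap k (ringA inf) u - d : ringA inf) : K) =
      algebraMap k (Cinf inf) u - algebraMap K (Cinf inf) d := map_sub _ _ _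
  have h2 : algebraMap K (Cinf inf) ((-b : ringA inf) : K) = -algebraMap K (Cinf inf) b :=
    map_neg _ _
  -- Solving `c ω + d = u + v ε` gives `s = (u - d) / v` and `t = c / v`; the norm of `ε + s` is
  -- then `t` times `-b / v`.
  refine ⟨algebraMap k _ v⁻¹ * (algebraMap k _ u - d), algebraMap k _ v⁻¹ * c, ?_, ?_,
    algebraMap k _ v⁻¹ * (-b), ?_⟩
  · intro h0
    have h1 := hcoe v⁻¹ c
    rw [h0] at h1
    change algebraMap K (Cinf inf) 0 = _ at h1
    rw [map_zero, eq_comm, mul_eq_zero, map_inv₀, inv_eq_zero] at h1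
    exact h1.elim hvC hc0
  · rw [map_div₀, map_add, AlgHom.commutes, AlgHom.commutes, hcoe, hcoe, h1, map_inv₀, eq_div_iff
      (mul_ne_zero (inv_ne_zero hvC) hc0)]
    generalize algebraMap k (Cinf inf) v = v at *
    field_simp
    linear_combination huv - hx
  · refine (show Function.Injective ι from ι.toRingHom.injective) ?_
    rw [map_mul, map_mul, map_add, map_add, map_pow, AlgHom.commutes, AlgHom.commutes,
      AlgHom.commutes, hcoe, hcoe, hcoe, h1, h2, map_inv₀]
    rw [huv'] at hxT
    generalize algebraMap k (Cinf inf) v = v at *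
    generalize algebraMap k (Cinf inf) u = u at *
    generalize ι ε = y at *
    generalize y ^ Nat.card k = Y at *
    generalize algebraMap K (Cinf inf) a = a at *
    generalize algebraMap K (Cinf inf) b = b at *
    generalize algebraMap K (Cinf inf) c = c at *
    generalize algebraMap K (Cinf inf) d = d at *
    generalize ω.1 = w at *
    have h3 : (v * Y + (u - d)) * (v * y + (u - d)) = -(c * b) := by
      have h4 : v * y + (u - d) = c * w := by linear_combination hx - huv
      have h5 : v * Y + (u - d) = a - d - c * w := by
        linear_combination -hxT - hx
      rw [h4, h5]
      linear_combination c * hfix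
    field_simp
    linear_combination h3

lemma IsRepresentation.normCondition (h : IsRepresentation ι ε s t ω) : NormCondition k ε s t := h.2.2

lemma isElliptic_of_isRepresentation (hε : IsQuadConst k ε)
    (h : IsRepresentation ι ε s t ω) : IsElliptic ω := by
  obtain ⟨ht, hω, t', ht'⟩ := h
  obtain ⟨T, hT⟩ := hε.exists_trace
  obtain ⟨D, hD⟩ := hε.exists_norm
  rw [← frob_apply] at ht'
  have hD0 : D ≠ 0 := by
    rintro rfl
    rw [map_zero, eq_comm, mul_eq_zero] at hD
    have h1 : ε = 0 := hD.elim (fun h => (map_eq_zero_iff _ (frob k L).toRingHom.injective).1 h) id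
    exact hε.frob_ne (by rw [h1, map_zero])
  have hTK : algebraMap K L (algebraMap k K T) = frob k L ε + ε := by
    rw [← IsScalarTower.algebraMap_apply, hT]
  have hDK : algebraMap K L (algebraMap k K D) = frob k L ε * ε := by
    rw [← IsScalarTower.algebraMap_apply, hD]
  -- The matrix of multiplication by `ε` on the lattice: it sends `(ε + s, t)` to `ε (ε + s, t)`, so
  -- it fixes `ω`, and its determinant is the norm of `ε`.
  let M : Matrix (Fin 2) (Fin 2) (ringA inf) := !![algebraMap k _ T + s, -t'; t, -s]
  have hdet : M.det = algebraMap k _ D := by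
    rw [Matrix.det_fin_two_of]
    refine Subtype.ext ((algebraMap K L).injective ?_)
    change algebraMap K L ((algebraMap k K T + s) * -s - -(t' : K) * t) =
      algebraMap K L (algebraMap k K D)
    simp only [map_sub, map_mul, map_add, map_neg, hTK, hDK]
    linear_combination -ht'
  have hM : IsUnit M.det := by rw [hdet]; exact (isUnit_iff_ne_zero.2 hD0).map _
  have ht0 : algebraMap K L t ≠ 0 := by
    rw [Ne, map_eq_zero]; exact fun h => ht (Subtype.ext h)
  refine ⟨Matrix.GeneralLinearGroup.mk'' M hM, ?_, fun a ha => ht ?_⟩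
  · rw [MulAction.mem_stabilizer_iff]
    refine Subtype.ext ?_
    change moebius _ ω.1 = ω.1
    rw [moebius, div_eq_iff (denom_ne_zero _ ω), hω]
    change algebraMap K _ (algebraMap k K T + s) * _ + algebraMap K _ (-(t' : K)) =
      _ * (algebraMap K _ (t : K) * _ + algebraMap K _ (-(s : K)))
    rw [← ι.commutes, ← ι.commutes, ← ι.commutes, ← ι.commutes, ← map_mul, ← map_mul, ← map_add,
      ← map_add, ← map_mul]
    congr 1
    rw [map_add, map_neg, map_neg, hTK]
    field_simp
    linear_combination ht'
  · have := congrFun (congrFun ha 1) 0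
    simpa [M] using this

/-- If the point were in `K_∞`, so would be `ε`, which the odd degree of `inf` excludes. -/
lemma exists_omega_isRepresentation (hinf : Odd inf.degree) (hε : IsQuadConst k ε)
    (ι : L →ₐ[K] Cinf inf) (ht : t ≠ 0) (h : NormCondition k ε s t) :
    ∃ ω : EllipticElement inf, IsRepresentation ι ε s t ω.1 := by
  have ht0 : algebraMap K L t ≠ 0 := by
    rw [Ne, map_eq_zero]; exact fun h => ht (Subtype.ext h)
  have hmem : ι ((ε + algebraMap K L s) / algebraMap K L t) ∉ Set.range (Kinf.toCinf inf) := by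
    intro h1
    refine (hε.map ι.toRingHom).notMem_range_toCinf inf hinf ?_
    have h2 : ι.toRingHom ε = ι ((ε + algebraMap K L s) / algebraMap K L t) *
        algebraMap K _ (t : K) - algebraMap K _ (s : K) := by
      rw [← ι.commutes, ← ι.commutes, ← map_mul, ← map_sub, div_mul_cancel₀ _ ht0, add_sub_cancel_right]
      rfl
    have h3 : ι.toRingHom ε ∈ (Kinf.toCinf inf).fieldRange := by
      rw [h2]
      exact sub_mem (mul_mem h1 (algebraMap_mem_range inf _)) (algebraMap_mem_range inf _)
    exact h3
  have hrep : IsRepresentation ι ε s t (⟨_, hmem⟩ : Omega inf) := ⟨ht, rfl, h⟩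
  exact ⟨⟨_, isElliptic_of_isRepresentation hε hrep⟩, hrep⟩

/-- Passage from one generator of `𝔽_{q²}` to another. -/
lemma IsRepresentation.change {ε₀ : L} (hε : IsQuadConst k ε) (hε₀ : IsQuadConst k ε₀)
    (h : IsRepresentation ι ε s t ω) : ∃ s₀ t₀ : ringA inf, IsRepresentation ι ε₀ s₀ t₀ ω ∧
      {x | ∃ a b : ringA inf, x = algebraMap K L t₀ * algebraMap K L a +
        (ε₀ + algebraMap K L s₀) * algebraMap K L b} =
      {x | ∃ a b : ringA inf, x = algebraMap K L t * algebraMap K L a +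
        (ε + algebraMap K L s) * algebraMap K L b} := by
  obtain ⟨ht, hω, t', ht'⟩ := h
  obtain ⟨u, v, huv⟩ := hε₀.exists_eq hε.pow_sq
  have hv : v ≠ 0 := by
    rintro rfl
    rw [map_zero, zero_mul, add_zero] at huv
    exact hε.notMem_range ⟨u, huv.symm⟩
  have hvL : algebraMap k L v ≠ 0 := by simpa using hv
  have ht0 : algebraMap K L t ≠ 0 := by
    rw [Ne, map_eq_zero]; exact fun h => ht (Subtype.ext h)
  have huv' : ε ^ Nat.card k = algebraMap k L u + algebraMap k L v * ε₀ ^ Nat.card k := by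
    rw [huv, ← frob_apply, ← frob_apply, map_add, map_mul, AlgHom.commutes, AlgHom.commutes]
  have hcoe : ∀ (r : k) (z : ringA inf), algebraMap K L
      ((algebraMap k (ringA inf) r * z : ringA inf) : K) =
        algebraMap k L r * algebraMap K L z := fun r z => by
    rw [IsScalarTower.algebraMap_apply k K L]; exact map_mul _ _ _
  have hs : algebraMap K L ((s + algebraMap k (ringA inf) u : ringA inf) : K) =
      algebraMap K L s + algebraMap k L u := by
    rw [IsScalarTower.algebraMap_apply k K L]; exact map_add _ _ _
  -- From `ε = u + v ε₀` follows `ω = (ε₀ + (s + u) / v) / (t / v)`; the lattice is only scaled by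
  -- the constant `v⁻¹`, a unit of `A`.
  refine ⟨algebraMap k _ v⁻¹ * (s + algebraMap k _ u), algebraMap k _ v⁻¹ * t, ⟨?_, ?_,
    algebraMap k _ v⁻¹ * t', ?_⟩, ?_⟩
  · intro h0
    have h1 := hcoe v⁻¹ t
    rw [h0] at h1
    change algebraMap K L 0 = _ at h1
    rw [map_zero, eq_comm, mul_eq_zero, map_inv₀, inv_eq_zero] at h1
    exact h1.elim hvL ht0
  · rw [hω, hcoe, hcoe, hs, map_inv₀]
    congr 1
    field_simp
    rw [huv]; ring
  · rw [hcoe, hcoe, hcoe, hs, map_inv₀]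
    rw [huv', huv] at ht'
    field_simp
    linear_combination ht'
  · ext x
    simp only [Set.mem_ofPred_eq]
    constructor
    · rintro ⟨a, b, rfl⟩
      refine ⟨algebraMap k _ v⁻¹ * a, algebraMap k _ v⁻¹ * b, ?_⟩
      rw [hcoe, hcoe, hcoe, hcoe, hs, map_inv₀, huv]
      field_simp
      ring
    · rintro ⟨a, b, rfl⟩
      refine ⟨algebraMap k _ v * a, algebraMap k _ v * b, ?_⟩
      rw [hcoe, hcoe, hcoe, hcoe, hs, map_inv₀, huv]
      field_simp
      ring

end EllipticPoints

end DrinfeldElliptic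

/-! ### The class of an elliptic point, and conjugation -/

namespace DrinfeldElliptic

section ClassOfEllipticPoint

variable {k K L : Type*} [Field k] [Finite k] [Field K] [Field L] [Algebra k K] [Algebra K L]
  [Algebra k L] [IsScalarTower k K L] [Algebra.IsQuadraticExtension K L] {ε : L}
  {σ : L ≃ₐ[K] L} {inf : Place k K} {s t s' t' : ringA inf}

/-- The constant `ε`, as an element of `Ã`. -/
def IsQuadConst.toRingAt (hε : IsQuadConst k ε) (inf : Place k K) : ringAt L inf :=
  ⟨ε, hε.isIntegral_ringA inf⟩

lemma NormCondition.ringAt (hε : IsQuadConst k ε) (hσ : σ ε = frob k L ε)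
    (h : NormCondition k ε s t) : ∃ t' : ringA inf,
      (conjRingAt inf σ (hε.toRingAt inf) + algebraMap _ _ s) *
        (hε.toRingAt inf + algebraMap _ _ s) = algebraMap _ (ringAt L inf) t * algebraMap _ _ t' := by
  obtain ⟨t', ht'⟩ := h
  refine ⟨t', Subtype.ext ?_⟩
  change (σ ε + algebraMap K L s) * (ε + algebraMap K L s) = _
  rw [hσ, frob_apply, ht']
  rfl

lemma normCondition_of_ringAt (hε : IsQuadConst k ε) (hσ : σ ε = frob k L ε)
    (h : ∃ t' : ringA inf, (conjRingAt inf σ (hε.toRingAt inf) + algebraMap _ _ s) *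
        (hε.toRingAt inf + algebraMap _ _ s) =
          algebraMap _ (DrinfeldElliptic.ringAt L inf) t * algebraMap _ _ t') :
    NormCondition k ε s t := by
  obtain ⟨t', ht'⟩ := h
  have h1 : (σ ε + algebraMap K L s) * (ε + algebraMap K L s) = _ := congrArg Subtype.val ht'
  exact ⟨t', by rw [← frob_apply, ← hσ, h1]; rfl⟩

variable [OneVariable k K]

lemma image_latticeIdeal (hK : IsFunctionField k K) (hε : IsQuadConst k ε)
    (hσ : σ ε = frob k L ε) (h : NormCondition k ε s t) :
    (Subtype.val '' (latticeIdeal (hε.toRingAt inf) s t : Set (ringAt L inf)) : Set L) =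
      {x | ∃ a b : ringA inf, x = algebraMap K L t * algebraMap K L a +
        (ε + algebraMap K L s) * algebraMap K L b} := by
  have he : IsEtaleGenerator (R := ringA inf) (hε.toRingAt inf) (conjRingAt inf σ) :=
    isEtaleGenerator_ringAt inf hK hε hσ
  have hmem := he.mem_latticeIdeal (h.ringAt hε hσ)
  ext x
  constructor
  · rintro ⟨z, hz, rfl⟩
    obtain ⟨a, b, hab⟩ := (hmem z).1 hz
    exact ⟨a, b, congrArg Subtype.val hab⟩
  · rintro ⟨a, b, rfl⟩
    exact ⟨_, (hmem _).2 ⟨a, b, rfl⟩, rfl⟩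

variable {ι : L →ₐ[K] Cinf inf} {ω ω' : EllipticElement inf}

variable [IsDedekindDomain (ringA inf)] [IsDedekindDomain (ringAt L inf)]
  [Module.Finite (ringA inf) (ringAt L inf)]

theorem equiv_iff_idealClass_eq (hK : IsFunctionField k K) (hε : IsQuadConst k ε)
    (hσ : σ ε = frob k L ε) (h : IsRepresentation ι ε s t ω.1)
    (h' : IsRepresentation ι ε s' t' ω'.1) :
    ω' ≈ ω ↔ idealClass (latticeIdeal (hε.toRingAt inf) s t) =
      idealClass (latticeIdeal (hε.toRingAt inf) s' t') := by
  have he : IsEtaleGenerator (R := ringA inf) (hε.toRingAt inf) (conjRingAt inf σ) :=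
    isEtaleGenerator_ringAt inf hK hε hσ
  have hcl := he.idealClass_latticeIdeal_eq_iff h.1 h'.1
    (h.normCondition.ringAt hε hσ) (h'.normCondition.ringAt hε hσ)
  refine Iff.trans ?_ hcl.symm
  have hne : ∀ {t : ringA inf}, t ≠ 0 → algebraMap K L t ≠ 0 := fun ht => by
    rw [Ne, map_eq_zero]; exact fun h => ht (Subtype.ext h)
  have ht := hne h.1
  have ht' := hne h'.1
  change (∃ g : ModularGroup inf, g • ω.1 = ω'.1) ↔ _
  refine exists_congr fun g => ?_
  rw [show g • ω.1 = ω'.1 ↔ moebius g ω.1.1 = ω'.1.1 from Subtype.ext_iff]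
  rw [moebius, div_eq_iff (denom_ne_zero g ω.1), h.2.1, h'.2.1]
  simp only [entry]
  rw [← ι.commutes, ← ι.commutes, ← ι.commutes, ← ι.commutes, ← map_mul, ← map_mul, ← map_add,
    ← map_add, ← map_mul, (show Function.Injective ι from ι.toRingHom.injective).eq_iff,
    ← Subtype.val_injective.eq_iff]
  change _ ↔ (ε + algebraMap K L s') * (algebraMap K L (g.val 1 0) * (ε + algebraMap K L s) +
    algebraMap K L (g.val 1 1) * algebraMap K L t) = algebraMap K L t' *
      (algebraMap K L (g.val 0 0) * (ε + algebraMap K L s) +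
        algebraMap K L (g.val 0 1) * algebraMap K L t)
  field_simp
  exact eq_comm

variable (inf) in
/-- The map from elliptic points to the class group of `Ã`. -/
def ellClass (hK : IsFunctionField k K) (hε : IsQuadConst k ε) (ι : L →ₐ[K] Cinf inf) (x : Ell inf) :
    ClassGroup (ringAt L inf) :=
  have h := exists_isRepresentation (ι := ι) hK hε x.out.2
  idealClass (latticeIdeal (hε.toRingAt inf) h.choose h.choose_spec.choose)

lemma ellClass_mk (hK : IsFunctionField k K) (hε : IsQuadConst k ε)
    (hσ : σ ε = frob k L ε) (h : IsRepresentation ι ε s t ω.1) :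
    ellClass inf hK hε ι (Quotient.mk _ ω) = idealClass (latticeIdeal (hε.toRingAt inf) s t) := by
  have h1 := exists_isRepresentation (ι := ι) hK hε (Quotient.mk (ellipticSetoid inf) ω).out.2
  exact ((equiv_iff_idealClass_eq hK hε hσ h h1.choose_spec.choose_spec).1
    (Quotient.mk_out ω)).symm

/-- Injectivity is `equiv_iff_idealClass_eq`. Surjectivity combines the freeness of ideals with
principal norm and the fact that each lattice ideal produces a point of `Ω`. -/
lemma ellClass_bijOn (hK : IsFunctionField k K) (hε : IsQuadConst k ε) (hσ : σ ε = frob k L ε)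
    (hinf : Odd inf.degree) (ι : L →ₐ[K] Cinf inf) :
    Set.BijOn (ellClass inf hK hε ι) Set.univ {c | classNorm (ringA inf) c = 1} := by
  have he : IsEtaleGenerator (R := ringA inf) (hε.toRingAt inf) (conjRingAt inf σ) :=
    isEtaleGenerator_ringAt inf hK hε hσ
  refine ⟨?_, ?_, ?_⟩
  · rintro ⟨ω⟩ -
    obtain ⟨s, t, h⟩ := exists_isRepresentation (ι := ι) hK hε ω.2
    change classNorm _ (ellClass inf hK hε ι (Quotient.mk _ ω)) = 1
    rw [ellClass_mk hK hε hσ h]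
    exact he.classNorm_latticeIdeal h.1 (h.normCondition.ringAt hε hσ)
  · rintro ⟨ω⟩ - ⟨ω'⟩ - heq
    obtain ⟨s, t, h⟩ := exists_isRepresentation (ι := ι) hK hε ω.2
    obtain ⟨s', t', h'⟩ := exists_isRepresentation (ι := ι) hK hε ω'.2
    change ellClass inf hK hε ι (Quotient.mk _ ω) = ellClass inf hK hε ι (Quotient.mk _ ω') at heq
    rw [ellClass_mk hK hε hσ h, ellClass_mk hK hε hσ h'] at heq
    exact (Quotient.sound ((equiv_iff_idealClass_eq hK hε hσ h h').2 heq)).symm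
  · intro c hc
    obtain ⟨s, t, ht, hst, rfl⟩ := he.exists_latticeIdeal hc
    obtain ⟨ω, hω⟩ := exists_omega_isRepresentation hinf hε ι ht
      (normCondition_of_ringAt hε hσ hst)
    exact ⟨Quotient.mk _ ω, trivial, ellClass_mk hK hε hσ hω⟩

lemma IsRepresentation.conj {ω : Omega inf} (hinf : Odd inf.degree) (hε : IsQuadConst k ε)
    (h : IsRepresentation ι ε s t ω) : ∃ ω' : EllipticElement inf,
      IsConjugate ω ω'.1 ∧ IsRepresentation ι (frob k L ε) s t ω'.1 := by
  obtain ⟨ht, hω, t', ht'⟩ := h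
  have hn : NormCondition k (frob k L ε) s t := ⟨t', by
    rw [← frob_apply] at ht' ⊢
    rw [hε.frob_frob, ← ht', mul_comm]⟩
  obtain ⟨ω', hω'⟩ := exists_omega_isRepresentation hinf hε.frob_mem ι ht hn
  have hne : algebraMap K (Cinf inf) t ≠ 0 := by
    rw [Ne, map_eq_zero]; exact fun h => ht (Subtype.ext h)
  refine ⟨ω', ⟨ι ε, (s : K) / t, (t : K)⁻¹, by rw [← map_pow, hε.pow_sq], ?_, ?_⟩, hω'⟩
  · rw [hω, map_div₀, map_add, AlgHom.commutes, AlgHom.commutes, map_div₀, map_inv₀]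
    field_simp
    ring
  · rw [hω'.2.1, map_div₀, map_add, AlgHom.commutes, AlgHom.commutes, map_div₀, map_inv₀,
      frob_apply, map_pow]
    field_simp
    ring

/-- The decomposition in `IsConjugate` is arbitrary; comparing coordinates with respect to `1, ε`
identifies it with `s / t + ε / t`, so the conjugate is unique. -/
lemma IsRepresentation.of_isConjugate {ω ω' : Omega inf} (hK : IsFunctionField k K)
    (hε : IsQuadConst k ε) (h : IsRepresentation ι ε s t ω) (hc : IsConjugate ω ω') :
    IsRepresentation ι (frob k L ε) s t ω' := by
  obtain ⟨ht, hω, t', ht'⟩ := h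
  refine ⟨ht, ?_, t', by
    rw [← frob_apply] at ht' ⊢
    rw [hε.frob_frob, ← ht', mul_comm]⟩
  obtain ⟨ε', a, b, hε', h1, h2⟩ := hc
  obtain ⟨u, v, rfl⟩ := (hε.map ι.toRingHom).exists_eq hε'
  change ω.1 = _ + (_ + _ * ι ε) * _ at h1
  change ω'.1 = _ + (_ + _ * ι ε) ^ _ * _ at h2
  have hinj : Function.Injective ι := ι.toRingHom.injective
  have hne : algebraMap K L t ≠ 0 := by
    rw [Ne, map_eq_zero]; exact fun h => ht (Subtype.ext h)
  rw [hω, ← map_algebraMap_const ι, ← map_algebraMap_const ι, ← ι.commutes, ← ι.commutes,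
    ← map_mul, ← map_add, ← map_mul, ← map_add] at h1
  have h3 := hinj h1
  rw [div_eq_iff hne] at h3
  obtain ⟨h4, h5⟩ := hε.eq_zero_of_add_mul_eq_zero hK
    (a := (a + algebraMap k K u * b) * t - s) (b := algebraMap k K v * b * t - 1) (by
      simp only [map_sub, map_mul, map_add, map_one, ← IsScalarTower.algebraMap_apply]
      linear_combination -h3)
  have h4' := congrArg (algebraMap K L) h4
  have h5' := congrArg (algebraMap K L) h5
  simp only [map_sub, map_mul, map_add, map_one, map_zero, ← IsScalarTower.algebraMap_apply]
    at h4' h5'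
  rw [h2, ← map_algebraMap_const ι, ← map_algebraMap_const ι, ← ι.commutes, ← ι.commutes,
    ← map_mul, ← map_add, ← map_pow, ← map_mul, ← map_add, ← frob_apply]
  congr 1
  rw [eq_div_iff hne, map_add, map_mul, AlgHom.commutes, AlgHom.commutes]
  linear_combination h4' + frob k L ε * h5'

/-- The lattice `t A + (ε ^ q + s) A` is the conjugate of `t A + (ε + s) A`, and conjugation inverts
its class. -/
lemma ellClass_mk_of_isConjugate (hK : IsFunctionField k K) (hε : IsQuadConst k ε)
    (hσ : σ ε = frob k L ε) (h : IsRepresentation ι (frob k L ε) s t ω.1) :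
    ellClass inf hK hε ι (Quotient.mk _ ω) =
      (idealClass (latticeIdeal (hε.toRingAt inf) s t))⁻¹ := by
  have he : IsEtaleGenerator (R := ringA inf) (hε.toRingAt inf) (conjRingAt inf σ) :=
    isEtaleGenerator_ringAt inf hK hε hσ
  obtain ⟨s₀, t₀, h₀, hset⟩ := h.change hε.frob_mem hε
  have hσ' : σ (frob k L ε) = frob k L (frob k L ε) := by
    rw [frob_frob, frob_apply, map_pow, hσ, frob_apply, ← pow_mul, sq]
  have hn : NormCondition k ε s t := by
    obtain ⟨t', ht'⟩ := h.normCondition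
    refine ⟨t', ?_⟩
    rw [← frob_apply] at ht' ⊢
    rw [hε.frob_frob] at ht'
    rw [← ht', mul_comm]
  rw [ellClass_mk hK hε hσ h₀, ← he.idealClass_map_latticeIdeal h.1 (hn.ringAt hε hσ)]
  congr 1
  rw [← image_latticeIdeal hK hε hσ h₀.normCondition,
    ← image_latticeIdeal hK hε.frob_mem hσ' h.normCondition] at hset
  rw [SetLike.coe_injective (Subtype.val_injective.image_injective hset)]
  change _ = Ideal.map (conjRingAt inf σ) (latticeIdeal (hε.toRingAt inf) s t)
  rw [he.map_latticeIdeal, latticeIdeal]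
  congr 3
  exact Subtype.ext (congrArg (· + algebraMap K L s) hσ.symm)

/-- The conjugate point has the inverse class. Since the class determines the orbit, both points are
equivalent exactly when the class equals its inverse. -/
theorem mem_Ell2_iff (hK : IsFunctionField k K) (hε : IsQuadConst k ε) (hσ : σ ε = frob k L ε)
    (hinf : Odd inf.degree) (ι : L →ₐ[K] Cinf inf) (x : Ell inf) :
    x ∈ Ell2 inf ↔ ellClass inf hK hε ι x ^ 2 = 1 := by
  rw [sq, mul_eq_one_iff_eq_inv]
  constructor
  · rintro ⟨ω, ω', rfl, hc, heq⟩
    obtain ⟨s, t, h⟩ := exists_isRepresentation (ι := ι) hK hε ω.2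
    have h' := h.of_isConjugate hK hε hc
    have h0 : (Quotient.mk _ ω' : Ell inf) = Quotient.mk _ ω := Quotient.sound heq
    have h1 := ellClass_mk_of_isConjugate hK hε hσ h'
    rwa [h0, ← ellClass_mk hK hε hσ h] at h1
  · obtain ⟨ω, rfl⟩ := Quotient.exists_rep x
    intro hx
    obtain ⟨s, t, h⟩ := exists_isRepresentation (ι := ι) hK hε ω.2
    obtain ⟨ω', hc, h'⟩ := h.conj hinf hε
    refine ⟨ω, ω', rfl, hc, Quotient.exact ((ellClass_bijOn hK hε hσ hinf ι).injOn trivial trivial ?_)⟩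
    rw [ellClass_mk_of_isConjugate hK hε hσ h', hx, ellClass_mk hK hε hσ h]

lemma ellClass_bijOn_Ell2 (hK : IsFunctionField k K) (hε : IsQuadConst k ε)
    (hσ : σ ε = frob k L ε) (hinf : Odd inf.degree) (ι : L →ₐ[K] Cinf inf) :
    Set.BijOn (ellClass inf hK hε ι) (Ell2 inf) {c | classNorm (ringA inf) c = 1 ∧ c ^ 2 = 1} := by
  have h := ellClass_bijOn hK hε hσ hinf ι
  refine ⟨fun x hx => ⟨h.mapsTo trivial, (mem_Ell2_iff hK hε hσ hinf ι x).1 hx⟩,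
    h.injOn.mono (Set.subset_univ _), fun c hc => ?_⟩
  obtain ⟨x, -, rfl⟩ := h.surjOn hc.1
  exact ⟨x, (mem_Ell2_iff hK hε hσ hinf ι x).2 hc.2, rfl⟩

theorem exists_ideal_eq_ellClass (hK : IsFunctionField k K) (hε : IsQuadConst k ε)
    (hσ : σ ε = frob k L ε) {ε' : L} (hε' : IsQuadConst k ε')
    (h : IsRepresentation ι ε' s t ω.1) :
    ∃ J : Ideal (ringAt L inf), J ≠ ⊥ ∧ (Subtype.val '' (J : Set (ringAt L inf)) : Set L) =
      {x | ∃ a b : ringA inf, x = algebraMap K L t * algebraMap K L a +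
        (ε' + algebraMap K L s) * algebraMap K L b} ∧
      ellClass inf hK hε ι (Quotient.mk _ ω) = idealClass J := by
  have he : IsEtaleGenerator (R := ringA inf) (hε.toRingAt inf) (conjRingAt inf σ) :=
    isEtaleGenerator_ringAt inf hK hε hσ
  obtain ⟨s₀, t₀, h₀, hset⟩ := h.change hε' hε
  exact ⟨latticeIdeal (hε.toRingAt inf) s₀ t₀, he.latticeIdeal_ne_bot h₀.1,
    (image_latticeIdeal hK hε hσ h₀.normCondition).trans hset, ellClass_mk hK hε hσ h₀⟩

end ClassOfEllipticPoint

end DrinfeldElliptic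

/-! ### Ideal classes and divisor classes -/

namespace DrinfeldElliptic

open IsDedekindDomain

section ClassesAndDivisors

variable {k F : Type*} [Field k] [Field F] [Algebra k F] {R : Type*} [CommRing R]
  [IsDedekindDomain R] [Algebra k R] [Algebra R F] [IsScalarTower k R F] [IsFractionRing R F]

lemma idealDivisor_pow {I : Ideal R} (hI : I ≠ ⊥) (n : ℕ) :
    idealDivisor k F (I ^ n) = n • idealDivisor k F I := by
  induction n with
  | zero => rw [pow_zero, Ideal.one_eq_top, idealDivisor_top, zero_smul]
  | succ n ih => rw [pow_succ, idealDivisor_mul (pow_ne_zero n hI) hI, ih, succ_nsmul]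

variable (k F) in
lemma idealClass_eq_iff_exists_ord {I J : Ideal R} (hI : I ≠ ⊥) (hJ : J ≠ ⊥) :
    idealClass I = idealClass J ↔ ∃ x : F, x ≠ 0 ∧ ∀ Q : Place k F, Q.Contains R →
      idealDivisor k F I Q - idealDivisor k F J Q = Q.ord x := by
  have hinj := IsFractionRing.injective R F
  have hne : ∀ {a : R}, a ≠ 0 → algebraMap R F a ≠ 0 := fun ha => (map_ne_zero_iff _ hinj).2 ha
  have hspan : ∀ {a : R}, a ≠ 0 → Ideal.span {a} ≠ ⊥ := fun ha => by simpa using ha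
  rw [idealClass_eq_iff hI hJ]
  constructor
  · rintro ⟨x, y, hx, hy, hxy⟩
    refine ⟨algebraMap R F y / algebraMap R F x, div_ne_zero (hne hy) (hne hx), fun Q hQ => ?_⟩
    have h1 := DFunLike.congr_fun (congrArg (idealDivisor k F) hxy) Q
    rw [idealDivisor_mul (hspan hx) hI, idealDivisor_mul (hspan hy) hJ, Finsupp.add_apply,
      Finsupp.add_apply, idealDivisor_span hx hQ, idealDivisor_span hy hQ] at h1
    rw [Q.ord_div (hne hy) (hne hx)]
    linarith
  · rintro ⟨z, hz, h⟩
    obtain ⟨y, x, hx, rfl⟩ := IsFractionRing.div_surjective (A := R) z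
    have hx0 : x ≠ 0 := nonZeroDivisors.ne_zero hx
    have hy0 : y ≠ 0 := by rintro rfl; simp at hz
    refine ⟨x, y, hx0, hy0, idealDivisor_injective (k := k) (F := F) (mul_ne_zero (hspan hx0) hI)
      (mul_ne_zero (hspan hy0) hJ) ?_⟩
    ext Q
    by_cases hQ : Q.Contains R
    · have h1 := h Q hQ
      rw [Q.ord_div (hne hy0) (hne hx0)] at h1
      rw [idealDivisor_mul (hspan hx0) hI, idealDivisor_mul (hspan hy0) hJ, Finsupp.add_apply,
        Finsupp.add_apply, idealDivisor_span hx0 hQ, idealDivisor_span hy0 hQ]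
      linarith
    · rw [idealDivisor_apply_of_not_contains (mul_ne_zero (hspan hx0) hI) hQ,
        idealDivisor_apply_of_not_contains (mul_ne_zero (hspan hy0) hJ) hQ]

end ClassesAndDivisors

section ClassMap

variable {k K L : Type*} [Field k] [Field K] [Field L] [Algebra k K] [Algebra K L]
  [Algebra k L] [IsScalarTower k K L] [Algebra.IsAlgebraic K L] (inf : Place k K)
  [IsDedekindDomain (ringAt L inf)]

lemma divisorIdealClass_add (D E : Divisor k L) :
    divisorIdealClass inf (D + E) = divisorIdealClass inf D * divisorIdealClass inf E := by
  classical
  refine Finsupp.prod_add_index' (fun Q => ?_) (fun Q m n => ?_)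
  · split_ifs <;> simp
  · split_ifs
    · simp
    · rw [zpow_add]

/-- The class map on divisors, as a homomorphism. -/
def divisorIdealClassHom : Divisor k L →+ Additive (ClassGroup (ringAt L inf)) where
  toFun D := Additive.ofMul (divisorIdealClass inf D)
  map_zero' := by rw [divisorIdealClass, Finsupp.prod_zero_index]; rfl
  map_add' D E := by rw [divisorIdealClass_add]; rfl

variable {inf}

lemma divisorIdealClass_single {Q : Place k L} (hQ : Q.under K ≠ inf) (n : ℤ) :
    divisorIdealClass inf (Finsupp.single Q n) = idealClass (placeIdeal Q hQ) ^ n := by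
  rw [divisorIdealClass, Finsupp.prod_single_index]
  · rw [dif_neg hQ]
  · rw [dif_neg hQ, zpow_zero]

lemma divisorIdealClass_single_of_under_eq {Q : Place k L} (hQ : Q.under K = inf) (n : ℤ) :
    divisorIdealClass inf (Finsupp.single Q n) = 1 := by
  rw [divisorIdealClass, Finsupp.prod_single_index] <;> rw [dif_pos hQ]

lemma Place.contains_ringAt {Q : Place k L} (hQ : Q.under K ≠ inf) : Q.Contains (ringAt L inf) :=
  fun r => ringAt_le hQ r

variable [IsFractionRing (ringAt L inf) L]

lemma divisorIdealClass_idealDivisor (hcon : ∀ Q : Place k L, Q.Contains (ringAt L inf) →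
      Q.under K ≠ inf) {I : Ideal (ringAt L inf)} (hI : I ≠ ⊥) :
    divisorIdealClass inf (idealDivisor k L I) = idealClass I := by
  refine ideal_induction (p := fun I => divisorIdealClass inf (idealDivisor k L I) = idealClass I)
    ?_ ?_ hI
  · rw [idealDivisor_top, idealClass_top, divisorIdealClass, Finsupp.prod_zero_index]
  · intro v J hJ ih
    rw [idealDivisor_mul v.ne_bot hJ, divisorIdealClass_add, ih, idealClass_mul v.ne_bot hJ,
      idealDivisor_prime,
      divisorIdealClass_single (hcon _ (Place.ofPrime_contains v)), zpow_one]
    congr 2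
    exact Place.center_ofPrime (k := k) (F := L) v

/-- A divisor is the difference of two divisors of ideals of `Ã`, up to a multiple of the place
above `inf`. -/
lemma exists_idealDivisor_sub {Qinf : Place k L} (huniq : ∀ Q : Place k L, Q.under K = inf → Q = Qinf)
    (D : Divisor k L) : ∃ I J : Ideal (ringAt L inf), ∃ n : ℤ, I ≠ ⊥ ∧ J ≠ ⊥ ∧
      D = idealDivisor k L I - idealDivisor k L J + Finsupp.single Qinf n := by
  induction D using Finsupp.induction_linear with
  | zero => exact ⟨⊤, ⊤, 0, top_ne_bot, top_ne_bot, by simp⟩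
  | add D E hD hE =>
    obtain ⟨I, J, n, hI, hJ, rfl⟩ := hD
    obtain ⟨I', J', n', hI', hJ', rfl⟩ := hE
    refine ⟨I * I', J * J', n + n', mul_ne_zero hI hI', mul_ne_zero hJ hJ', ?_⟩
    rw [idealDivisor_mul hI hI', idealDivisor_mul hJ hJ', Finsupp.single_add]
    abel
  | single Q n =>
    by_cases hQ : Q.under K = inf
    · exact ⟨⊤, ⊤, n, top_ne_bot, top_ne_bot, by rw [huniq Q hQ]; simp⟩
    · have hc := Place.contains_ringAt hQ
      have h0 := Place.center_ne_bot hc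
      rcases Int.eq_nat_or_neg n with ⟨m, rfl | rfl⟩
      · refine ⟨Place.center hc ^ m, ⊤, 0, pow_ne_zero m h0, top_ne_bot, ?_⟩
        rw [idealDivisor_pow h0, idealDivisor_center, idealDivisor_top, Finsupp.smul_single]
        simp
      · refine ⟨⊤, Place.center hc ^ m, 0, top_ne_bot, pow_ne_zero m h0, ?_⟩
        rw [idealDivisor_pow h0, idealDivisor_center, idealDivisor_top, Finsupp.smul_single]
        simp [Finsupp.single_neg]

end ClassMap

section PlaceAtInfinity

variable {k K L : Type*} [Field k] [Finite k] [Field K] [Field L] [Algebra k K] [Algebra K L]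
  [Algebra k L] [IsScalarTower k K L] [FiniteDimensional K L] [OneVariable k K] [OneVariable k L]
  {inf : Place k K} {Qinf : Place k L}

/-- The place `Qinf` is inert over `inf`. -/
structure IsInertPlace (inf : Place k K) (Qinf : Place k L) : Prop where
  under_eq : Qinf.under K = inf
  inertiaDeg : Qinf.inertiaDeg K = 2
  unique : ∀ Q : Place k L, Q.under K = inf → Q = Qinf

variable (hK : IsFunctionField k K) (hQ : IsInertPlace inf Qinf)

include hQ in
lemma IsInertPlace.degree_eq : Qinf.degree = inf.degree * 2 := by
  rw [← Qinf.degree_under_mul_inertiaDeg (K := K), hQ.under_eq, hQ.inertiaDeg]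

include hK in
lemma under_ne_of_contains (Q : Place k L) (h : Q.Contains (ringAt L inf)) : Q.under K ≠ inf :=
  (contains_ringA_iff hK inf).1 (Place.under_contains (R := ringA inf) h)

variable [IsDedekindDomain (ringA inf)] [IsDedekindDomain (ringAt L inf)]
  [IsFractionRing (ringA inf) K] [IsFractionRing (ringAt L inf) L]

include hK hQ

lemma divisorIdealClass_eq {I J : Ideal (ringAt L inf)} (hI : I ≠ ⊥) (hJ : J ≠ ⊥) (n : ℤ) :
    divisorIdealClass inf (idealDivisor k L I - idealDivisor k L J + Finsupp.single Qinf n) =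
      idealClass I / idealClass J := by
  have hcon := under_ne_of_contains (L := L) (inf := inf) hK
  have h1 := divisorIdealClass_add inf (idealDivisor k L I - idealDivisor k L J) (idealDivisor k L J)
  rw [sub_add_cancel, divisorIdealClass_idealDivisor hcon hI, divisorIdealClass_idealDivisor hcon hJ]
    at h1
  rw [divisorIdealClass_add, divisorIdealClass_single_of_under_eq hQ.under_eq, mul_one, h1,
    mul_div_cancel_right]

lemma sub_add_single_apply {I J : Ideal (ringAt L inf)} (n : ℤ) {Q : Place k L}
    (h : Q.Contains (ringAt L inf)) :
    (idealDivisor k L I - idealDivisor k L J + Finsupp.single Qinf n) Q =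
      idealDivisor k L I Q - idealDivisor k L J Q := by
  have hne : Q ≠ Qinf := fun h' => under_ne_of_contains hK Q h (h' ▸ hQ.under_eq)
  rw [Finsupp.add_apply, Finsupp.sub_apply, Finsupp.single_eq_of_ne hne, add_zero]

lemma divisorIdealClass_eq_one_iff (D : Divisor k L) : divisorIdealClass inf D = 1 ↔
    ∃ x : L, x ≠ 0 ∧ ∀ Q : Place k L, Q.Contains (ringAt L inf) → D Q = Q.ord x := by
  obtain ⟨I, J, n, hI, hJ, rfl⟩ := exists_idealDivisor_sub hQ.unique D
  rw [divisorIdealClass_eq hK hQ hI hJ, div_eq_one, idealClass_eq_iff_exists_ord k L hI hJ]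
  refine exists_congr fun x => and_congr_right fun _ => forall₂_congr fun Q h => ?_
  rw [sub_add_single_apply hK hQ n h]

lemma exists_principal {x : L} (hx : x ≠ 0) : ∃ D : Divisor k L, ∀ Q, D Q = Q.ord x := by
  obtain ⟨a, b, hb, rfl⟩ := IsFractionRing.div_surjective (A := ringAt L inf) x
  have hinj := IsFractionRing.injective (ringAt L inf) L
  have hne : ∀ {a : ringAt L inf}, a ≠ 0 → algebraMap (ringAt L inf) L a ≠ 0 :=
    fun ha => (map_ne_zero_iff _ hinj).2 ha
  have hb0 : b ≠ 0 := nonZeroDivisors.ne_zero hb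
  have ha0 : a ≠ 0 := by rintro rfl; simp at hx
  have hspan : ∀ {a : ringAt L inf}, a ≠ 0 → Ideal.span {a} ≠ ⊥ := fun ha => by simpa using ha
  refine ⟨idealDivisor k L (Ideal.span {a}) - idealDivisor k L (Ideal.span {b}) +
    Finsupp.single Qinf (Qinf.ord (algebraMap _ L a / algebraMap _ L b)), fun Q => ?_⟩
  by_cases hc : Q.Contains (ringAt L inf)
  · rw [sub_add_single_apply hK hQ _ hc, idealDivisor_span ha0 hc, idealDivisor_span hb0 hc,
      Q.ord_div (hne ha0) (hne hb0)]
  · have hQ' : Q = Qinf := hQ.unique Q (by by_contra h; exact hc (Place.contains_ringAt h))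
    rw [Finsupp.add_apply, Finsupp.sub_apply, idealDivisor_apply_of_not_contains (hspan ha0) hc,
      idealDivisor_apply_of_not_contains (hspan hb0) hc, hQ', Finsupp.single_eq_same]
    simp

variable [IsGalois K L]

/-- A trivial class means that `D` agrees with a principal divisor away from `Qinf`. The difference
is a multiple of `Qinf` of degree `0`, hence zero. -/
lemma mem_principalDivisors_of_class_eq_one {D : Divisor k L} (hD : D ∈ degreeZero k L)
    (h : divisorIdealClass inf D = 1) : D ∈ principalDivisors k L := by
  obtain ⟨x, hx, hxD⟩ := (divisorIdealClass_eq_one_iff hK hQ D).1 h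
  obtain ⟨E, hE⟩ := exists_principal hK hQ hx
  have hE0 := divisorDegree_principal_extension hK inf hx hE
  have h1 : D - E = Finsupp.single Qinf (D Qinf - E Qinf) := by
    ext Q
    by_cases hQQ : Q = Qinf
    · rw [hQQ, Finsupp.single_eq_same, Finsupp.sub_apply]
    · rw [Finsupp.single_eq_of_ne hQQ, Finsupp.sub_apply, hE,
        hxD Q (Place.contains_ringAt fun h => hQQ (hQ.unique Q h)), sub_self]
  have h2 := congrArg (divisorDegree k L) h1
  rw [map_sub, hE0, divisorDegree_single, sub_zero, (hD : divisorDegree k L D = 0), eq_comm,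
    mul_eq_zero] at h2
  have h3 := h2.resolve_right (by exact_mod_cast Qinf.degree_pos.ne')
  rw [h3, Finsupp.single_zero, sub_eq_zero] at h1
  exact ⟨x, hx, fun Q => by rw [h1, hE]⟩

variable [Module.Finite (ringA inf) (ringAt L inf)]

lemma divisorNorm_sub_add_single {I J : Ideal (ringAt L inf)} (hI : I ≠ ⊥) (hJ : J ≠ ⊥) (n : ℤ) :
    divisorNorm K (idealDivisor k L I - idealDivisor k L J + Finsupp.single Qinf n) =
      idealDivisor k K (Ideal.relNorm (ringA inf) I) - idealDivisor k K (Ideal.relNorm (ringA inf) J) +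
        Finsupp.single inf (n * 2) := by
  have h1 := divisorNorm_idealDivisor (k := k) (K := K) (L := L) (R := ringA inf) hI
  have h2 := divisorNorm_idealDivisor (k := k) (K := K) (L := L) (R := ringA inf) hJ
  have h3 := divisorNorm_single (K := K) Qinf n
  rw [← divisorNormHom_apply] at *
  rw [map_add, map_sub, h1, h2, h3, hQ.under_eq, hQ.inertiaDeg]
  rfl

lemma classNorm_eq_one {D : Divisor k L} (hD : divisorNorm K D ∈ principalDivisors k K) :
    classNorm (ringA inf) (divisorIdealClass inf D) = 1 := by
  obtain ⟨I, J, n, hI, hJ, rfl⟩ := exists_idealDivisor_sub hQ.unique D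
  obtain ⟨g, hg, hgD⟩ := hD
  rw [divisorIdealClass_eq hK hQ hI hJ, map_div, classNorm_idealClass _ hI,
    classNorm_idealClass _ hJ, div_eq_one, idealClass_eq_iff_exists_ord k K
      (by rwa [Ne, Ideal.relNorm_eq_bot_iff]) (by rwa [Ne, Ideal.relNorm_eq_bot_iff])]
  refine ⟨g, hg, fun P hP => ?_⟩
  rw [← hgD, divisorNorm_sub_add_single hK hQ hI hJ, Finsupp.add_apply, Finsupp.sub_apply,
    Finsupp.single_eq_of_ne ((contains_ringA_iff hK inf).1 hP), add_zero]

/-- Surjectivity on kernels, where the parity of the degree enters: an ideal `J` with norm `(a)` is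
completed at `Qinf` so that its divisor norm becomes the full divisor of `a`. -/
lemma exists_divisor_of_classNorm_eq_one {ε : L} (hε : IsQuadConst k ε) (hinf : Odd inf.degree)
    {c : ClassGroup (ringAt L inf)} (hc : classNorm (ringA inf) c = 1) :
    ∃ D ∈ degreeZero k L, divisorNorm K D ∈ principalDivisors k K ∧
      divisorIdealClass inf D = c := by
  obtain ⟨J, hJ, rfl⟩ := exists_idealClass_eq c
  rw [classNorm_idealClass _ hJ, idealClass_eq_one_iff (by rwa [Ne, Ideal.relNorm_eq_bot_iff])] at hc
  obtain ⟨a, ha, hJa⟩ := hc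
  have haK : (a : K) ≠ 0 := fun h => ha (Subtype.ext h)
  have hspan : Ideal.span {a} ≠ ⊥ := by simpa using ha
  have hdiv : ∀ P : Place k K, (idealDivisor k K (Ideal.span {a}) +
      Finsupp.single inf (inf.ord (a : K))) P = P.ord (a : K) := by
    intro P
    by_cases hP : P = inf
    · rw [Finsupp.add_apply, idealDivisor_apply_of_not_contains hspan
        (fun h => (contains_ringA_iff hK inf).1 h hP), hP, Finsupp.single_eq_same, zero_add]
    · rw [Finsupp.add_apply, idealDivisor_span ha ((contains_ringA_iff hK inf).2 hP),
        Finsupp.single_eq_of_ne hP, add_zero]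
      rfl
  have hdeg := divisorDegree_principal hK inf haK hdiv
  rw [map_add, divisorDegree_single, ← hJa,
    ← divisorNorm_idealDivisor (k := k) (K := K) (L := L) hJ, divisorDegree_divisorNorm] at hdeg
  have heven := even_divisorDegree hε (idealDivisor k L J)
  -- The product formula gives `ord_inf(a) deg(inf) = -deg J`, which is even, while `deg(inf)` is
  -- odd. The inertia degree at `Qinf` is `2`, so `m Qinf` has norm `ord_inf(a) inf`.
  obtain ⟨m, hm⟩ : Even (inf.ord (a : K)) := by
    have h1 : Even (inf.ord (a : K) * (inf.degree : ℤ)) := by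
      rw [show inf.ord (a : K) * (inf.degree : ℤ) = -divisorDegree k L (idealDivisor k L J) by
        linarith]
      exact heven.neg
    rw [Int.even_mul] at h1
    exact h1.resolve_right (by
      rw [Int.even_coe_nat, Nat.not_even_iff_odd]; exact hinf)
  have hnorm := divisorNorm_sub_add_single hK hQ hJ (top_ne_bot (α := Ideal (ringAt L inf))) m
  rw [idealDivisor_top, Ideal.relNorm_top, idealDivisor_top, sub_zero, sub_zero, hJa] at hnorm
  have hcl := divisorIdealClass_eq hK hQ hJ (top_ne_bot (α := Ideal (ringAt L inf))) m
  rw [idealDivisor_top, sub_zero, idealClass_top, div_one] at hcl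
  refine ⟨idealDivisor k L J + Finsupp.single Qinf m, ?_, ⟨(a : K), haK, fun P => ?_⟩, hcl⟩
  · change divisorDegree k L _ = 0
    rw [map_add, divisorDegree_single, hQ.degree_eq]
    rw [hm] at hdeg
    push_cast
    linarith
  · rw [hnorm, ← hdiv, hm]
    congr 3
    ring

end PlaceAtInfinity

end DrinfeldElliptic

/-! ### Comparison of the two kernels and the theorem -/

namespace DrinfeldElliptic

section NormOfClasses

variable {k K L : Type*} [Field k] [Finite k] [Field K] [Field L] [Algebra k K] [Algebra K L]
  [Algebra k L] [IsScalarTower k K L] [FiniteDimensional K L] [IsGalois K L]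
  [OneVariable k K] [OneVariable k L]

lemma divisorNorm_mem_degreeZero {D : Divisor k L} (hD : D ∈ degreeZero k L) :
    divisorNorm K D ∈ degreeZero k K := by
  change divisorDegree k K _ = 0
  rw [divisorDegree_divisorNorm]
  exact hD

lemma divisorNorm_mem_principalDivisors {D : Divisor k L} (hD : D ∈ principalDivisors k L) :
    divisorNorm K D ∈ principalDivisors k K := by
  obtain ⟨x, hx, hxD⟩ := hD
  exact ⟨Algebra.norm K x, Algebra.norm_ne_zero_iff.2 hx, divisorNorm_principal hx hxD⟩

variable (k K L) in
/-- The norm on divisors of degree `0`. -/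
def degreeZeroNorm : degreeZero k L →+ degreeZero k K :=
  ((divisorNormHom k K L).comp (degreeZero k L).subtype).codRestrict (degreeZero k K)
    fun D => divisorNorm_mem_degreeZero D.2

variable (k K L) in
/-- The norm on divisor classes of degree `0`. -/
def cl0Norm : Cl0 k L →+ Cl0 k K :=
  QuotientAddGroup.map _ _ (degreeZeroNorm k K L) fun _ hD => divisorNorm_mem_principalDivisors hD

lemma cl0Norm_mk (D : degreeZero k L) : cl0Norm k K L (Cl0.mk D) =
    Cl0.mk ⟨divisorNorm K (D : Divisor k L), divisorNorm_mem_degreeZero D.2⟩ := rfl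

lemma Cl0.mk_eq_zero_iff {F : Type*} [Field F] [Algebra k F] (D : degreeZero k F) :
    Cl0.mk D = 0 ↔ (D : Divisor k F) ∈ principalDivisors k F :=
  (QuotientAddGroup.eq_zero_iff D).trans AddSubgroup.mem_addSubgroupOf

lemma cl0Norm_mk_eq_zero_iff (D : degreeZero k L) : cl0Norm k K L (Cl0.mk D) = 0 ↔
    divisorNorm K (D : Divisor k L) ∈ principalDivisors k K :=
  Cl0.mk_eq_zero_iff _

end NormOfClasses

section CanonicalMap

variable {k K L : Type*} [Field k] [Finite k] [Field K] [Field L] [Algebra k K] [Algebra K L]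
  [Algebra k L] [IsScalarTower k K L] [FiniteDimensional K L] [OneVariable k K] [OneVariable k L]
  {inf : Place k K} {Qinf : Place k L} [IsDedekindDomain (ringA inf)]
  [IsDedekindDomain (ringAt L inf)] [IsFractionRing (ringA inf) K] [IsFractionRing (ringAt L inf) L]

/-- The canonical map from the divisor classes of degree `0` to the ideal classes of `Ã`. -/
def cl0ToClassGroup (hK : IsFunctionField k K) (hQ : IsInertPlace inf Qinf) :
    Cl0 k L →+ Additive (ClassGroup (ringAt L inf)) :=
  QuotientAddGroup.lift _ ((divisorIdealClassHom inf).comp (degreeZero k L).subtype) fun D hD => by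
    obtain ⟨x, hx, hxD⟩ := hD
    exact congrArg Additive.ofMul
      ((divisorIdealClass_eq_one_iff hK hQ (D : Divisor k L)).2 ⟨x, hx, fun Q _ => hxD Q⟩)

variable (hK : IsFunctionField k K) (hQ : IsInertPlace inf Qinf)

lemma cl0ToClassGroup_mk (D : degreeZero k L) : cl0ToClassGroup hK hQ (Cl0.mk D) =
    Additive.ofMul (divisorIdealClass inf (D : Divisor k L)) := rfl

variable [IsGalois K L]

lemma cl0ToClassGroup_injective : Function.Injective (cl0ToClassGroup hK hQ) := by
  rw [injective_iff_map_eq_zero]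
  intro c hc
  obtain ⟨D, rfl⟩ := QuotientAddGroup.mk_surjective c
  exact (Cl0.mk_eq_zero_iff D).2 (mem_principalDivisors_of_class_eq_one hK hQ D.2 hc)

variable [Module.Finite (ringA inf) (ringAt L inf)]

/-- Only surjectivity onto the kernel of the norm uses the odd degree directly; the map is injective
on all of `Cl⁰(L)`. -/
theorem cl0ToClassGroup_bijOn {ε : L} (hε : IsQuadConst k ε) (hinf : Odd inf.degree) :
    Set.BijOn (cl0ToClassGroup hK hQ) {c | cl0Norm k K L c = 0}
      {c | classNorm (ringA inf) c.toMul = 1} := by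
  refine ⟨fun c hc => ?_, (cl0ToClassGroup_injective hK hQ).injOn, fun c hc => ?_⟩
  · obtain ⟨D, rfl⟩ := QuotientAddGroup.mk_surjective c
    exact classNorm_eq_one hK hQ ((cl0Norm_mk_eq_zero_iff D).1 hc)
  · obtain ⟨D, hD, hDN, hDc⟩ := exists_divisor_of_classNorm_eq_one hK hQ hε hinf hc
    exact ⟨Cl0.mk ⟨D, hD⟩, (cl0Norm_mk_eq_zero_iff _).2 hDN, congrArg Additive.ofMul hDc⟩

end CanonicalMap

section Prime

variable {k K L : Type*} [Field k] [Field K] [Field L] [Algebra k K] [Algebra K L]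
  [Algebra k L] [IsScalarTower k K L] [FiniteDimensional K L] [IsGalois K L]
  {inf : Place k K} [IsDedekindDomain (ringA inf)]
  [IsDedekindDomain (ringAt L inf)] [IsFractionRing (ringA inf) K] [IsFractionRing (ringAt L inf) L]
  [Module.Finite (ringA inf) (ringAt L inf)]

lemma classNorm_idealClass_prime (Q : Ideal (ringAt L inf)) [Q.IsPrime] (hQ : Q ≠ ⊥) :
    classNorm (ringA inf) (idealClass Q) =
      idealClass (Q.under (ringA inf)) ^ Q.inertiaDeg (ringA inf) := by
  have h0 : Q.under (ringA inf) ≠ ⊥ := by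
    exact Ideal.IsIntegral.comap_ne_bot _ hQ
  rw [classNorm_idealClass _ hQ, relNorm_prime K L Q hQ, idealClass_pow h0]

end Prime

section Lifting

variable {k K L : Type*} [Field k] [Field K] [Field L] [Algebra k K] [Algebra K L]
  [Algebra k L] [IsScalarTower k K L]

lemma exists_algHom_Cinf [Algebra.IsAlgebraic K L] (inf : Place k K) :
    Nonempty (L →ₐ[K] Cinf inf) := by
  let _ : Algebra K (KinfAlg inf) := ((algebraMap (Kinf inf) (KinfAlg inf)).comp (toKinf inf)).toAlgebra
  let f : L →ₐ[K] KinfAlg inf := IsAlgClosed.lift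
  refine ⟨{ (UniformSpace.Completion.coeRingHom (α := KinfAlg inf)).comp f.toRingHom with
    commutes' := fun a => ?_ }⟩
  exact congrArg (UniformSpace.Completion.coeRingHom (α := KinfAlg inf)) (f.commutes a)

end Lifting

section Transfer

variable {X G H : Type*} [AddCommGroup G] [CommGroup H]

/-- A bijection onto a subgroup can be moved along an injective homomorphism. -/
lemma exists_bijOn_lift {Φ : X → H} {Y : Set X} {ψ : G →+ Additive H} {S : Set G} {T : Set H}
    (hψ : Set.BijOn ψ S {c | c.toMul ∈ T}) (hinj : Function.Injective ψ)
    (hΦ : Set.BijOn Φ Set.univ T) (hY : Set.BijOn Φ Y {c | c ∈ T ∧ c ^ 2 = 1}) :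
    ∃ Φ₀ : X → G, (∀ x, (ψ (Φ₀ x)).toMul = Φ x) ∧ Set.BijOn Φ₀ Set.univ S ∧
      Set.BijOn Φ₀ Y {c | c ∈ S ∧ 2 • c = 0} := by
  choose Φ₀ hS hΦ₀ using fun x => hψ.surjOn (hΦ.mapsTo (Set.mem_univ x))
  have h0 : ∀ x, (ψ (Φ₀ x)).toMul = Φ x := hΦ₀
  have hinj₀ : Function.Injective Φ₀ := fun x y h =>
    hΦ.injOn trivial trivial (by rw [← h0, ← h0, h])
  have htwo : ∀ x, 2 • Φ₀ x = 0 ↔ Φ x ^ 2 = 1 := fun x => by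
    rw [← map_eq_zero_iff ψ hinj, map_nsmul, ← h0]
    rfl
  have hsurj : ∀ c ∈ S, ∃ x, Φ₀ x = c := fun c hc => by
    obtain ⟨x, -, hx⟩ := hΦ.surjOn (hψ.mapsTo hc)
    exact ⟨x, hinj ((hΦ₀ x).trans hx)⟩
  refine ⟨Φ₀, h0, ⟨fun x _ => hS x, hinj₀.injOn, fun c hc => ?_⟩,
    fun x hx => ⟨hS x, (htwo x).2 (hY.mapsTo hx).2⟩, hinj₀.injOn, fun c hc => ?_⟩
  · obtain ⟨x, rfl⟩ := hsurj c hc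
    exact ⟨x, trivial, rfl⟩
  · obtain ⟨x, rfl⟩ := hsurj c hc.1
    obtain ⟨y, hy, hxy⟩ := hY.surjOn ⟨hΦ.mapsTo trivial, (htwo x).1 hc.2⟩
    exact ⟨x, hΦ.injOn trivial trivial hxy ▸ hy, rfl⟩

end Transfer

section Main

variable {k K L : Type*} [Field k] [Finite k] [Field K] [Field L] [Algebra k K] [Algebra K L]
  [Algebra k L] [IsScalarTower k K L] [Algebra.IsQuadraticExtension K L] [IsGalois K L]
  [OneVariable k K] [OneVariable k L] {ε : L} {σ : L ≃ₐ[K] L} {inf : Place k K}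

variable [IsDedekindDomain (ringA inf)] [IsDedekindDomain (ringAt L inf)]
  [IsFractionRing (ringA inf) K] [IsFractionRing (ringAt L inf) L]
  [Module.Finite (ringA inf) (ringAt L inf)]

theorem exists_bijOn_cl0 (hK : IsFunctionField k K) (hε : IsQuadConst k ε) (hσ : σ ε = frob k L ε)
    {Qinf : Place k L} (hQ : IsInertPlace inf Qinf) (hinf : Odd inf.degree)
    (ι : L →ₐ[K] Cinf inf) :
    ∃ Φ₀ : Ell inf → Cl0 k L,
      (∀ x, (cl0ToClassGroup hK hQ (Φ₀ x)).toMul = ellClass inf hK hε ι x) ∧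
      Set.BijOn Φ₀ Set.univ {c | cl0Norm k K L c = 0} ∧
      Set.BijOn Φ₀ (Ell2 inf) {c | cl0Norm k K L c = 0 ∧ 2 • c = 0} :=
  exists_bijOn_lift (T := {c | classNorm (ringA inf) c = 1})
    (cl0ToClassGroup_bijOn hK hQ hε hinf) (cl0ToClassGroup_injective hK hQ)
    (ellClass_bijOn hK hε hσ hinf ι) (ellClass_bijOn_Ell2 hK hε hσ hinf ι)

end Main

section Count

universe v w

variable {k : Type*} {K : Type v} {L : Type w} [Field k] [Finite k] [Field K] [Field L]
  [Algebra k K] [Algebra K L]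
  [Algebra k L] [IsScalarTower k K L] [Algebra.IsQuadraticExtension K L] [IsGalois K L]
  [OneVariable k K] [OneVariable k L] {ε : L} {σ : L ≃ₐ[K] L}

lemma exists_isInertPlace (hε : IsQuadConst k ε) {inf : Place k K} (hinf : Odd inf.degree) :
    ∃ Qinf : Place k L, IsInertPlace inf Qinf := by
  obtain ⟨Qinf, h1, h2, h3⟩ := exists_unique_place_above hε hinf
  exact ⟨Qinf, h1, h2, h3⟩

/-- The elliptic points are counted by the kernel of the norm on divisor classes. -/
theorem lift_mk_Ell (hK : IsFunctionField k K) (hε : IsQuadConst k ε) (hσ : σ ε = frob k L ε)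
    {inf : Place k K} (hinf : Odd inf.degree) :
    Cardinal.lift.{w} (Cardinal.mk (Ell inf)) =
        Cardinal.lift.{v} (Cardinal.mk {c | cl0Norm k K L c = 0}) ∧
      Cardinal.lift.{w} (Cardinal.mk (Ell2 inf)) =
        Cardinal.lift.{v} (Cardinal.mk {c | cl0Norm k K L c = 0 ∧ 2 • c = 0}) := by
  have := isDedekindDomain_ringA hK inf
  have := isDedekindDomain_ringAt inf hK hε
  have := isFractionRing_ringA hK inf
  have := isFractionRing_ringAt (L := L) inf hK
  have := finite_ringAt inf hK hε
  obtain ⟨Qinf, hQ⟩ := exists_isInertPlace hε hinf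
  -- Each place needs its own embedding of `L` into `C_∞`; any one serves, since the kernel in
  -- `Cl⁰(L)` refers neither to the embedding nor to the place.
  obtain ⟨ι⟩ := exists_algHom_Cinf (L := L) inf
  obtain ⟨Φ₀, -, h1, h2⟩ := exists_bijOn_cl0 hK hε hσ hQ hinf ι
  exact ⟨Cardinal.lift_mk_eq'.2 ⟨(Equiv.Set.univ _).symm.trans (h1.equiv _)⟩,
    Cardinal.lift_mk_eq'.2 ⟨h2.equiv _⟩⟩

theorem mk_Ell_eq (hK : IsFunctionField k K) (hε : IsQuadConst k ε) (hσ : σ ε = frob k L ε)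
    {inf inf' : Place k K} (hinf : Odd inf.degree) (hinf' : Odd inf'.degree) :
    Cardinal.mk (Ell inf') = Cardinal.mk (Ell inf) ∧
      Cardinal.mk (Ell2 inf') = Cardinal.mk (Ell2 inf) := by
  have h := lift_mk_Ell hK hε hσ hinf
  have h' := lift_mk_Ell hK hε hσ hinf'
  exact ⟨Cardinal.lift_injective (h'.1.trans h.1.symm), Cardinal.lift_injective (h'.2.trans h.2.symm)⟩

end Count

end DrinfeldElliptic

end

open DrinfeldElliptic in
theorem theorem2p8 {k K L : Type*} [Field k] [Finite k] [Field K] [Algebra k K] [Field L]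
    [Algebra K L] [Algebra k L] [IsScalarTower k K L]
    -- `K` is a function field with constant field `k = 𝔽_q`, and `L = 𝔽_{q²} K`
    (hK : IsFunctionField k K) [Algebra.IsQuadraticExtension K L]
    (hL : ∃ ε : L, ε ^ (Nat.card k ^ 2) = ε ∧ ε ∉ Set.range (algebraMap K L))
    -- the place `inf` has odd degree, and `L` is regarded as a subfield of `C_∞` by means of `ι`
    (inf : Place k K) (hinf : Odd inf.degree) (ι : L →ₐ[K] Cinf inf) :
    (∃ (_ : IsDedekindDomain (ringA inf)) (_ : IsDedekindDomain (ringAt L inf))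
      (N : ClassGroup (ringAt L inf) →* ClassGroup (ringA inf))
      (N₀ : Cl0 k L →+ Cl0 k K)
      (ψ : Cl0 k L →+ Additive (ClassGroup (ringAt L inf)))
      (Φ : Ell inf → ClassGroup (ringAt L inf))
      (Φ₀ : Ell inf → Cl0 k L),
      -- `N` is induced by the norm of ideals
      (∀ Q : Ideal (ringAt L inf), Q.IsPrime → Q ≠ ⊥ →
        N (idealClass Q) = idealClass (Q.under (ringA inf)) ^ Q.inertiaDeg (ringA inf)) ∧
      -- `N₀` is induced by the norm of divisors
      (∀ D : degreeZero k L, ∃ h : divisorNorm K (D : Divisor k L) ∈ degreeZero k K,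
        N₀ (Cl0.mk D) = Cl0.mk ⟨divisorNorm K (D : Divisor k L), h⟩) ∧
      -- `ψ` is the canonical map from `Cl⁰(L)` to `Cl(Ã)`
      (∀ D : degreeZero k L,
        ψ (Cl0.mk D) = Additive.ofMul (divisorIdealClass inf (D : Divisor k L))) ∧
      -- `Φ` maps `ω = (ε + s) / t` to the class of the ideal `t A + (ε + s) A` of `Ã`
      (∀ ε : L, ε ^ (Nat.card k ^ 2) = ε → ε ^ Nat.card k ≠ ε →
        ∀ ω : EllipticElement inf,
          (∃ s t : ringA inf, IsRepresentation ι ε s t ω.1) ∧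
          ∀ s t : ringA inf, IsRepresentation ι ε s t ω.1 →
            ∃ J : Ideal (ringAt L inf), J ≠ ⊥ ∧
              (Subtype.val '' (J : Set (ringAt L inf)) : Set L) =
                {x | ∃ a b : ringA inf, x = algebraMap K L t * algebraMap K L a +
                  (ε + algebraMap K L s) * algebraMap K L b} ∧
              Φ (Quotient.mk _ ω) = idealClass J) ∧
      -- the bijections in `Cl(Ã)`
      Set.BijOn Φ Set.univ {c | N c = 1} ∧
      Set.BijOn Φ (Ell2 inf) {c | N c = 1 ∧ c ^ 2 = 1} ∧
      -- the canonical map identifies the two kernels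
      Set.BijOn ψ {c | N₀ c = 0} {c | N c.toMul = 1} ∧
      -- the bijections in `Cl⁰(L)`
      (∀ x : Ell inf, (ψ (Φ₀ x)).toMul = Φ x) ∧
      Set.BijOn Φ₀ Set.univ {c | N₀ c = 0} ∧
      Set.BijOn Φ₀ (Ell2 inf) {c | N₀ c = 0 ∧ 2 • c = 0}) ∧
    -- the cardinalities do not depend on the place
    (∀ inf' : Place k K, Odd inf'.degree →
      Cardinal.mk (Ell inf') = Cardinal.mk (Ell inf) ∧
      Cardinal.mk (Ell2 inf') = Cardinal.mk (Ell2 inf)) := by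
  obtain ⟨ε, hε1, hε2⟩ := hL
  have hε : IsQuadConst k ε := isQuadConst_of_notMem hε1 hε2
  obtain ⟨t, ht, hfin⟩ := hK.exists_finite
  have : OneVariable k K := OneVariable.of_finite ht
  have : OneVariable k L := OneVariable.of_extension (K := K) ht
  have : IsGalois K L := IsQuadConst.isGalois hK hε
  obtain ⟨σ, hσ⟩ := exists_conjugation hK hε
  refine ⟨?_, fun inf' hinf' => mk_Ell_eq hK hε hσ hinf hinf'⟩
  have hA := isDedekindDomain_ringA hK inf
  have hAt := isDedekindDomain_ringAt inf hK hε
  have := isFractionRing_ringA hK inf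
  have := isFractionRing_ringAt (L := L) inf hK
  have := finite_ringAt inf hK hε
  obtain ⟨Qinf, hQ⟩ := exists_isInertPlace hε hinf
  obtain ⟨Φ₀, h0, h1, h2⟩ := exists_bijOn_cl0 hK hε hσ hQ hinf ι
  refine ⟨hA, hAt, classNorm (ringA inf), cl0Norm k K L, cl0ToClassGroup hK hQ,
    ellClass inf hK hε ι, Φ₀, fun Q _ hQ0 => classNorm_idealClass_prime Q hQ0,
    fun D => ⟨_, cl0Norm_mk D⟩, cl0ToClassGroup_mk hK hQ, fun ε' h1 h2 ω => ?_,
    ellClass_bijOn hK hε hσ hinf ι, ellClass_bijOn_Ell2 hK hε hσ hinf ι,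
    cl0ToClassGroup_bijOn hK hQ hε hinf, h0, h1, h2⟩
  have hε' : IsQuadConst k ε' := ⟨h1, h2⟩
  exact ⟨exists_isRepresentation hK hε' ω.2, fun s t h => exists_ideal_eq_ellClass hK hε hσ hε' h⟩
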